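/- Let $\lambda\ge 0$, $1<p<\infty$, and let $\mathbb D=\{z\in\mathbb C:|z|<1\}$. Let $d\sigma_\lambda(z)=c_\lambda|y|^{2\lambda}\,dx\,dy$ ($z=x+iy\in\mathbb D$) with $c_\lambda=\frac{\Gamma(\lambda+2)}{\Gamma(\lambda+1/2)\,\Gamma(1/2)}$, and let $L^p_\lambda(\mathbb D)=L^p(\mathbb D;d\sigma_\lambda)$. A $C^2$ function $f:\mathbb D\to\mathbb C$ is called $\lambda$-analytic if $$D_{\bar z}f(z)=\partial_{\bar z}f(z)-\lambda\,\frac{f(z)-f(\bar z)}{z-\bar z}=0\qquad(z\in\mathbb D),$$ where for real $z$ the quotient is read as its limit value $-i\,\partial_yf(z)$. The $\lambda$-Bergman space $A^p_\lambda(\mathbb D)$ consists of the $\lambda$-analytic functions in $L^p_\lambda(\mathbb D)$, with the norm of $L^p_\lambda(\mathbb D)$. With the Pochhammer symbol $(a)_n=a(a+1)\cdots(a+n-1)$, put, for $n=0,1,2,\dots$, $$\phi_n(z)=\sqrt{\frac{n!}{(2\lambda+1)_n}}\;\sum_{j=0}^{n}\frac{(\lambda)_j(\lambda+1)_{n-j}}{j!\,(n-j)!}\,\bar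 z^{\,j}z^{\,n-j},\qquad K_\lambda(z,w)=\sum_{n=0}^\infty\frac{n+\lambda+1}{\lambda+1}\,\phi_n(z)\,\overline{\phi_n(w)},$$ and let the $\lambda$-Bergman projection be $$(P_\lambda f)(z)=\int_{\mathbb D}f(w)\,K_\lambda(z,w)\,d\sigma_\lambda(w),\qquad z\in\mathbb D.$$ Then $P_\lambda$ is a well-defined bounded linear operator from $L^p_\lambda(\mathbb D)$ onto $A^p_\lambda(\mathbb D)$. That is: the series for $K_\lambda(z,w)$ converges absolutely for all $z,w\in\mathbb D$; for every $f\in L^p_\lambda(\mathbb D)$ and every $z\in\mathbb D$ the integral for $(P_\lambda f)(z)$ converges absolutely, and it is linear in $f$; there is a constant $C$, depending only on $p$ and $\lambda$, such that for every $f\in L^p_\lambda(\mathbb D)$ the function $P_\lambda f$ belongs to $A^p_\lambda(\mathbb D)$ and $\|P_\lambda f\|_{L^p_\lambda(\mathbb D)}\le C\|f\|_{L^p_\lambda(\mathbb D)}$; and for every $g\in A^p_\lambda(\mathbb D)$ there is $f\in L^p_\lambda(\mathbb D)$ with $P_\lambda f=g$ on $\mathbb D$. -/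

import Mathlib

open MeasureTheory
open scoped ComplexConjugate NNReal ENNReal Nat

noncomputable section

namespace LambdaBergman

/-- The open unit disk of the complex plane. -/
def disk : Set ℂ := Metric.ball (0 : ℂ) 1

/-- The Wirtinger derivative `∂f/∂z̄ = (∂f/∂x + i ∂f/∂y) / 2`. -/
def dbar (f : ℂ → ℂ) (z : ℂ) : ℂ :=
  (fderiv ℝ f z 1 + Complex.I * fderiv ℝ f z Complex.I) / 2

/-- The difference quotient `(f(z) - f(z̄)) / (z - z̄)`; on the real axis it is read as the limit
`-i ∂f/∂y` of the quotient along `z ± it`, `t → 0`, which is its continuous extension when `f`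
is continuously differentiable. -/
def reflQuotient (f : ℂ → ℂ) (z : ℂ) : ℂ :=
  if z.im = 0 then -Complex.I * fderiv ℝ f z Complex.I
  else (f z - f (conj z)) / (z - conj z)

/-- The complex Dunkl operator `D_z̄ f = ∂f/∂z̄ - lam (f(z) - f(z̄)) / (z - z̄)`. -/
def dunklBar (lam : ℝ) (f : ℂ → ℂ) (z : ℂ) : ℂ :=
  dbar f z - (lam : ℂ) * reflQuotient f z

/-- A `C²` function on the disk is `lam`-analytic if `D_z̄ f = 0` there. -/
def IsLamAnalytic (lam : ℝ) (f : ℂ → ℂ) : Prop :=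
  ContDiffOn ℝ 2 f disk ∧ ∀ z ∈ disk, dunklBar lam f z = 0

/-- The constant `c = Γ(lam + 2) / (Γ(lam + 1/2) Γ(1/2))`. -/
def normConst (lam : ℝ) : ℝ :=
  Real.Gamma (lam + 2) / (Real.Gamma (lam + 1 / 2) * Real.Gamma (1 / 2))

/-- The measure `dσ(z) = c |y|^(2 lam) dx dy` on the disk, as a measure on `ℂ` carried by the
disk. -/
def sigma (lam : ℝ) : Measure ℂ :=
  (volume.restrict disk).withDensity
    (fun z => ENNReal.ofReal (normConst lam * |z.im| ^ (2 * lam)))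

/-- The Bergman space: the `lam`-analytic functions on the disk that lie in `L^p(σ)`. -/
def bergmanSpace (lam : ℝ) (p : ℝ≥0∞) : Set (ℂ → ℂ) :=
  {f | IsLamAnalytic lam f ∧ MemLp f p (sigma lam)}

/-- The Pochhammer symbol `(a)_n = a (a + 1) ⋯ (a + n - 1)`. -/
def poch (a : ℝ) (n : ℕ) : ℝ := (ascPochhammer ℝ n).eval a

/-- The normalising factor `√(n! / (2 lam + 1)_n)`. -/
def eps (lam : ℝ) (n : ℕ) : ℝ := √((n ! : ℝ) / poch (2 * lam + 1) n)

/-- The basic `lam`-analytic polynomials `φ_n`. -/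
def phi (lam : ℝ) (n : ℕ) (z : ℂ) : ℂ :=
  (eps lam n : ℂ) * ∑ j ∈ Finset.range (n + 1),
    ((poch lam j * poch (lam + 1) (n - j) / ((j ! : ℝ) * ((n - j)! : ℝ)) : ℝ) : ℂ)
      * (conj z) ^ j * z ^ (n - j)

/-- The `n`-th term of the series that defines the Bergman kernel. -/
def kernelTerm (lam : ℝ) (z w : ℂ) (n : ℕ) : ℂ :=
  ((((n : ℝ) + lam + 1) / (lam + 1) : ℝ) : ℂ) * phi lam n z * conj (phi lam n w)

/-- The Bergman kernel `K(z, w)`. -/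
def kernel (lam : ℝ) (z w : ℂ) : ℂ := ∑' n : ℕ, kernelTerm lam z w n

/-- The Bergman projection `(P f)(z) = ∫ f(w) K(z, w) dσ(w)`. -/
def bergmanProj (lam : ℝ) (f : ℂ → ℂ) (z : ℂ) : ℂ :=
  ∫ w, f w * kernel lam z w ∂(sigma lam)

end LambdaBergman

end

/-!
Write `φ_n` for `phi lam n` and `κ` for the total mass `circMass lam` of the circle with the weight
`|sin θ| ^ (2 lam)`.

*Orthogonality.* In polar coordinates the Dunkl equation reads `r ∂_r g = T g` with a first order
operator `T` in the angle. Integration by parts on the weighted circle (`circle_pairing`) shows that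
pairing a solution over the circle of radius `r` with an eigenfunction `η` of the transpose of `T`
gives a multiple of `r ^ μ`, `μ` the eigenvalue (`IsOffReal.circPair_eq`). The functions `conj φ_n`
have the eigenvalues `n`, and the functions `e^{iθ} φ_n` have negative ones, so that the latter are
orthogonal to every solution. Applied to the solutions `φ_m` this gives orthogonality of the `φ_n`;
since both families together are triangular with respect to the exponentials, it also shows that
every solution is a series `∑ a_n φ_n` (`IsOffReal.expansion`). As `φ_n` restricts to a nonzero
multiple of `x ^ n` on the real diameter, solutions are determined by their values there
(`IsOffReal.eq_of_real`).

*Kernels.* The Szegő kernel `S_w = ∑ conj (φ_n w) φ_n` has an elementary closed form on the real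
diameter. For `lam > 0` the function `z ↦ p z / (1 - z w̄)`, where `p` is the integral of
`2 (1 - u) (|1 - z w|² - 4 u Im z Im w) ^ (-lam)` against the symmetric beta distribution, solves the
Dunkl equation and has the same values there, so it equals `S_w` (`szego_eq`). Hence `p ≥ 0` and
`r ∂_r p + lam p ≥ 0` (`exists_szego_numerator`). The Bergman kernel is
`K = S + (lam + 1)⁻¹ r ∂_r S` (`kernel_eq_fderiv_szego`), so that `|K|` is dominated by a combination
of two nonnegative functions, each of which is the real part of a function whose integral over a
circle is known from the mean value property (`norm_kernel_le`). The result is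
`∫ |K(z, r e^{iθ})| |sin θ| ^ (2 lam) dθ ≤ κ / (1 - |z| r)` (`integral_norm_kernel_circle_le`).

*The projection.* Integration in `r` and the Schur test with the weight `(1 - |w|) ^ (-1 / (p q))`,
`q` the conjugate exponent, bound the operator with kernel `|K|` on `L^p`
(`exists_lintegral_kernel_rpow_le`). The projection of `f` is a series in the `φ_n`
(`bergmanProj_eq_tsum`), hence `lam`-analytic, and by orthogonality and the expansion above it is
multiplication by a nonzero constant on the Bergman space (`bergmanProj_eq_const_mul`), whence it is
onto.
-/

namespace LambdaBergman

open Finset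

/-! ### The basic polynomials -/

/-- The binomial coefficient `(lam)_n / n!`, i.e. the `n`-th Taylor coefficient of
`(1 - x) ^ (-lam)`. -/
noncomputable def binA (lam : ℝ) (n : ℕ) : ℝ := poch lam n / (n ! : ℝ)

lemma poch_succ (a : ℝ) (n : ℕ) : poch a (n + 1) = poch a n * (a + n) := by
  simp [poch, ascPochhammer_succ_eval]

lemma poch_succ' (a : ℝ) (n : ℕ) : poch a (n + 1) = a * poch (a + 1) n := by
  simp [poch, ascPochhammer_succ_left]

lemma poch_zero (a : ℝ) : poch a 0 = 1 := by simp [poch]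

lemma binA_zero (a : ℝ) : binA a 0 = 1 := by simp [binA, poch_zero]

lemma poch_nonneg {a : ℝ} (ha : 0 ≤ a) (n : ℕ) : 0 ≤ poch a n := by
  induction n with
  | zero => simp [poch_zero]
  | succ n ih => rw [poch_succ]; positivity

lemma poch_pos {a : ℝ} (ha : 0 < a) (n : ℕ) : 0 < poch a n := by
  induction n with
  | zero => simp [poch_zero]
  | succ n ih => rw [poch_succ]; positivity

lemma binA_nonneg {a : ℝ} (ha : 0 ≤ a) (n : ℕ) : 0 ≤ binA a n :=
  div_nonneg (poch_nonneg ha n) (by positivity)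

lemma binA_pos {a : ℝ} (ha : 0 < a) (n : ℕ) : 0 < binA a n :=
  div_pos (poch_pos ha n) (by positivity)

lemma succ_mul_binA (a : ℝ) (n : ℕ) : ((n : ℝ) + 1) * binA a (n + 1) = (a + n) * binA a n := by
  have : (n ! : ℝ) ≠ 0 := by positivity
  rw [binA, binA, poch_succ, Nat.factorial_succ]; push_cast; field_simp

lemma succ_mul_binA' (a : ℝ) (n : ℕ) : ((n : ℝ) + 1) * binA a (n + 1) = a * binA (a + 1) n := by
  have : (n ! : ℝ) ≠ 0 := by positivity
  rw [binA, binA, poch_succ', Nat.factorial_succ]; push_cast; field_simp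

lemma mul_binA_add_one (a : ℝ) (n : ℕ) : a * binA (a + 1) n = (a + n) * binA a n := by
  rw [← succ_mul_binA', succ_mul_binA]

lemma binA_add_one_sub (a : ℝ) (n : ℕ) :
    binA (a + 1) (n + 1) - binA a (n + 1) = binA (a + 1) n := by
  have h : ((n : ℝ) + 1) ≠ 0 := by positivity
  apply mul_left_cancel₀ h
  rw [mul_sub, succ_mul_binA (a + 1), succ_mul_binA' a]
  ring

/-- A sum `∑ c j k z̄ ^ j z ^ k` over `j + k = n`: the homogeneous polynomials of degree `n` in
`z` and `z̄`. -/
noncomputable def homPoly (c : ℕ → ℕ → ℝ) (n : ℕ) (z : ℂ) : ℂ :=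
  ∑ x ∈ antidiagonal n, (c x.1 x.2 : ℂ) * conj z ^ x.1 * z ^ x.2

lemma mul_homPoly (c : ℕ → ℕ → ℝ) (n : ℕ) (z : ℂ) (d : ℕ → ℕ → ℝ)
    (hd : ∀ j k, d j (k + 1) = c j k) (hd0 : ∀ j, d j 0 = 0) :
    z * homPoly c n z = homPoly d (n + 1) z := by
  rw [homPoly, homPoly, Finset.Nat.sum_antidiagonal_succ', Finset.mul_sum]
  simp only [hd, hd0]
  simp only [Complex.ofReal_zero, zero_mul, zero_add]
  exact Finset.sum_congr rfl fun x _ => by ring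

lemma conj_mul_homPoly (c : ℕ → ℕ → ℝ) (n : ℕ) (z : ℂ) (d : ℕ → ℕ → ℝ)
    (hd : ∀ j k, d (j + 1) k = c j k) (hd0 : ∀ k, d 0 k = 0) :
    conj z * homPoly c n z = homPoly d (n + 1) z := by
  rw [homPoly, homPoly, Finset.Nat.sum_antidiagonal_succ, Finset.mul_sum]
  simp only [hd, hd0]
  simp only [Complex.ofReal_zero, zero_mul, zero_add]
  exact Finset.sum_congr rfl fun x _ => by ring

lemma conj_homPoly (c : ℕ → ℕ → ℝ) (n : ℕ) (z : ℂ) :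
    conj (homPoly c n z) = homPoly (fun j k => c k j) n z := by
  rw [homPoly, homPoly, map_sum, ← Finset.Nat.sum_antidiagonal_swap]
  exact Finset.sum_congr rfl fun x _ => by simp; ring

lemma homPoly_conj (c : ℕ → ℕ → ℝ) (n : ℕ) (z : ℂ) :
    homPoly c n (conj z) = conj (homPoly c n z) := by
  rw [homPoly, homPoly, map_sum]
  exact Finset.sum_congr rfl fun x _ => by simp

lemma homPoly_real_mul (c : ℕ → ℕ → ℝ) (n : ℕ) (r : ℝ) (z : ℂ) :
    homPoly c n (r * z) = r ^ n * homPoly c n z := by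
  rw [homPoly, homPoly, Finset.mul_sum]
  refine Finset.sum_congr rfl fun x hx => ?_
  rw [← mem_antidiagonal.1 hx]
  simp; ring

/-- The coefficients `(lam)_j (lam + 1)_k / (j! k!)` of `z̄ ^ j z ^ k` in the basic polynomials. -/
noncomputable def coefA (lam : ℝ) (j k : ℕ) : ℝ := binA lam j * binA (lam + 1) k

/-- The basic `lam`-analytic polynomials without the normalising factor, written `Q_n` below. -/
noncomputable def basicPoly (lam : ℝ) (n : ℕ) (z : ℂ) : ℂ := homPoly (coefA lam) n z

lemma phi_eq (lam : ℝ) (n : ℕ) (z : ℂ) : phi lam n z = eps lam n * basicPoly lam n z := by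
  rw [phi, basicPoly, homPoly, Finset.Nat.sum_antidiagonal_eq_sum_range_succ_mk]
  congr 1
  refine Finset.sum_congr rfl fun j _ => ?_
  simp only [coefA, binA]
  congr 3
  field_simp

/-- Multiplication by `z` of a basic polynomial, expressed in the two families
`Q_n` and `z̄ conj Q_n`. -/
lemma basicPoly_recursion (lam : ℝ) (n : ℕ) (z : ℂ) :
    (lam + n + 1) * (z * basicPoly lam n z) =
      (n + 1) * basicPoly lam (n + 1) z - lam * (conj z * conj (basicPoly lam n z)) := by
  rw [basicPoly, conj_homPoly, conj_mul_homPoly _ _ _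
    (fun j k => binA lam k * (binA (lam + 1) j - binA lam j)),
    mul_homPoly _ _ _ (fun j k => binA lam j * (binA (lam + 1) k - binA lam k))]
  · rw [basicPoly, homPoly, homPoly, homPoly, mul_sum, mul_sum, mul_sum, ← sum_sub_distrib]
    refine Finset.sum_congr rfl fun x hx => ?_
    obtain ⟨j, k⟩ := x
    have h : j + k = n + 1 := mem_antidiagonal.1 hx
    have h' : (n : ℂ) + 1 = j + k := by exact_mod_cast h.symm
    have e1 : ((lam : ℂ) * (binA (lam + 1) j : ℂ)) = (lam + j) * binA lam j := by
      exact_mod_cast mul_binA_add_one lam j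
    have e2 : ((lam : ℂ) * (binA (lam + 1) k : ℂ)) = (lam + k) * binA lam k := by
      exact_mod_cast mul_binA_add_one lam k
    simp only [coefA]
    push_cast
    rw [add_assoc, h']
    linear_combination (binA lam k * conj z ^ j * z ^ k) * e1 +
      (binA lam j * conj z ^ j * z ^ k) * e2
  · intro j k; simp [coefA, binA_add_one_sub]
  · intro j; simp [binA_zero]
  · intro j k; simp [coefA, binA_add_one_sub]
  · intro j; simp [binA_zero]

/-- The divided difference of `Q_{n + 1}` under reflection; `∂Q_{n + 1}/∂z̄` is `lam` times it. -/
lemma basicPoly_sub_conj (lam : ℝ) (n : ℕ) (z : ℂ) :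
    basicPoly lam (n + 1) z - basicPoly lam (n + 1) (conj z) =
      (z - conj z) * homPoly (fun j k => binA (lam + 1) j * binA (lam + 1) k) n z := by
  rw [basicPoly, basicPoly, homPoly_conj, conj_homPoly, sub_mul, conj_mul_homPoly _ _ _
    (fun j k => (binA (lam + 1) j - binA lam j) * binA (lam + 1) k),
    mul_homPoly _ _ _ (fun j k => binA (lam + 1) j * (binA (lam + 1) k - binA lam k))]
  · rw [homPoly, homPoly, homPoly, homPoly, ← sum_sub_distrib, ← sum_sub_distrib]
    refine Finset.sum_congr rfl fun x hx => ?_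
    simp only [coefA]
    push_cast
    ring
  · intro j k; simp [binA_add_one_sub]
  · intro j; simp [binA_zero]
  · intro j k; simp [binA_add_one_sub]
  · intro j; simp [binA_zero]

lemma basicPoly_conj (lam : ℝ) (n : ℕ) (z : ℂ) :
    basicPoly lam n (conj z) = conj (basicPoly lam n z) := homPoly_conj _ _ _

lemma basicPoly_real_mul (lam : ℝ) (n : ℕ) (r : ℝ) (z : ℂ) :
    basicPoly lam n (r * z) = r ^ n * basicPoly lam n z := homPoly_real_mul _ _ _ _

lemma basicPoly_zero (lam : ℝ) (z : ℂ) : basicPoly lam 0 z = 1 := by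
  simp [basicPoly, homPoly, coefA, binA_zero]

lemma basicPoly_one (lam : ℝ) (n : ℕ) : basicPoly lam n 1 = binA (2 * lam + 1) n := by
  induction n with
  | zero => simp [basicPoly_zero, binA_zero]
  | succ n ih =>
    have h := basicPoly_recursion lam n 1
    have h2 := congrArg Complex.ofReal (succ_mul_binA (2 * lam + 1) n)
    have h3 : ((n : ℂ) + 1) ≠ 0 := by exact_mod_cast Nat.succ_ne_zero n
    apply mul_left_cancel₀ h3
    rw [ih] at h
    simp only [one_mul, map_one, Complex.conj_ofReal] at h
    push_cast at h2
    rw [h2]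
    linear_combination -h

lemma basicPoly_ofReal (lam : ℝ) (n : ℕ) (x : ℝ) :
    basicPoly lam n x = binA (2 * lam + 1) n * x ^ n := by
  have := basicPoly_real_mul lam n x 1
  rw [mul_one] at this
  rw [this, basicPoly_one, mul_comm]

lemma sum_coefA (lam : ℝ) (n : ℕ) :
    ∑ x ∈ antidiagonal n, coefA lam x.1 x.2 = binA (2 * lam + 1) n := by
  have := basicPoly_one lam n
  simp only [basicPoly, homPoly, map_one, one_pow, mul_one] at this
  exact_mod_cast this

lemma coefA_nonneg {lam : ℝ} (hlam : 0 ≤ lam) (j k : ℕ) : 0 ≤ coefA lam j k :=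
  mul_nonneg (binA_nonneg hlam _) (binA_nonneg (by linarith) _)

lemma norm_basicPoly_le {lam : ℝ} (hlam : 0 ≤ lam) (n : ℕ) (z : ℂ) :
    ‖basicPoly lam n z‖ ≤ binA (2 * lam + 1) n * ‖z‖ ^ n := by
  rw [← sum_coefA, sum_mul]
  rw [basicPoly, homPoly]
  refine (norm_sum_le _ _).trans (Finset.sum_le_sum fun x hx => ?_)
  rw [← mem_antidiagonal.1 hx]
  simp only [norm_mul, norm_pow, RCLike.norm_conj, Complex.norm_real, Real.norm_eq_abs,
    abs_of_nonneg (coefA_nonneg hlam _ _), pow_add]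
  exact le_of_eq (by ring)

/-- An exponent of polynomial growth for the basic polynomials; any integer that is at least `2 * lam`
would do. -/
noncomputable def growthExp (lam : ℝ) : ℕ := ⌈2 * lam⌉₊ + 1

lemma binA_le (lam : ℝ) (hlam : 0 ≤ lam) (n : ℕ) :
    binA (2 * lam + 1) n ≤ ((n : ℝ) + 1) ^ growthExp lam := by
  induction n with
  | zero => simp [binA_zero]
  | succ n ih =>
    have h := succ_mul_binA (2 * lam + 1) n
    have hn : (0 : ℝ) < n + 1 := by positivity
    have hm : 2 * lam ≤ growthExp lam := by
      have := Nat.le_ceil (2 * lam)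
      rw [growthExp]; push_cast; linarith
    have hB : (1 + (growthExp lam : ℝ) * (1 / (n + 1))) ≤ (1 + 1 / ((n : ℝ) + 1)) ^ growthExp lam :=
      one_add_mul_le_pow (by have : (0:ℝ) ≤ 1 / ((n : ℝ) + 1) := by positivity
                             linarith) _
    have e : binA (2 * lam + 1) (n + 1) = (1 + 2 * lam * (1 / (n + 1))) * binA (2 * lam + 1) n := by
      field_simp; linarith
    rw [e]
    calc (1 + 2 * lam * (1 / (n + 1))) * binA (2 * lam + 1) n
        ≤ (1 + 1 / ((n : ℝ) + 1)) ^ growthExp lam * ((n : ℝ) + 1) ^ growthExp lam := by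
          refine mul_le_mul (le_trans ?_ hB) ih (binA_nonneg (by linarith) _) (by positivity)
          gcongr
      _ = _ := by
          rw [← mul_pow]; congr 1; push_cast; field_simp

lemma one_le_binA {lam : ℝ} (hlam : 0 ≤ lam) (n : ℕ) : 1 ≤ binA (2 * lam + 1) n := by
  induction n with
  | zero => simp [binA_zero]
  | succ n ih =>
    have h := succ_mul_binA (2 * lam + 1) n
    have hn : (0 : ℝ) < n + 1 := by positivity
    nlinarith

lemma eps_sq {lam : ℝ} (hlam : 0 ≤ lam) (n : ℕ) : eps lam n ^ 2 = (binA (2 * lam + 1) n)⁻¹ := by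
  rw [eps, Real.sq_sqrt, binA, inv_div]
  exact div_nonneg (by positivity) (poch_nonneg (by linarith) n)

lemma eps_pos {lam : ℝ} (hlam : 0 ≤ lam) (n : ℕ) : 0 < eps lam n :=
  Real.sqrt_pos.2 (div_pos (by positivity) (poch_pos (by linarith) n))

lemma eps_le_one {lam : ℝ} (hlam : 0 ≤ lam) (n : ℕ) : eps lam n ≤ 1 := by
  have h := eps_sq hlam n
  have h1 := inv_le_one_of_one_le₀ (one_le_binA hlam n)
  have := eps_pos hlam n
  nlinarith

lemma norm_phi_le {lam : ℝ} (hlam : 0 ≤ lam) (n : ℕ) (z : ℂ) :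
    ‖phi lam n z‖ ≤ ((n : ℝ) + 1) ^ growthExp lam * ‖z‖ ^ n := by
  rw [phi_eq, norm_mul, Complex.norm_real, Real.norm_eq_abs, abs_of_pos (eps_pos hlam n)]
  calc eps lam n * ‖basicPoly lam n z‖ ≤ 1 * (binA (2 * lam + 1) n * ‖z‖ ^ n) :=
        mul_le_mul (eps_le_one hlam n) (norm_basicPoly_le hlam n z) (norm_nonneg _) zero_le_one
    _ ≤ _ := by
        rw [one_mul]
        exact mul_le_mul_of_nonneg_right (binA_le lam hlam n) (by positivity)

lemma phi_conj (lam : ℝ) (n : ℕ) (z : ℂ) : phi lam n (conj z) = conj (phi lam n z) := by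
  simp [phi_eq, basicPoly_conj]

lemma phi_real_mul (lam : ℝ) (n : ℕ) (r : ℝ) (z : ℂ) :
    phi lam n (r * z) = r ^ n * phi lam n z := by
  rw [phi_eq, phi_eq, basicPoly_real_mul]; ring

lemma phi_zero (lam : ℝ) (z : ℂ) : phi lam 0 z = 1 := by
  simp [phi_eq, basicPoly_zero, eps, poch_zero]

lemma phi_ofReal (lam : ℝ) (n : ℕ) (x : ℝ) :
    phi lam n x = (eps lam n * binA (2 * lam + 1) n : ℝ) * x ^ n := by
  rw [phi_eq, basicPoly_ofReal]; push_cast; ring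

lemma summable_growth (m : ℕ) {r : ℝ} (h0 : 0 ≤ r) (hr : r < 1) :
    Summable fun n : ℕ => ((n : ℝ) + 1) ^ m * r ^ n := by
  rcases h0.eq_or_lt with rfl | h0
  · refine summable_of_ne_finset_zero (s := {0}) fun n hn => ?_
    simp at hn; simp [hn]
  have h := (summable_nat_add_iff 1).2 (summable_pow_mul_geometric_of_norm_lt_one m
    (r := r) (by rwa [Real.norm_eq_abs, abs_of_pos h0]))
  refine (h.mul_left r⁻¹).congr fun n => ?_
  rw [pow_succ]; push_cast; field_simp

end LambdaBergman

namespace LambdaBergman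

open Filter Topology

/-! ### Series of homogeneous polynomials in `z` and `z̄` -/

section Series

variable {E : Type} [NormedAddCommGroup E] [NormedSpace ℝ E]

/-- `f` is a finite sum of terms `B (z̄ ^ a z ^ b)` with `a + b = d` and continuous real-linear
maps `B : ℂ → E` whose norms add up to at most `M`. Linear maps, rather than vectors, are used as
coefficients so that the derivative is again of this form. -/
def IsHomBounded (d : ℕ) (M : ℝ) (f : ℂ → E) : Prop :=
  ∃ (ι : Type) (s : Finset ι) (a b : ι → ℕ) (B : ι → ℂ →L[ℝ] E),
    (∀ i ∈ s, a i + b i = d) ∧ ∑ i ∈ s, ‖B i‖ ≤ M ∧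
      ∀ z, f z = ∑ i ∈ s, B i (conj z ^ a i * z ^ b i)

lemma IsHomBounded.nonneg {d : ℕ} {M : ℝ} {f : ℂ → E} (h : IsHomBounded d M f) : 0 ≤ M := by
  obtain ⟨ι, s, a, b, B, -, h2, -⟩ := h
  exact (Finset.sum_nonneg fun i _ => norm_nonneg _).trans h2

lemma IsHomBounded.norm_le {d : ℕ} {M : ℝ} {f : ℂ → E} (h : IsHomBounded d M f) (z : ℂ) :
    ‖f z‖ ≤ M * ‖z‖ ^ d := by
  obtain ⟨ι, s, a, b, B, h1, h2, h3⟩ := h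
  rw [h3]
  calc ‖∑ i ∈ s, B i (conj z ^ a i * z ^ b i)‖ ≤ ∑ i ∈ s, ‖B i‖ * ‖z‖ ^ d := by
        refine norm_sum_le_of_le _ fun i hi => ((B i).le_opNorm _).trans (le_of_eq ?_)
        rw [norm_mul, norm_pow, norm_pow, RCLike.norm_conj, ← pow_add, h1 i hi]
    _ ≤ M * ‖z‖ ^ d := by
        rw [← Finset.sum_mul]
        exact mul_le_mul_of_nonneg_right h2 (by positivity)

/-- For `B : ℂ → E` and `T : ℂ → ℂ` the map `m ↦ (h ↦ B (m * T h))`. -/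
noncomputable def mulComp (B : ℂ →L[ℝ] E) (T : ℂ →L[ℝ] ℂ) : ℂ →L[ℝ] (ℂ →L[ℝ] E) :=
  ((ContinuousLinearMap.compL ℝ ℂ ℂ E).flip T) ∘L
    ((ContinuousLinearMap.compL ℝ ℂ ℂ E B) ∘L (ContinuousLinearMap.mul ℝ ℂ))

lemma mulComp_apply (B : ℂ →L[ℝ] E) (T : ℂ →L[ℝ] ℂ) (m h : ℂ) :
    mulComp B T m h = B (m * T h) := rfl

lemma norm_mulComp_le (B : ℂ →L[ℝ] E) (T : ℂ →L[ℝ] ℂ) (hT : ∀ h, ‖T h‖ ≤ ‖h‖) :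
    ‖mulComp B T‖ ≤ ‖B‖ := by
  refine ContinuousLinearMap.opNorm_le_bound _ (norm_nonneg _) fun m => ?_
  refine ContinuousLinearMap.opNorm_le_bound _ (by positivity) fun h => ?_
  rw [mulComp_apply]
  refine (B.le_opNorm _).trans ?_
  rw [norm_mul, mul_assoc]
  gcongr
  exact hT h

lemma hasFDerivAt_monomial (B : ℂ →L[ℝ] E) (a b : ℕ) (z : ℂ) :
    HasFDerivAt (fun z : ℂ => B (conj z ^ a * z ^ b))
      (mulComp ((a : ℝ) • B) (Complex.conjCLE : ℂ →L[ℝ] ℂ) (conj z ^ (a - 1) * z ^ b) +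
        mulComp ((b : ℝ) • B) (ContinuousLinearMap.id ℝ ℂ) (conj z ^ a * z ^ (b - 1))) z := by
  have h1 : HasFDerivAt (fun z : ℂ => conj z) (Complex.conjCLE : ℂ →L[ℝ] ℂ) z :=
    Complex.conjCLE.hasFDerivAt
  have h2 : HasFDerivAt (fun z : ℂ => z) (ContinuousLinearMap.id ℝ ℂ) z := hasFDerivAt_id z
  have h3 := B.hasFDerivAt.comp z ((h1.pow a).mul (h2.pow b))
  refine h3.congr_fderiv ?_
  ext h
  all_goals
    simp [mulComp_apply, ← map_smul, ← map_add]
    congr 1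
    ring

/-- The class is stable under differentiation, with the degree lowered by one and the bound multiplied
by the degree. -/
lemma IsHomBounded.fderiv {d : ℕ} {M : ℝ} {f : ℂ → E} (h : IsHomBounded d M f) :
    Differentiable ℝ f ∧ IsHomBounded (d - 1) (d * M) (fderiv ℝ f) := by
  classical
  obtain ⟨ι, s, a, b, B, h1, h2, h3⟩ := h
  have hd : ∀ z, HasFDerivAt f (∑ i ∈ s,
      (mulComp ((a i : ℝ) • B i) (Complex.conjCLE : ℂ →L[ℝ] ℂ) (conj z ^ (a i - 1) * z ^ b i) +
        mulComp ((b i : ℝ) • B i) (ContinuousLinearMap.id ℝ ℂ)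
          (conj z ^ a i * z ^ (b i - 1)))) z := by
    intro z
    have : f = fun z => ∑ i ∈ s, B i (conj z ^ a i * z ^ b i) := funext h3
    rw [this]
    exact HasFDerivAt.fun_sum fun i _ => hasFDerivAt_monomial (B i) (a i) (b i) z
  refine ⟨fun z => (hd z).differentiableAt, ι ⊕ ι,
    (s.filter fun i => a i ≠ 0).disjSum (s.filter fun i => b i ≠ 0),
    Sum.elim (fun i => a i - 1) a, Sum.elim b (fun i => b i - 1),
    Sum.elim (fun i => mulComp ((a i : ℝ) • B i) (Complex.conjCLE : ℂ →L[ℝ] ℂ))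
      (fun i => mulComp ((b i : ℝ) • B i) (ContinuousLinearMap.id ℝ ℂ)), ?_, ?_, ?_⟩
  · rintro (i | i) hi
    · simp at hi
      have := h1 i hi.1
      simp; omega
    · simp at hi
      have := h1 i hi.1
      simp; omega
  · rw [Finset.sum_disjSum]
    simp only [Sum.elim_inl, Sum.elim_inr]
    calc _ ≤ ∑ i ∈ s, (a i : ℝ) * ‖B i‖ + ∑ i ∈ s, (b i : ℝ) * ‖B i‖ := by
          refine add_le_add ?_ ?_
          · refine le_trans (Finset.sum_le_sum fun i _ =>
              (norm_mulComp_le _ _ fun h => by simp).trans (le_of_eq (norm_smul _ _)))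
              ((Finset.sum_le_sum_of_subset_of_nonneg (Finset.filter_subset _ s)
                fun i _ _ => by positivity).trans (le_of_eq (by simp)))
          · refine le_trans (Finset.sum_le_sum fun i _ =>
              (norm_mulComp_le _ _ fun h => by simp).trans (le_of_eq (norm_smul _ _)))
              ((Finset.sum_le_sum_of_subset_of_nonneg (Finset.filter_subset _ s)
                fun i _ _ => by positivity).trans (le_of_eq (by simp)))
      _ = d * ∑ i ∈ s, ‖B i‖ := by
          rw [← Finset.sum_add_distrib, Finset.mul_sum]
          refine Finset.sum_congr rfl fun i hi => ?_
          rw [← h1 i hi]; push_cast; ring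
      _ ≤ d * M := by gcongr
  · intro z
    rw [(hd z).fderiv, Finset.sum_disjSum, Finset.sum_add_distrib]
    simp only [Sum.elim_inl, Sum.elim_inr]
    congr 1
    · refine (Finset.sum_filter_of_ne (p := fun i => a i ≠ 0) fun i _ hi h0 => hi ?_).symm
      ext
      all_goals simp [mulComp_apply, h0]
    · refine (Finset.sum_filter_of_ne (p := fun i => b i ≠ 0) fun i _ hi h0 => hi ?_).symm
      ext
      all_goals simp [mulComp_apply, h0]

lemma summable_deriv_bound {M : ℕ → ℝ} {d : ℕ → ℕ} (hM : ∀ i, 0 ≤ M i)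
    (hs : ∀ r : ℝ, 0 < r → r < 1 → Summable fun i => M i * r ^ d i) (r : ℝ) (h0 : 0 < r)
    (h1 : r < 1) : Summable fun i => (d i * M i) * r ^ (d i - 1) := by
  obtain ⟨r', hr1, hr2⟩ := exists_between h1
  have hr0 : 0 < r' := h0.trans hr1
  have hq : r / r' < 1 := (div_lt_one hr0).2 hr1
  obtain ⟨C, hC⟩ := (tendsto_self_mul_const_pow_of_lt_one (by positivity) hq).bddAbove_range
  have hC' : ∀ n : ℕ, (n : ℝ) * (r / r') ^ n ≤ C := fun n => hC ⟨n, rfl⟩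
  refine Summable.of_nonneg_of_le (fun i => ?_) (fun i => ?_) ((hs r' hr0 hr2).mul_left (C / r))
  · have := hM i; positivity
  · rcases Nat.eq_zero_or_pos (d i) with h | h
    · rw [h]
      have : 0 ≤ C := by simpa using hC' 0
      have := hM i
      simp; positivity
    · obtain ⟨k, hk⟩ := Nat.exists_eq_succ_of_ne_zero h.ne'
      have h2 := hC' (d i)
      rw [div_pow, mul_div_assoc', div_le_iff₀ (by positivity)] at h2
      have h3 : r ^ (d i - 1) = r ^ d i / r := by
        rw [hk]; simp [pow_succ]; field_simp
      rw [h3]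
      calc (d i * M i) * (r ^ d i / r) = (d i * r ^ d i) * (M i / r) := by ring
        _ ≤ (C * r' ^ d i) * (M i / r) :=
            mul_le_mul_of_nonneg_right h2 (div_nonneg (hM i) h0.le)
        _ = _ := by ring

variable [CompleteSpace E]

lemma mem_disk {z : ℂ} : z ∈ disk ↔ ‖z‖ < 1 := by simp [disk]

lemma isOpen_disk : IsOpen disk := Metric.isOpen_ball

lemma conj_mem_disk {z : ℂ} : conj z ∈ disk ↔ z ∈ disk := by simp [mem_disk]

/-- Term by term differentiation of a series of homogeneous polynomials. -/
lemma hasFDerivAt_tsum_hom {f : ℕ → ℂ → E} {d : ℕ → ℕ} {M : ℕ → ℝ}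
    (hf : ∀ i, IsHomBounded (d i) (M i) (f i))
    (hs : ∀ r : ℝ, 0 < r → r < 1 → Summable fun i => M i * r ^ d i) {z : ℂ} (hz : z ∈ disk) :
    HasFDerivAt (fun z => ∑' i, f i z) (∑' i, fderiv ℝ (f i) z) z := by
  rw [mem_disk] at hz
  obtain ⟨r, hr1, hr2⟩ := exists_between hz
  have h0 : 0 < r := (norm_nonneg z).trans_lt hr1
  refine hasFDerivAt_tsum_of_isPreconnected (s := Metric.ball (0 : ℂ) r)
    (summable_deriv_bound (fun i => (hf i).nonneg) hs r h0 hr2) Metric.isOpen_ball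
    (convex_ball _ _).isPreconnected (fun i x _ => ((hf i).fderiv.1 x).hasFDerivAt)
    (fun i x hx => ?_) (x₀ := z) (by simpa using hr1) ?_ (by simpa using hr1)
  · refine ((hf i).fderiv.2.norm_le x).trans ?_
    have := (hf i).nonneg
    have hx' : ‖x‖ ≤ r := by simpa using (Metric.mem_ball.1 hx).le
    gcongr
  · refine Summable.of_norm_bounded (hs r h0 hr2) fun i => ((hf i).norm_le z).trans ?_
    have := (hf i).nonneg
    gcongr

end Series

/-- A series of homogeneous polynomials that converges absolutely on the disk is smooth there. -/
lemma contDiffOn_tsum_hom (k : ℕ) : ∀ {E : Type} [NormedAddCommGroup E] [NormedSpace ℝ E]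
    [CompleteSpace E] {f : ℕ → ℂ → E} {d : ℕ → ℕ} {M : ℕ → ℝ}
    (_ : ∀ i, IsHomBounded (d i) (M i) (f i))
    (_ : ∀ r : ℝ, 0 < r → r < 1 → Summable fun i => M i * r ^ d i),
    ContDiffOn ℝ k (fun z => ∑' i, f i z) disk := by
  induction k with
  | zero =>
    intro E _ _ _ f d M hf hs
    simp only [CharP.cast_eq_zero, contDiffOn_zero]
    exact fun z hz => (hasFDerivAt_tsum_hom hf hs hz).continuousAt.continuousWithinAt
  | succ k ih =>
    intro E _ _ _ f d M hf hs
    push_cast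
    rw [contDiffOn_succ_iff_fderiv_of_isOpen isOpen_disk]
    refine ⟨fun z hz => (hasFDerivAt_tsum_hom hf hs hz).differentiableAt.differentiableWithinAt,
      by simp, ?_⟩
    have := ih (fun i => (hf i).fderiv.2)
      (summable_deriv_bound (fun i => (hf i).nonneg) hs)
    exact this.congr fun z hz => (hasFDerivAt_tsum_hom hf hs hz).fderiv

end LambdaBergman

namespace LambdaBergman

open Filter Topology Finset

/-! ### Dunkl analyticity off the real axis -/

/-- A `C¹` function on the disk that satisfies the equation `D_z̄ g = 0` off the real axis. The
equation on the axis then holds by continuity, see `IsOffReal.dunklBar_eq_zero`. -/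
structure IsOffReal (lam : ℝ) (g : ℂ → ℂ) : Prop where
  contDiffOn : ContDiffOn ℝ 1 g disk
  eq_off : ∀ z ∈ disk, z.im ≠ 0 → (z - conj z) * dbar g z = lam * (g z - g (conj z))

lemma sub_conj_ne_zero {z : ℂ} (hz : z.im ≠ 0) : z - conj z ≠ 0 := by
  intro h
  apply hz
  have := congrArg Complex.im h
  simp at this
  linarith

lemma IsLamAnalytic.isOffReal {lam : ℝ} {g : ℂ → ℂ} (h : IsLamAnalytic lam g) :
    IsOffReal lam g := by
  refine ⟨h.1.of_le (by norm_num), fun z hz hi => ?_⟩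
  have := h.2 z hz
  rw [dunklBar, reflQuotient, if_neg hi, sub_eq_zero] at this
  have h2 := sub_conj_ne_zero hi
  rw [this]
  field_simp

lemma IsOffReal.differentiableAt {lam : ℝ} {g : ℂ → ℂ} (h : IsOffReal lam g) {z : ℂ}
    (hz : z ∈ disk) : DifferentiableAt ℝ g z :=
  (h.contDiffOn.differentiableOn one_ne_zero).differentiableAt (isOpen_disk.mem_nhds hz)

lemma IsOffReal.continuousOn_fderiv {lam : ℝ} {g : ℂ → ℂ} (h : IsOffReal lam g) :
    ContinuousOn (fderiv ℝ g) disk :=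
  h.contDiffOn.continuousOn_fderiv_of_isOpen isOpen_disk le_rfl

/-- On the real axis the equation follows by continuity of `∂g/∂z̄`. -/
lemma IsOffReal.dunklBar_eq_zero {lam : ℝ} {g : ℂ → ℂ} (h : IsOffReal lam g) {z : ℂ}
    (hz : z ∈ disk) : dunklBar lam g z = 0 := by
  rw [dunklBar, reflQuotient]
  split_ifs with hi
  swap
  · have := h.eq_off z hz hi
    have h2 := sub_conj_ne_zero hi
    rw [sub_eq_zero, ← mul_div_assoc, eq_div_iff h2, mul_comm]
    exact this
  -- pass to the limit `t → 0` in the equation at `z + t i`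
  have hline : ∀ s : ℝ, HasDerivAt (fun t : ℝ => g (z + (s * t : ℝ) * Complex.I))
      (s * fderiv ℝ g z Complex.I) 0 := by
    intro s
    have h1 : HasDerivAt (fun t : ℝ => z + (s * t : ℝ) * Complex.I) (s * Complex.I) 0 := by
      have := (((hasDerivAt_id (0 : ℝ)).const_mul s).ofReal_comp.mul_const Complex.I).const_add z
      simpa using this
    have h2 : HasFDerivAt g (fderiv ℝ g z) (z + (s * 0 : ℝ) * Complex.I) := by
      simpa using (h.differentiableAt hz).hasFDerivAt
    have := h2.comp_hasDerivAt (0 : ℝ) h1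
    refine this.congr_deriv ?_
    rw [← Complex.real_smul, map_smul, Complex.real_smul]
  have hD := (hline 1).sub (hline (-1))
  have hq := hD.tendsto_slope_zero
  have hpath : Tendsto (fun t : ℝ => z + t * Complex.I) (𝓝[≠] 0) (𝓝 z) := by
    have : Continuous fun t : ℝ => z + t * Complex.I := by fun_prop
    have := this.tendsto 0
    simp only [Complex.ofReal_zero, zero_mul, add_zero] at this
    exact this.mono_left nhdsWithin_le_nhds
  have hfd : Tendsto (fun t : ℝ => fderiv ℝ g (z + t * Complex.I)) (𝓝[≠] 0) (𝓝 (fderiv ℝ g z)) :=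
    (h.continuousOn_fderiv.continuousAt (isOpen_disk.mem_nhds hz)).tendsto.comp hpath
  have hdb : Tendsto (fun t : ℝ => dbar g (z + t * Complex.I)) (𝓝[≠] 0) (𝓝 (dbar g z)) := by
    have e : ∀ v : ℂ, Tendsto (fun t : ℝ => fderiv ℝ g (z + t * Complex.I) v) (𝓝[≠] 0)
        (𝓝 (fderiv ℝ g z v)) := fun v =>
      ((ContinuousLinearMap.apply ℝ ℂ v).continuous.tendsto _).comp hfd
    exact (((e 1).add ((e Complex.I).const_mul Complex.I)).div_const 2)
  have hconj : conj z = z := Complex.conj_eq_iff_im.2 hi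
  have heq : ∀ᶠ t : ℝ in 𝓝[≠] 0, dbar g (z + t * Complex.I) =
      lam * (-Complex.I / 2) * (t⁻¹ • ((g (z + ((1 : ℝ) * (0 + t) : ℝ) * Complex.I)
        - g (z + ((-1 : ℝ) * (0 + t) : ℝ) * Complex.I)) -
        (g (z + ((1 : ℝ) * 0 : ℝ) * Complex.I) - g (z + ((-1 : ℝ) * 0 : ℝ) * Complex.I)))) := by
    filter_upwards [hpath.eventually (isOpen_disk.mem_nhds hz), self_mem_nhdsWithin] with t ht ht0
    have ht0' : (t : ℂ) ≠ 0 := by exact_mod_cast ht0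
    have := h.eq_off _ ht (by simpa [hi] using ht0)
    simp only [map_add, map_mul, hconj, Complex.conj_ofReal, Complex.conj_I] at this
    have e : z + t * Complex.I - (z + t * -Complex.I) = 2 * t * Complex.I := by ring
    rw [e] at this
    simp only [Complex.real_smul]
    push_cast
    have e2 : z + -1 * (0 + (t : ℂ)) * Complex.I = z + t * -Complex.I := by ring
    have e3 : z + 1 * (0 + (t : ℂ)) * Complex.I = z + t * Complex.I := by ring
    rw [e2, e3]
    simp only [mul_zero, zero_mul, add_zero, sub_self, sub_zero]
    have h3 : (2 * t * Complex.I) ≠ 0 := by simp [ht0']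
    apply mul_left_cancel₀ h3
    rw [this]
    field_simp
    ring_nf
    simp
    ring
  have hlim := (hq.const_mul ((lam : ℂ) * (-Complex.I / 2)))
  have := tendsto_nhds_unique (hdb.congr' heq) hlim
  rw [this]
  push_cast
  ring

/-- The real derivative is split into its complex linear and antilinear parts. -/
lemma fderiv_eq_dbar (g : ℂ → ℂ) (z h : ℂ) :
    fderiv ℝ g z h = (fderiv ℝ g z 1 - Complex.I * fderiv ℝ g z Complex.I) / 2 * h +
      dbar g z * conj h := by
  have : h = h.re • (1 : ℂ) + h.im • Complex.I := by
    simp [Complex.re_add_im]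
  have e : fderiv ℝ g z h = h.re * fderiv ℝ g z 1 + h.im * fderiv ℝ g z Complex.I := by
    conv_lhs => rw [this]
    rw [map_add, map_smul, map_smul, Complex.real_smul, Complex.real_smul]
  have hc : conj h = h.re - h.im * Complex.I := by
    apply Complex.ext <;> simp
  rw [e, hc, dbar]
  conv_rhs => rw [show h = h.re + h.im * Complex.I from (Complex.re_add_im h).symm]
  simp only [Complex.add_re, Complex.add_im, Complex.mul_re, Complex.mul_im, Complex.ofReal_re,
    Complex.ofReal_im, Complex.I_re, Complex.I_im, mul_zero, mul_one, sub_zero, add_zero,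
    zero_add]
  linear_combination ((h.im : ℂ) * fderiv ℝ g z Complex.I) * Complex.I_sq

/-- The radial derivative in terms of the angular one and `∂/∂z̄`. -/
lemma fderiv_radial (g : ℂ → ℂ) (z : ℂ) :
    fderiv ℝ g z z = -Complex.I * fderiv ℝ g z (Complex.I * z) + 2 * conj z * dbar g z := by
  rw [fderiv_eq_dbar g z z, fderiv_eq_dbar g z (Complex.I * z)]
  simp only [map_mul, Complex.conj_I]
  linear_combination ((fderiv ℝ g z 1 - Complex.I * fderiv ℝ g z Complex.I) / 2 * z -
    dbar g z * conj z) * Complex.I_sq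

/-! ### The basic polynomials are `lam`-analytic -/

lemma hasFDerivAt_homPoly (c : ℕ → ℕ → ℝ) (n : ℕ) (z : ℂ) :
    HasFDerivAt (homPoly c n) (∑ x ∈ antidiagonal n,
      (mulComp ((x.1 : ℝ) • ((c x.1 x.2) • ContinuousLinearMap.id ℝ ℂ))
        (Complex.conjCLE : ℂ →L[ℝ] ℂ) (conj z ^ (x.1 - 1) * z ^ x.2) +
        mulComp ((x.2 : ℝ) • ((c x.1 x.2) • ContinuousLinearMap.id ℝ ℂ))
          (ContinuousLinearMap.id ℝ ℂ) (conj z ^ x.1 * z ^ (x.2 - 1)))) z := by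
  have : homPoly c n = fun z => ∑ x ∈ antidiagonal n,
      ((c x.1 x.2) • ContinuousLinearMap.id ℝ ℂ) (conj z ^ x.1 * z ^ x.2) := by
    ext z; simp [homPoly, mul_assoc]
  rw [this]
  exact HasFDerivAt.fun_sum fun x _ => hasFDerivAt_monomial _ _ _ z

lemma dbar_homPoly_succ (c : ℕ → ℕ → ℝ) (n : ℕ) (z : ℂ) :
    dbar (homPoly c (n + 1)) z = homPoly (fun j k => (j + 1) * c (j + 1) k) n z := by
  rw [dbar, (hasFDerivAt_homPoly c (n + 1) z).fderiv]
  simp only [_root_.sum_apply, FunLike.coe_add, Pi.add_apply, mulComp_apply]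
  simp only [FunLike.coe_smul, Pi.smul_apply, ContinuousLinearMap.id_apply,
    ContinuousLinearEquiv.coe_coe, Complex.conjCLE_apply, map_one, Complex.conj_I,
    Complex.real_smul, Finset.mul_sum, ← Finset.sum_add_distrib, Finset.sum_div]
  rw [Finset.Nat.sum_antidiagonal_succ, homPoly]
  simp only [Nat.cast_zero, Complex.ofReal_zero, zero_mul]
  refine (congrArg₂ (· + ·) ?_ ?_).trans (zero_add _)
  · simp
    linear_combination (((n : ℂ) + 1) * c 0 (n + 1) * z ^ n) * Complex.I_sq
  · refine Finset.sum_congr rfl fun x _ => ?_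
    simp only [Nat.add_sub_cancel]
    push_cast
    linear_combination ((((x.2 : ℂ) * (c (x.1 + 1) x.2 * (conj z ^ (x.1 + 1) * z ^ (x.2 - 1)))) -
      ((x.1 : ℂ) + 1) * (c (x.1 + 1) x.2 * (conj z ^ x.1 * z ^ x.2))) / 2) * Complex.I_sq

lemma dbar_const_mul {g : ℂ → ℂ} {z : ℂ} (c : ℂ) (hg : DifferentiableAt ℝ g z) :
    dbar (fun z => c * g z) z = c * dbar g z := by
  rw [dbar, dbar, fderiv_const_mul hg]
  simp
  ring

lemma isHomBounded_phi {lam : ℝ} (hlam : 0 ≤ lam) (n : ℕ) (a : ℂ) :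
    IsHomBounded n (‖a‖ * ((n : ℝ) + 1) ^ growthExp lam) (fun z => a * phi lam n z) := by
  refine ⟨ℕ × ℕ, antidiagonal n, Prod.fst, Prod.snd,
    fun x => ContinuousLinearMap.mul ℝ ℂ (a * eps lam n * coefA lam x.1 x.2),
    fun i hi => mem_antidiagonal.1 hi, ?_, fun z => ?_⟩
  · calc _ ≤ ∑ x ∈ antidiagonal n, ‖a‖ * (eps lam n * coefA lam x.1 x.2) := by
          refine Finset.sum_le_sum fun x _ => ?_
          rw [ContinuousLinearMap.opNorm_mul_apply, mul_assoc, norm_mul, norm_mul,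
            Complex.norm_real, Complex.norm_real, Real.norm_of_nonneg (eps_pos hlam n).le,
            Real.norm_of_nonneg (coefA_nonneg hlam _ _)]
      _ = ‖a‖ * (eps lam n * binA (2 * lam + 1) n) := by
          rw [← Finset.mul_sum, ← Finset.mul_sum, sum_coefA]
      _ ≤ _ := by
          refine mul_le_mul_of_nonneg_left ?_ (norm_nonneg _)
          have := binA_nonneg (a := 2 * lam + 1) (by linarith) n
          have h1 := eps_le_one hlam n
          have h2 := binA_le lam hlam n
          nlinarith
  · simp only [phi_eq, basicPoly, homPoly, ContinuousLinearMap.mul_apply', Finset.mul_sum]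
    exact Finset.sum_congr rfl fun x _ => by ring

lemma differentiable_phi {lam : ℝ} (hlam : 0 ≤ lam) (n : ℕ) :
    Differentiable ℝ (phi lam n) := by
  have := (isHomBounded_phi hlam n 1).fderiv.1
  simpa using this

/-- The Dunkl equation for the basic polynomials, cleared of the denominator. -/
lemma phi_eq_off (lam : ℝ) (n : ℕ) (z : ℂ) :
    (z - conj z) * dbar (phi lam n) z = lam * (phi lam n z - phi lam n (conj z)) := by
  have e : phi lam n = fun z => (eps lam n : ℂ) * basicPoly lam n z := funext (phi_eq lam n)
  have hd : ∀ n, DifferentiableAt ℝ (basicPoly lam n) z := fun n =>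
    (hasFDerivAt_homPoly (coefA lam) n z).differentiableAt
  rw [e, dbar_const_mul _ (hd n)]
  dsimp only
  cases n with
  | zero =>
    have : basicPoly lam 0 = fun _ => 1 := funext (basicPoly_zero lam)
    simp [this, dbar]
  | succ n =>
    have h1 := basicPoly_sub_conj lam n z
    have h2 : dbar (basicPoly lam (n + 1)) z =
        lam * homPoly (fun j k => binA (lam + 1) j * binA (lam + 1) k) n z := by
      have : basicPoly lam (n + 1) = homPoly (coefA lam) (n + 1) := rfl
      rw [this, dbar_homPoly_succ, homPoly, homPoly, Finset.mul_sum]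
      refine Finset.sum_congr rfl fun x _ => ?_
      have e1 : ((x.1 : ℂ) + 1) * (binA lam (x.1 + 1) : ℂ) = lam * binA (lam + 1) x.1 := by
        exact_mod_cast succ_mul_binA' lam x.1
      simp only [coefA]
      push_cast
      linear_combination (binA (lam + 1) x.2 * conj z ^ x.1 * z ^ x.2) * e1
    rw [h2, ← mul_sub, h1]
    ring

/-! ### Series of basic polynomials -/

/-- Coefficient sequences for which the bound `norm_phi_le` makes `∑ a n * phi lam n` and its
derivatives converge locally uniformly on the disk. -/
def IsCoefSeq (lam : ℝ) (a : ℕ → ℂ) : Prop :=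
  ∀ r : ℝ, 0 < r → r < 1 → Summable fun n => ‖a n‖ * ((n : ℝ) + 1) ^ growthExp lam * r ^ n

lemma IsCoefSeq.summable_norm {lam : ℝ} (hlam : 0 ≤ lam) {a : ℕ → ℂ} (ha : IsCoefSeq lam a)
    {z : ℂ} (hz : z ∈ disk) : Summable fun n => ‖a n * phi lam n z‖ := by
  rw [mem_disk] at hz
  obtain ⟨r, hr1, hr2⟩ := exists_between hz
  refine Summable.of_nonneg_of_le (fun n => norm_nonneg _) (fun n => ?_)
    (ha r ((norm_nonneg z).trans_lt hr1) hr2)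
  refine ((isHomBounded_phi hlam n (a n)).norm_le z).trans ?_
  gcongr

lemma IsCoefSeq.of_norm_le {lam : ℝ} {a : ℕ → ℂ} {C : ℝ} {m : ℕ}
    (h : ∀ n, ‖a n‖ ≤ C * ((n : ℝ) + 1) ^ m) : IsCoefSeq lam a := by
  intro r h0 h1
  refine Summable.of_nonneg_of_le (fun n => by positivity) (fun n => ?_)
    ((summable_growth (m + growthExp lam) h0.le h1).mul_left C)
  calc _ ≤ (C * ((n : ℝ) + 1) ^ m) * ((n : ℝ) + 1) ^ growthExp lam * r ^ n := by
        gcongr; exact h n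
    _ = _ := by rw [pow_add]; ring

lemma IsCoefSeq.hasFDerivAt {lam : ℝ} (hlam : 0 ≤ lam) {a : ℕ → ℂ} (ha : IsCoefSeq lam a)
    {z : ℂ} (hz : z ∈ disk) :
    HasFDerivAt (fun z => ∑' n, a n * phi lam n z)
      (∑' n, fderiv ℝ (fun z => a n * phi lam n z) z) z :=
  hasFDerivAt_tsum_hom (fun n => isHomBounded_phi hlam n (a n)) ha hz

lemma IsCoefSeq.summable_fderiv {lam : ℝ} (hlam : 0 ≤ lam) {a : ℕ → ℂ} (ha : IsCoefSeq lam a)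
    {z : ℂ} (hz : z ∈ disk) : Summable fun n => fderiv ℝ (fun z => a n * phi lam n z) z := by
  rw [mem_disk] at hz
  obtain ⟨r, hr1, hr2⟩ := exists_between hz
  refine Summable.of_norm_bounded (summable_deriv_bound
    (fun n => (isHomBounded_phi hlam n (a n)).nonneg) ha r ((norm_nonneg z).trans_lt hr1) hr2)
    fun n => ((isHomBounded_phi hlam n (a n)).fderiv.2.norm_le z).trans ?_
  gcongr

lemma IsCoefSeq.hasSum_dbar {lam : ℝ} (hlam : 0 ≤ lam) {a : ℕ → ℂ} (ha : IsCoefSeq lam a)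
    {z : ℂ} (hz : z ∈ disk) :
    HasSum (fun n => a n * dbar (phi lam n) z) (dbar (fun z => ∑' n, a n * phi lam n z) z) := by
  have h := (ha.summable_fderiv hlam hz).hasSum
  rw [← (ha.hasFDerivAt hlam hz).fderiv] at h
  have e : ∀ v : ℂ, HasSum (fun n => fderiv ℝ (fun z => a n * phi lam n z) z v)
      (fderiv ℝ (fun z => ∑' n, a n * phi lam n z) z v) := fun v =>
    (ContinuousLinearMap.apply ℝ ℂ v).hasSum h
  have := ((e 1).add ((e Complex.I).mul_left Complex.I)).div_const 2
  refine this.congr_fun fun n => ?_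
  rw [← dbar_const_mul _ (differentiable_phi hlam n z)]
  rfl

lemma IsCoefSeq.isLamAnalytic {lam : ℝ} (hlam : 0 ≤ lam) {a : ℕ → ℂ} (ha : IsCoefSeq lam a) :
    IsLamAnalytic lam (fun z => ∑' n, a n * phi lam n z) := by
  have h2 : ContDiffOn ℝ (2 : ℕ) (fun z => ∑' n, a n * phi lam n z) disk :=
    contDiffOn_tsum_hom 2 (fun n => isHomBounded_phi hlam n (a n)) ha
  have h : IsOffReal lam (fun z => ∑' n, a n * phi lam n z) := by
    refine ⟨h2.of_le (by norm_num), fun z hz _ => ?_⟩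
    have e1 := (ha.hasSum_dbar hlam hz).mul_left (z - conj z)
    have e2 := ((ha.summable_norm hlam hz).of_norm.hasSum.sub
      (ha.summable_norm hlam (conj_mem_disk.2 hz)).of_norm.hasSum).mul_left (lam : ℂ)
    refine e1.unique (e2.congr_fun fun n => ?_)
    linear_combination (a n) * phi_eq_off lam n z
  exact ⟨by exact_mod_cast h2, fun z hz => h.dunklBar_eq_zero hz⟩

end LambdaBergman

namespace LambdaBergman

open Filter Topology Set

/-! ### The weighted circle -/

/-- The measure `|sin θ| ^ (2 lam) dθ` on `(-π, π]`, the angular part of `sigma`. -/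
noncomputable def circ (lam : ℝ) : Measure ℝ :=
  (volume.restrict (Ioc (-Real.pi) Real.pi)).withDensity
    (fun θ => ENNReal.ofReal (|Real.sin θ| ^ (2 * lam)))

lemma continuous_sinWeight {lam : ℝ} (hlam : 0 ≤ lam) :
    Continuous fun θ : ℝ => |Real.sin θ| ^ (2 * lam) :=
  (Real.continuous_sin.abs).rpow_const fun _ => Or.inr (by linarith)

lemma isFiniteMeasure_circ {lam : ℝ} (hlam : 0 ≤ lam) : IsFiniteMeasure (circ lam) := by
  refine isFiniteMeasure_withDensity (ne_of_lt ?_)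
  calc ∫⁻ θ in Ioc (-Real.pi) Real.pi, ENNReal.ofReal (|Real.sin θ| ^ (2 * lam))
      ≤ ∫⁻ _ in Ioc (-Real.pi) Real.pi, 1 := by
        refine lintegral_mono fun θ => ?_
        rw [← ENNReal.ofReal_one]
        exact ENNReal.ofReal_le_ofReal
          (Real.rpow_le_one (abs_nonneg _) (Real.abs_sin_le_one θ) (by linarith))
    _ < ⊤ := by simp

lemma integral_circ {lam : ℝ} (hlam : 0 ≤ lam) (F : ℝ → ℂ) :
    ∫ θ, F θ ∂circ lam = ∫ θ in -Real.pi..Real.pi, |Real.sin θ| ^ (2 * lam) • F θ := by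
  rw [circ, intervalIntegral.integral_of_le (by linarith [Real.pi_pos]),
    integral_withDensity_eq_integral_toReal_smul
      (continuous_sinWeight hlam).measurable.ennreal_ofReal (by simp)]
  refine integral_congr_ae (ae_of_all _ fun θ => ?_)
  simp only
  rw [ENNReal.toReal_ofReal (by positivity)]

lemma integral_circ_symm {lam : ℝ} (hlam : 0 ≤ lam) {F : ℝ → ℂ} (hF : Continuous F) :
    ∫ θ, F θ ∂circ lam =
      ∫ θ in (0 : ℝ)..Real.pi, |Real.sin θ| ^ (2 * lam) • (F θ + F (-θ)) := by
  have hc : Continuous fun θ => |Real.sin θ| ^ (2 * lam) • F θ :=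
    (continuous_sinWeight hlam).smul hF
  have hc' : Continuous fun θ => |Real.sin θ| ^ (2 * lam) • F (-θ) :=
    (continuous_sinWeight hlam).smul (hF.comp continuous_neg)
  have hneg : ∫ θ in (0 : ℝ)..Real.pi, |Real.sin θ| ^ (2 * lam) • F (-θ) =
      ∫ θ in -Real.pi..(0 : ℝ), |Real.sin θ| ^ (2 * lam) • F θ := by
    have := intervalIntegral.integral_comp_neg (a := 0) (b := Real.pi)
      (fun θ => |Real.sin θ| ^ (2 * lam) • F θ)
    simpa using this
  simp only [smul_add]
  rw [integral_circ hlam, intervalIntegral.integral_add (hc.intervalIntegrable _ _)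
    (hc'.intervalIntegrable _ _), hneg, add_comm,
    intervalIntegral.integral_add_adjacent_intervals (hc.intervalIntegrable _ _)
      (hc.intervalIntegrable _ _)]

lemma Continuous.integrable_circ {lam : ℝ} (hlam : 0 ≤ lam) {E : Type*} [NormedAddCommGroup E]
    {F : ℝ → E} (hF : Continuous F) : Integrable F (circ lam) := by
  have := isFiniteMeasure_circ hlam
  obtain ⟨C, hC⟩ := (isCompact_Icc (a := -Real.pi) (b := Real.pi)).exists_bound_of_continuousOn
    hF.continuousOn
  refine Integrable.of_bound hF.aestronglyMeasurable C ?_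
  have : ∀ᵐ θ ∂(volume.restrict (Ioc (-Real.pi) Real.pi)), ‖F θ‖ ≤ C :=
    (ae_restrict_mem measurableSet_Ioc).mono fun θ hθ => hC θ (Ioc_subset_Icc_self hθ)
  exact (withDensity_absolutelyContinuous _ _).ae_le this

/-- Integration by parts on the weighted circle. With `T = -i ∂_θ + lam e^{-iθ} (1 - ρ) / (i sin θ)`,
`ρ` the reflection `θ ↦ -θ`, the hypotheses say `R = T G` and that `η` is an eigenfunction of the
transpose of `T`. -/
lemma circle_pairing {lam : ℝ} (hlam : 0 ≤ lam) {G G' R η η' : ℝ → ℂ} {μ : ℂ}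
    (hG : ∀ θ, HasDerivAt G (G' θ) θ) (hη : ∀ θ, HasDerivAt η (η' θ) θ)
    (hGπ : G (-Real.pi) = G Real.pi) (hηπ : η (-Real.pi) = η Real.pi) (hR : Continuous R)
    (eG : ∀ θ, Real.sin θ ≠ 0 → R θ = -Complex.I * G' θ +
      lam * Complex.exp (-(θ * Complex.I)) * (G θ - G (-θ)) / (Complex.I * Real.sin θ))
    (eη : ∀ θ, Real.sin θ ≠ 0 → Complex.I * η' θ +
      Complex.I * lam * Complex.exp (θ * Complex.I) * (η θ - η (-θ)) / Real.sin θ = μ * η θ) :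
    ∫ θ, (R θ - μ * G θ) * η θ ∂circ lam = 0 := by
  have hGc : Continuous G := continuous_iff_continuousAt.2 fun θ => (hG θ).continuousAt
  have hηc : Continuous η := continuous_iff_continuousAt.2 fun θ => (hη θ).continuousAt
  have hFc : Continuous fun θ => (R θ - μ * G θ) * η θ :=
    (hR.sub (continuous_const.mul hGc)).mul hηc
  rw [integral_circ_symm hlam hFc]
  -- `sin ^ (2 lam) (G η - G(-·) η(-·))` is a primitive, up to a factor `i`
  set O : ℝ → ℂ := fun θ => |Real.sin θ| ^ (2 * lam) • (G θ * η θ - G (-θ) * η (-θ)) with hO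
  have hOc : Continuous O := (continuous_sinWeight hlam).smul
    ((hGc.mul hηc).sub ((hGc.comp continuous_neg).mul (hηc.comp continuous_neg)))
  have hderiv : ∀ θ ∈ Ioo (0 : ℝ) Real.pi, HasDerivAt O
      (Complex.I * |Real.sin θ| ^ (2 * lam) •
        ((R θ - μ * G θ) * η θ + (R (-θ) - μ * G (-θ)) * η (-θ))) θ := by
    intro θ hθ
    have hs : 0 < Real.sin θ := Real.sin_pos_of_pos_of_lt_pi hθ.1 hθ.2
    have hs' : (Real.sin θ : ℂ) ≠ 0 := by exact_mod_cast hs.ne'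
    have hev : O =ᶠ[𝓝 θ] fun θ => Real.sin θ ^ (2 * lam) •
        (G θ * η θ - G (-θ) * η (-θ)) := by
      filter_upwards [Ioo_mem_nhds hθ.1 hθ.2] with t ht
      simp only [hO]
      rw [abs_of_pos (Real.sin_pos_of_pos_of_lt_pi ht.1 ht.2)]
    refine HasDerivAt.congr_of_eventuallyEq ?_ hev
    have hw : HasDerivAt (fun θ => Real.sin θ ^ (2 * lam))
        (Real.cos θ * (2 * lam) * Real.sin θ ^ (2 * lam - 1)) θ :=
      (Real.hasDerivAt_sin θ).rpow_const (Or.inl hs.ne')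
    have hGn : HasDerivAt (fun θ => G (-θ)) (-G' (-θ)) θ := by
      have := (hG (-θ)).scomp θ (hasDerivAt_neg θ)
      simpa using! this
    have hηn : HasDerivAt (fun θ => η (-θ)) (-η' (-θ)) θ := by
      have := (hη (-θ)).scomp θ (hasDerivAt_neg θ)
      simpa using! this
    refine (hw.smul (((hG θ).mul (hη θ)).sub (hGn.mul hηn))).congr_deriv ?_
    rw [abs_of_pos hs, Real.rpow_sub_one hs.ne']
    have hsn : Real.sin (-θ) ≠ 0 := by rw [Real.sin_neg]; exact neg_ne_zero.2 hs.ne'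
    have e1 := eG θ hs.ne'
    have e2 := eG (-θ) hsn
    have e3 := eη θ hs.ne'
    have e4 := eη (-θ) hsn
    have ecos' : Complex.exp (-(θ * Complex.I)) =
        Complex.cos θ - Complex.sin θ * Complex.I := by
      rw [← neg_mul, Complex.exp_mul_I, Complex.cos_neg, Complex.sin_neg]; ring
    simp only [neg_neg, Real.sin_neg, Complex.ofReal_neg, neg_mul, Complex.exp_mul_I, ecos',
      ← Complex.ofReal_sin, ← Complex.ofReal_cos] at e1 e2 e3 e4
    simp only [Complex.real_smul, Pi.sub_apply, Pi.mul_apply]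
    push_cast only [Complex.ofReal_mul, Complex.ofReal_div, Complex.ofReal_ofNat]
    generalize Real.sin θ ^ (2 * lam) = W at *
    generalize (Real.sin θ : ℂ) = s at *
    generalize (Real.cos θ : ℂ) = c at *
    have f1 : s * R θ = -Complex.I * s * G' θ - Complex.I * lam * (c - s * Complex.I) *
        (G θ - G (-θ)) := by
      rw [e1]; field_simp; linear_combination
        ((lam : ℂ) * (c - s * Complex.I) * (G θ - G (-θ))) * Complex.I_sq
    have f2 : s * R (-θ) = -Complex.I * s * G' (-θ) + Complex.I * lam * (c + s * Complex.I) *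
        (G (-θ) - G θ) := by
      rw [e2]; field_simp; linear_combination
        (-(lam : ℂ) * (c + s * Complex.I) * (G (-θ) - G θ)) * Complex.I_sq
    have f3 : s * (μ * η θ) = s * Complex.I * η' θ + Complex.I * lam * (c + s * Complex.I) *
        (η θ - η (-θ)) := by
      rw [← e3]; field_simp
    have f4 : s * (μ * η (-θ)) = s * Complex.I * η' (-θ) - Complex.I * lam *
        (c - s * Complex.I) * (η (-θ) - η θ) := by
      rw [← e4]; field_simp; ring
    field_simp
    linear_combination (-Complex.I * W * η θ) * f1 + (-Complex.I * W * η (-θ)) * f2 +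
      (Complex.I * W * G θ) * f3 + (Complex.I * W * G (-θ)) * f4 +
      (W * (s * (G' θ * η θ + G θ * η' θ + G' (-θ) * η (-θ) + G (-θ) * η' (-θ)) +
        2 * c * lam * (G θ * η θ - G (-θ) * η (-θ)))) * Complex.I_sq
  have hint := intervalIntegral.integral_eq_sub_of_hasDerivAt_of_le Real.pi_pos.le
    hOc.continuousOn hderiv (Continuous.intervalIntegrable (by
      exact continuous_const.mul ((continuous_sinWeight hlam).smul
        (hFc.add (hFc.comp continuous_neg)))) _ _)
  have h0 : O 0 = 0 := by simp [hO]
  have hπ : O Real.pi = 0 := by simp [hO, hGπ, hηπ]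
  rw [h0, hπ, sub_zero, intervalIntegral.integral_const_mul] at hint
  exact (mul_eq_zero.1 hint).resolve_left Complex.I_ne_zero

end LambdaBergman

namespace LambdaBergman

open Filter Topology Set

/-! ### The Dunkl equation in polar coordinates -/

/-- The point `e ^ (iθ)` of the unit circle. -/
noncomputable def cis (θ : ℝ) : ℂ := Complex.exp (θ * Complex.I)

lemma norm_cis (θ : ℝ) : ‖cis θ‖ = 1 := Complex.norm_exp_ofReal_mul_I θ

lemma continuous_cis : Continuous cis := by unfold cis; fun_prop

lemma conj_cis (θ : ℝ) : conj (cis θ) = Complex.exp (-(θ * Complex.I)) := by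
  rw [cis, ← Complex.exp_conj]; simp

lemma cis_neg (θ : ℝ) : cis (-θ) = conj (cis θ) := by
  rw [conj_cis, cis]; simp

lemma conj_cis_mul (θ : ℝ) : conj (cis θ) * cis θ = 1 := by
  rw [Complex.conj_mul', norm_cis]; simp

lemma cis_sub_conj (θ : ℝ) : cis θ - conj (cis θ) = 2 * Complex.I * Real.sin θ := by
  rw [conj_cis, cis, ← neg_mul, Complex.exp_mul_I, Complex.exp_mul_I, Complex.cos_neg,
    Complex.sin_neg, Complex.ofReal_sin]; ring

lemma cis_im (θ : ℝ) : (cis θ).im = Real.sin θ := by rw [cis, Complex.exp_ofReal_mul_I_im]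

lemma cis_neg_pi : cis (-Real.pi) = cis Real.pi := by
  rw [cis_neg, cis, Complex.exp_pi_mul_I]; simp

lemma hasDerivAt_cis (θ : ℝ) : HasDerivAt cis (Complex.I * cis θ) θ := by
  have := ((Complex.ofRealCLM.hasDerivAt (x := θ)).mul_const Complex.I).cexp
  refine this.congr_deriv ?_
  simp [cis, mul_comm]

lemma norm_real_mul_cis {r : ℝ} (hr : 0 ≤ r) (θ : ℝ) : ‖(r : ℂ) * cis θ‖ = r := by
  rw [norm_mul, norm_cis, mul_one, Complex.norm_real, Real.norm_of_nonneg hr]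

lemma real_mul_cis_mem_disk {r : ℝ} (hr : 0 ≤ r) (h1 : r < 1) (θ : ℝ) :
    (r : ℂ) * cis θ ∈ disk := by
  rw [mem_disk, norm_real_mul_cis hr]; exact h1

lemma hasDerivAt_comp_circle {g : ℂ → ℂ} {r θ : ℝ} (hg : DifferentiableAt ℝ g (r * cis θ)) :
    HasDerivAt (fun θ : ℝ => g (r * cis θ))
      (fderiv ℝ g (r * cis θ) (Complex.I * (r * cis θ))) θ := by
  have := hg.hasFDerivAt.comp_hasDerivAt θ ((hasDerivAt_cis θ).const_mul (r : ℂ))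
  refine this.congr_deriv ?_
  congr 1; ring

/-- The equation `D_z̄ g = 0` in polar coordinates. -/
lemma polar_equation {lam : ℝ} {g : ℂ → ℂ} {r θ : ℝ} (hr : r ≠ 0) (hs : Real.sin θ ≠ 0)
    (h : (r * cis θ - conj (r * cis θ)) * dbar g (r * cis θ) =
      lam * (g (r * cis θ) - g (conj (r * cis θ)))) :
    fderiv ℝ g (r * cis θ) (r * cis θ) =
      -Complex.I * fderiv ℝ g (r * cis θ) (Complex.I * (r * cis θ)) +
      lam * Complex.exp (-(θ * Complex.I)) * (g (r * cis θ) - g (r * cis (-θ))) /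
        (Complex.I * Real.sin θ) := by
  have hs' : (Real.sin θ : ℂ) ≠ 0 := by exact_mod_cast hs
  have hr' : (r : ℂ) ≠ 0 := by exact_mod_cast hr
  rw [fderiv_radial g, ← conj_cis, cis_neg]
  simp only [map_mul, Complex.conj_ofReal] at h ⊢
  rw [← mul_sub, cis_sub_conj] at h
  congr 1
  rw [eq_div_iff (mul_ne_zero Complex.I_ne_zero hs')]
  linear_combination (conj (cis θ)) * h

/-- Euler's identity for the homogeneous polynomial `phi lam n`. -/
lemma fderiv_phi_self {lam : ℝ} (hlam : 0 ≤ lam) (n : ℕ) (z : ℂ) :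
    fderiv ℝ (phi lam n) z z = n * phi lam n z := by
  have h1 : HasDerivAt (fun t : ℝ => phi lam n (t * z)) (fderiv ℝ (phi lam n) z z) 1 := by
    have hl : HasDerivAt (fun t : ℝ => (t : ℂ) * z) z 1 := by
      simpa using! (Complex.ofRealCLM.hasDerivAt (x := 1)).mul_const z
    have h2 : HasFDerivAt (phi lam n) (fderiv ℝ (phi lam n) z) ((1 : ℝ) * z) := by
      simpa using (differentiable_phi hlam n z).hasFDerivAt
    exact HasFDerivAt.comp_hasDerivAt (f := fun t : ℝ => (t : ℂ) * z) (1 : ℝ) h2 hl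
  have h3 : HasDerivAt (fun t : ℝ => phi lam n (t * z)) (n * phi lam n z) 1 := by
    simp only [phi_real_mul]
    have := (((hasDerivAt_id (1 : ℝ)).pow n).ofReal_comp).mul_const (phi lam n z)
    simpa using! this
  exact h1.unique h3

/-- `η` is a `2π`-periodic eigenfunction, with eigenvalue `μ`, of the transpose of the angular part
of the Dunkl operator. -/
structure IsTransposeEigen (lam μ : ℝ) (η : ℝ → ℂ) : Prop where
  differentiable : Differentiable ℝ η
  periodic : η (-Real.pi) = η Real.pi
  eq : ∀ θ, Real.sin θ ≠ 0 → Complex.I * deriv η θ +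
      Complex.I * lam * Complex.exp (θ * Complex.I) * (η θ - η (-θ)) / Real.sin θ = μ * η θ

lemma hasDerivAt_phi_cis {lam : ℝ} (hlam : 0 ≤ lam) (n : ℕ) (θ : ℝ) :
    HasDerivAt (fun θ => phi lam n (cis θ))
      (fderiv ℝ (phi lam n) (cis θ) (Complex.I * cis θ)) θ := by
  have := hasDerivAt_comp_circle (r := 1) (θ := θ) (differentiable_phi hlam n _)
  simpa using this

/-- The polar equation for `phi lam n` at radius one, where by Euler's identity the radial derivative
is `n * phi lam n`. -/
lemma phi_circle {lam : ℝ} (hlam : 0 ≤ lam) (n : ℕ) {θ : ℝ} (hs : Real.sin θ ≠ 0) :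
    Real.sin θ * (n * phi lam n (cis θ)) =
      -Complex.I * Real.sin θ * fderiv ℝ (phi lam n) (cis θ) (Complex.I * cis θ) -
      Complex.I * lam * conj (cis θ) * (phi lam n (cis θ) - conj (phi lam n (cis θ))) := by
  have := polar_equation (r := 1) one_ne_zero hs (phi_eq_off lam n _)
  simp only [Complex.ofReal_one, one_mul, fderiv_phi_self hlam, cis_neg, phi_conj] at this
  have hs' : (Real.sin θ : ℂ) ≠ 0 := by exact_mod_cast hs
  rw [this, ← conj_cis]
  generalize conj (cis θ) = e'
  field_simp
  linear_combination (e' * lam * (phi lam n (cis θ) -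
    conj (phi lam n (cis θ)))) * Complex.I_sq

lemma isTransposeEigen_conj_phi {lam : ℝ} (hlam : 0 ≤ lam) (n : ℕ) :
    IsTransposeEigen lam n (fun θ => conj (phi lam n (cis θ))) := by
  have hd : ∀ θ, HasDerivAt (fun θ => conj (phi lam n (cis θ)))
      (conj (fderiv ℝ (phi lam n) (cis θ) (Complex.I * cis θ))) θ := fun θ =>
    (Complex.conjCLE : ℂ →L[ℝ] ℂ).hasFDerivAt.comp_hasDerivAt θ (hasDerivAt_phi_cis hlam n θ)
  refine ⟨fun θ => (hd θ).differentiableAt, by simp [cis_neg_pi], fun θ hs => ?_⟩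
  have hs' : (Real.sin θ : ℂ) ≠ 0 := by exact_mod_cast hs
  rw [(hd θ).deriv]
  have h := congrArg conj (phi_circle hlam n hs)
  simp only [map_mul, map_neg, Complex.conj_I, map_sub, Complex.conj_conj,
    Complex.conj_ofReal, neg_neg, map_natCast] at h
  simp only [cis_neg, phi_conj, Complex.conj_conj]
  change Complex.I * _ + Complex.I * lam * cis θ * _ / _ = _
  rw [eq_comm, ← mul_right_inj' hs', Complex.ofReal_natCast, h, mul_add, mul_div_cancel₀ _ hs']
  ring

lemma isTransposeEigen_cis_mul_phi {lam : ℝ} (hlam : 0 ≤ lam) (n : ℕ) :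
    IsTransposeEigen lam (-(n + 1 + 2 * lam)) (fun θ => cis θ * phi lam n (cis θ)) := by
  have hd : ∀ θ, HasDerivAt (fun θ => cis θ * phi lam n (cis θ)) _ θ := fun θ =>
    (hasDerivAt_cis θ).mul (hasDerivAt_phi_cis hlam n θ)
  refine ⟨fun θ => (hd θ).differentiableAt, by simp [cis_neg_pi], fun θ hs => ?_⟩
  have hs' : (Real.sin θ : ℂ) ≠ 0 := by exact_mod_cast hs
  rw [(hd θ).deriv]
  have h := phi_circle hlam n hs
  simp only [cis_neg, phi_conj] at h ⊢
  have h1 := cis_sub_conj θ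
  change Complex.I * _ + Complex.I * lam * cis θ * _ / _ = _
  rw [← mul_right_inj' hs', mul_add, mul_div_cancel₀ _ hs']
  push_cast only [Complex.ofReal_neg, Complex.ofReal_add, Complex.ofReal_mul,
    Complex.ofReal_natCast, Complex.ofReal_one, Complex.ofReal_ofNat]
  generalize (Real.sin θ : ℂ) = s at *
  generalize cis θ = e at *
  generalize conj e = e' at *
  generalize phi lam n e = F at *
  generalize conj F = F' at *
  generalize fderiv ℝ (phi lam n) e (Complex.I * e) = D at *
  linear_combination e * h + (Complex.I * lam * e * F) * h1 +
    (s * e * F + 2 * lam * s * e * F) * Complex.I_sq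

/-! ### Pairings over circles -/

/-- The pairing over the weighted circle of radius `r` of a function on the disk with an angular
function. -/
noncomputable def circPair (lam : ℝ) (g : ℂ → ℂ) (η : ℝ → ℂ) (r : ℝ) : ℂ :=
  ∫ θ, g (r * cis θ) * η θ ∂circ lam

lemma IsOffReal.continuous_circle {lam : ℝ} {g : ℂ → ℂ} (hg : IsOffReal lam g) {r : ℝ}
    (h0 : 0 ≤ r) (h1 : r < 1) : Continuous fun θ : ℝ => g (r * cis θ) :=
  hg.contDiffOn.continuousOn.comp_continuous (continuous_const.mul continuous_cis)
    fun θ => real_mul_cis_mem_disk h0 h1 θ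

lemma IsOffReal.continuous_fderiv_circle {lam : ℝ} {g : ℂ → ℂ} (hg : IsOffReal lam g) {r : ℝ}
    (h0 : 0 ≤ r) (h1 : r < 1) (z : ℂ) :
    Continuous fun θ : ℝ => fderiv ℝ g (r * cis θ) (z * cis θ) :=
  (hg.continuousOn_fderiv.comp_continuous (continuous_const.mul continuous_cis)
    fun θ => real_mul_cis_mem_disk h0 h1 θ).clm_apply (continuous_const.mul continuous_cis)

lemma IsOffReal.hasDerivAt_circPair {lam : ℝ} (hlam : 0 ≤ lam) {g : ℂ → ℂ}
    (hg : IsOffReal lam g) {η : ℝ → ℂ} (hη : Continuous η) {r : ℝ} (h0 : 0 < r) (h1 : r < 1) :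
    HasDerivAt (circPair lam g η) (∫ θ, fderiv ℝ g (r * cis θ) (cis θ) * η θ ∂circ lam) r := by
  obtain ⟨r', hr1, hr2⟩ := exists_between h1
  have hsub : Metric.closedBall (0 : ℂ) r' ⊆ disk := Metric.closedBall_subset_ball hr2
  obtain ⟨C, hC⟩ := (isCompact_closedBall (0 : ℂ) r').exists_bound_of_continuousOn
    (hg.continuousOn_fderiv.mono hsub)
  refine (hasDerivAt_integral_of_dominated_loc_of_deriv_le (𝕜 := ℝ)
    (F := fun (r : ℝ) θ => g (r * cis θ) * η θ)
    (F' := fun (r : ℝ) θ => fderiv ℝ g (r * cis θ) (cis θ) * η θ)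
    (bound := fun θ => C * ‖η θ‖) (s := Ioo 0 r') (Ioo_mem_nhds h0 hr1) ?_ ?_ ?_ ?_ ?_ ?_).2
  · filter_upwards [Ioo_mem_nhds h0 hr1] with t ht
    exact ((hg.continuous_circle ht.1.le (ht.2.trans hr2)).mul hη).aestronglyMeasurable
  · exact Continuous.integrable_circ hlam ((hg.continuous_circle h0.le h1).mul hη)
  · have := hg.continuous_fderiv_circle h0.le h1 1
    simp only [one_mul] at this
    exact (this.mul hη).aestronglyMeasurable
  · refine ae_of_all _ fun θ t ht => ?_
    rw [norm_mul]
    refine mul_le_mul_of_nonneg_right ?_ (norm_nonneg _)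
    refine ((fderiv ℝ g _).le_opNorm _).trans ?_
    rw [norm_cis, mul_one]
    exact hC _ (by rw [mem_closedBall_zero_iff, norm_real_mul_cis ht.1.le]; exact ht.2.le)
  · exact Continuous.integrable_circ hlam (continuous_const.mul hη.norm)
  · refine ae_of_all _ fun θ t ht => ?_
    have hd := (hg.differentiableAt (real_mul_cis_mem_disk ht.1.le (ht.2.trans hr2) θ)).hasFDerivAt
    have hl : HasDerivAt (fun t : ℝ => (t : ℂ) * cis θ) (cis θ) t := by
      simpa using! (Complex.ofRealCLM.hasDerivAt (x := t)).mul_const (cis θ)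
    exact (HasFDerivAt.comp_hasDerivAt (f := fun t : ℝ => (t : ℂ) * cis θ) t hd hl).mul_const _

/-- The pairing of a `lam`-analytic function with an eigenfunction of the transposed angular
operator is a multiple of `r ^ μ`. -/
lemma IsOffReal.circPair_eq {lam : ℝ} (hlam : 0 ≤ lam) {g : ℂ → ℂ} (hg : IsOffReal lam g)
    {μ : ℝ} {η : ℝ → ℂ} (hη : IsTransposeEigen lam μ η) :
    ∃ c : ℂ, ∀ r ∈ Ioo (0 : ℝ) 1, circPair lam g η r = (r ^ μ : ℝ) * c := by
  have hηc := hη.differentiable.continuous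
  have hA : ∀ r ∈ Ioo (0 : ℝ) 1, HasDerivAt (circPair lam g η) (r⁻¹ * (μ * circPair lam g η r)) r := by
    intro r hr
    refine (hg.hasDerivAt_circPair hlam hηc hr.1 hr.2).congr_deriv ?_
    have hr0 : (r : ℂ) ≠ 0 := by exact_mod_cast hr.1.ne'
    rw [Complex.ofReal_inv, eq_inv_mul_iff_mul_eq₀ hr0, ← sub_eq_zero, circPair, ← integral_const_mul,
      ← integral_const_mul, ← integral_sub]
    · have hd : ∀ θ, DifferentiableAt ℝ g (r * cis θ) := fun θ =>
        hg.differentiableAt (real_mul_cis_mem_disk hr.1.le hr.2 θ)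
      rw [← circle_pairing hlam (G := fun θ => g (r * cis θ))
        (R := fun θ => fderiv ℝ g (r * cis θ) (r * cis θ)) (μ := μ)
        (fun θ => hasDerivAt_comp_circle (hd θ)) (fun θ => (hη.differentiable θ).hasDerivAt)
        (by simp only [cis_neg_pi]) hη.periodic (hg.continuous_fderiv_circle hr.1.le hr.2 _)
        (fun θ hs => polar_equation hr.1.ne' hs
          (hg.eq_off _ (real_mul_cis_mem_disk hr.1.le hr.2 θ) ?_)) hη.eq]
      · refine integral_congr_ae (ae_of_all _ fun θ => ?_)
        simp only
        have e : ∀ L : ℂ →L[ℝ] ℂ, L (r * cis θ) = r * L (cis θ) := fun L => by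
          rw [← Complex.real_smul, map_smul, Complex.real_smul]
        rw [e]
        ring
      · rw [← Complex.real_smul, Complex.smul_im, cis_im]
        exact mul_ne_zero hr.1.ne' hs
    · have := hg.continuous_fderiv_circle hr.1.le hr.2 1
      simp only [one_mul] at this
      exact Continuous.integrable_circ hlam (continuous_const.mul (this.mul hηc))
    · exact Continuous.integrable_circ hlam
        (continuous_const.mul ((hg.continuous_circle hr.1.le hr.2).mul hηc))
  have hB : ∀ r ∈ Ioo (0 : ℝ) 1,
      HasDerivAt (fun r => ((r ^ (-μ) : ℝ) : ℂ) * circPair lam g η r) 0 r := by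
    intro r hr
    have h1 := (Real.hasDerivAt_rpow_const (p := -μ) (Or.inl hr.1.ne')).ofReal_comp
    refine (h1.mul (hA r hr)).congr_deriv ?_
    rw [Real.rpow_sub_one hr.1.ne']
    push_cast
    ring
  obtain ⟨c, hc⟩ := isOpen_Ioo.exists_is_const_of_deriv_eq_zero isPreconnected_Ioo
    (fun r hr => (hB r hr).differentiableAt.differentiableWithinAt)
    (fun r hr => (hB r hr).deriv)
  refine ⟨c, fun r hr => ?_⟩
  have := hc r hr
  rw [← this, ← mul_assoc, ← Complex.ofReal_mul, ← Real.rpow_add hr.1]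
  simp

/-- The pairing with an eigenfunction of negative eigenvalue vanishes, since it stays bounded at the
origin. -/
lemma IsOffReal.circPair_eq_zero {lam : ℝ} (hlam : 0 ≤ lam) {g : ℂ → ℂ} (hg : IsOffReal lam g)
    {μ : ℝ} (hμ : μ < 0) {η : ℝ → ℂ} (hη : IsTransposeEigen lam μ η) {r : ℝ}
    (hr : r ∈ Ioo (0 : ℝ) 1) : circPair lam g η r = 0 := by
  have := isFiniteMeasure_circ hlam
  obtain ⟨c, hc⟩ := hg.circPair_eq hlam hη
  have hsub : Metric.closedBall (0 : ℂ) (1 / 2) ⊆ disk :=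
    Metric.closedBall_subset_ball (by norm_num)
  obtain ⟨C, hC⟩ := (isCompact_closedBall (0 : ℂ) (1 / 2)).exists_bound_of_continuousOn
    (hg.contDiffOn.continuousOn.mono hsub)
  have hb : ∀ᶠ r in 𝓝[>] (0 : ℝ), ‖c‖ ≤ r ^ (-μ) * ∫ θ, C * ‖η θ‖ ∂circ lam := by
    filter_upwards [Ioo_mem_nhdsGT (show (0 : ℝ) < 1 / 2 by norm_num)] with t ht
    have ht1 : t ∈ Ioo (0 : ℝ) 1 := ⟨ht.1, ht.2.trans (by norm_num)⟩
    have e : c = (t ^ (-μ) : ℝ) * circPair lam g η t := by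
      rw [hc t ht1, ← mul_assoc, ← Complex.ofReal_mul, ← Real.rpow_add ht.1]; simp
    rw [e, norm_mul, Complex.norm_real, Real.norm_of_nonneg (by have := ht.1; positivity)]
    refine mul_le_mul_of_nonneg_left ?_ (by have := ht.1; positivity)
    refine norm_integral_le_of_norm_le (Continuous.integrable_circ hlam
      (continuous_const.mul hη.differentiable.continuous.norm)) (ae_of_all _ fun θ => ?_)
    rw [norm_mul]
    refine mul_le_mul_of_nonneg_right (hC _ ?_) (norm_nonneg _)
    rw [mem_closedBall_zero_iff, norm_real_mul_cis ht.1.le]; exact ht.2.le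
  have hlim : Tendsto (fun r : ℝ => r ^ (-μ) * ∫ θ, C * ‖η θ‖ ∂circ lam) (𝓝[>] 0) (𝓝 0) := by
    have h := (Real.continuousAt_rpow_const 0 (-μ) (Or.inr (by linarith))).tendsto
    rw [Real.zero_rpow (by linarith)] at h
    have := (h.mono_left (nhdsWithin_le_nhds (s := Ioi 0))).mul_const (∫ θ, C * ‖η θ‖ ∂circ lam)
    rwa [zero_mul] at this
  have : c = 0 := norm_le_zero_iff.1 (ge_of_tendsto hlim hb)
  rw [hc r hr, this, mul_zero]

end LambdaBergman

namespace LambdaBergman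

open Filter Topology Set

/-! ### Orthogonality on the weighted circle -/

lemma isOffReal_phi {lam : ℝ} (hlam : 0 ≤ lam) (n : ℕ) : IsOffReal lam (phi lam n) := by
  have h : ContDiffOn ℝ (1 : ℕ) (fun z => ∑' i : ℕ, if i = n then phi lam n z else 0) disk := by
    refine contDiffOn_tsum_hom 1 (d := fun i => n)
      (M := fun i => if i = n then ((n : ℝ) + 1) ^ growthExp lam else 0) (fun i => ?_) ?_
    · split_ifs with hi
      · simpa using isHomBounded_phi hlam n 1
      · exact ⟨ℕ, ∅, id, id, fun _ => 0, by simp, by simp, by simp⟩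
    · intro r _ _
      exact summable_of_ne_finset_zero (s := {n}) fun i hi => by
        rw [if_neg (by simpa using hi), zero_mul]
  refine ⟨?_, fun z _ _ => phi_eq_off lam n z⟩
  simpa using h

/-- The total mass of the weighted circle. -/
noncomputable def circMass (lam : ℝ) : ℝ := (circ lam).real univ

lemma circMass_pos {lam : ℝ} (hlam : 0 ≤ lam) : 0 < circMass lam := by
  have := isFiniteMeasure_circ hlam
  refine ENNReal.toReal_pos (fun h => ?_) (measure_ne_top _ _)
  rw [circ, withDensity_apply _ MeasurableSet.univ, Measure.restrict_univ,
    lintegral_eq_zero_iff (continuous_sinWeight hlam).measurable.ennreal_ofReal] at h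
  have hne : ∀ᵐ θ ∂(volume.restrict (Ioo 0 Real.pi)), False := by
    have h' := ae_restrict_of_ae_restrict_of_subset
      (show Ioo 0 Real.pi ⊆ Ioc (-Real.pi) Real.pi from fun x hx =>
        ⟨by linarith [hx.1, Real.pi_pos], hx.2.le⟩) h
    filter_upwards [h', ae_restrict_mem measurableSet_Ioo] with θ h1 h2
    have hs := Real.sin_pos_of_pos_of_lt_pi h2.1 h2.2
    simp only [Pi.zero_apply, ENNReal.ofReal_eq_zero] at h1
    have : 0 < |Real.sin θ| ^ (2 * lam) := Real.rpow_pos_of_pos (abs_pos.2 hs.ne') _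
    linarith
  rw [ae_iff] at hne
  simp at hne
  linarith [Real.pi_pos]

lemma continuous_phi {lam : ℝ} (hlam : 0 ≤ lam) (n : ℕ) : Continuous (phi lam n) :=
  (differentiable_phi hlam n).continuous

lemma continuous_basicPoly (lam : ℝ) (n : ℕ) : Continuous (basicPoly lam n) :=
  continuous_iff_continuousAt.2 fun z =>
    (hasFDerivAt_homPoly (coefA lam) n z).continuousAt

lemma circPair_phi (lam : ℝ) (n : ℕ) (η : ℝ → ℂ) (r : ℝ) :
    circPair lam (phi lam n) η r = r ^ n * ∫ θ, phi lam n (cis θ) * η θ ∂circ lam := by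
  rw [circPair, ← integral_const_mul]
  simp only [phi_real_mul, mul_assoc]

/-- The pairing of `phi lam n` with `η` is a multiple both of `r ^ n` and of `r ^ μ`, so it is zero. -/
lemma integral_phi_mul_eigen {lam : ℝ} (hlam : 0 ≤ lam) (n : ℕ) {μ : ℝ} (hμ : μ ≠ n) {η : ℝ → ℂ}
    (hη : IsTransposeEigen lam μ η) : ∫ θ, phi lam n (cis θ) * η θ ∂circ lam = 0 := by
  obtain ⟨c, hc⟩ := (isOffReal_phi hlam n).circPair_eq hlam hη
  have h1 := hc (1 / 2) ⟨by norm_num, by norm_num⟩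
  have h2 := hc (1 / 4) ⟨by norm_num, by norm_num⟩
  rw [circPair_phi] at h1 h2
  set X := ∫ θ, phi lam n (cis θ) * η θ ∂circ lam
  have e : ((1 / 4 : ℝ)) ^ μ = (1 / 2) ^ μ * (1 / 2) ^ μ := by
    rw [← Real.mul_rpow (by norm_num) (by norm_num)]; norm_num
  have e' : ((1 / 4 : ℝ) : ℂ) ^ n = ((1 / 2 : ℝ) : ℂ) ^ n * ((1 / 2 : ℝ) : ℂ) ^ n := by
    rw [← mul_pow]; norm_num
  rw [e, e'] at h2
  have hab : ((1 / 2 : ℝ) ^ μ) ≠ (1 / 2 : ℝ) ^ n := by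
    rw [← Real.rpow_natCast]
    intro h
    exact hμ ((Real.rpow_right_inj (by norm_num) (by norm_num)).1 h)
  have hb : ((1 / 2 : ℝ) : ℂ) ^ n ≠ 0 := pow_ne_zero _ (by norm_num)
  have hab' : (((1 / 2 : ℝ) ^ μ : ℝ) : ℂ) - ((1 / 2 : ℝ) : ℂ) ^ n ≠ 0 := by
    rw [sub_ne_zero]; exact_mod_cast hab
  rw [Complex.ofReal_mul] at h2
  have : ((1 / 2 : ℝ) : ℂ) ^ n * ((((1 / 2 : ℝ) ^ μ : ℝ) : ℂ) - ((1 / 2 : ℝ) : ℂ) ^ n) * X = 0 := by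
    linear_combination (((1 / 2 : ℝ) ^ μ : ℝ) : ℂ) * h1 - h2
  exact (mul_eq_zero.1 this).resolve_left (mul_ne_zero hb hab')

lemma integral_phi_mul_conj_phi_of_ne {lam : ℝ} (hlam : 0 ≤ lam) {n m : ℕ} (h : m ≠ n) :
    ∫ θ, phi lam n (cis θ) * conj (phi lam m (cis θ)) ∂circ lam = 0 :=
  integral_phi_mul_eigen hlam n (by exact_mod_cast h) (isTransposeEigen_conj_phi hlam m)

lemma integral_phi_mul_cis_mul_phi {lam : ℝ} (hlam : 0 ≤ lam) (n m : ℕ) :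
    ∫ θ, phi lam n (cis θ) * (cis θ * phi lam m (cis θ)) ∂circ lam = 0 :=
  integral_phi_mul_eigen hlam n (by have : (0 : ℝ) ≤ n := by positivity
                                    have : (0 : ℝ) ≤ m := by positivity
                                    intro h; linarith) (isTransposeEigen_cis_mul_phi hlam m)

/-- The squared norms on the circle, from the recursion `basicPoly_recursion` whose right-hand side
is an orthogonal sum. -/
lemma integral_basicPoly_mul_conj {lam : ℝ} (hlam : 0 ≤ lam) (n : ℕ) :
    ∫ θ, basicPoly lam n (cis θ) * conj (basicPoly lam n (cis θ)) ∂circ lam =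
      (binA (2 * lam + 1) n * circMass lam : ℝ) := by
  induction n with
  | zero =>
    simp [basicPoly_zero, binA_zero, circMass]
  | succ n ih =>
    have hn : ((n : ℂ) + 1) ≠ 0 := by exact_mod_cast Nat.succ_ne_zero n
    have hX : ∫ θ, basicPoly lam (n + 1) (cis θ) * (cis θ * basicPoly lam n (cis θ)) ∂circ lam
        = 0 := by
      have h := integral_phi_mul_cis_mul_phi hlam (n + 1) n
      simp only [phi_eq] at h
      have e : ∀ θ, eps lam (n + 1) * basicPoly lam (n + 1) (cis θ) *
          (cis θ * (eps lam n * basicPoly lam n (cis θ))) = (eps lam (n + 1) * eps lam n : ℂ) *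
            (basicPoly lam (n + 1) (cis θ) * (cis θ * basicPoly lam n (cis θ))) :=
        fun θ => by ring
      simp only [e] at h
      rw [integral_const_mul] at h
      refine (mul_eq_zero.1 h).resolve_left (mul_ne_zero ?_ ?_)
      · exact_mod_cast (eps_pos hlam (n + 1)).ne'
      · exact_mod_cast (eps_pos hlam n).ne'
    have hX' : ∫ θ, conj (basicPoly lam (n + 1) (cis θ) * (cis θ * basicPoly lam n (cis θ)))
        ∂circ lam = 0 := by rw [integral_conj, hX, map_zero]
    have c0 : Continuous fun θ => basicPoly lam n (cis θ) :=
      (continuous_basicPoly lam n).comp continuous_cis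
    have c1 : Continuous fun θ => basicPoly lam (n + 1) (cis θ) :=
      (continuous_basicPoly lam (n + 1)).comp continuous_cis
    have cc := continuous_cis
    have key : ∀ θ, ((n : ℂ) + 1) ^ 2 *
        (basicPoly lam (n + 1) (cis θ) * conj (basicPoly lam (n + 1) (cis θ))) =
        (((lam : ℂ) + n + 1) ^ 2 - lam ^ 2) *
          (basicPoly lam n (cis θ) * conj (basicPoly lam n (cis θ))) +
        ((n + 1) * lam) * (basicPoly lam (n + 1) (cis θ) * (cis θ * basicPoly lam n (cis θ)) +
          conj (basicPoly lam (n + 1) (cis θ) * (cis θ * basicPoly lam n (cis θ)))) := by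
      intro θ
      have h := basicPoly_recursion lam n (cis θ)
      have h' := congrArg conj h
      simp only [map_mul, map_add, map_sub, map_one, map_natCast, Complex.conj_ofReal,
        Complex.conj_conj] at h' ⊢
      have hc := conj_cis_mul θ
      generalize cis θ = e at *
      generalize conj e = e' at *
      generalize basicPoly lam (n + 1) e = Y at *
      generalize basicPoly lam n e = X at *
      generalize conj X = X' at *
      generalize conj Y = Y' at *
      linear_combination (-((lam : ℂ) + n + 1) * (e' * X')) * h -
        ((n + 1) * Y - lam * (e' * X')) * h' +
        ((((lam : ℂ) + n + 1) ^ 2 - lam ^ 2) * X * X') * hc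
    have hint := congrArg (fun f : ℝ → ℂ => ∫ θ, f θ ∂circ lam) (funext key)
    rw [integral_const_mul, integral_add, integral_const_mul, integral_const_mul, ih,
      integral_add, hX, hX'] at hint
    · have hs : ((n : ℂ) + 1) * (binA (2 * lam + 1) (n + 1) : ℂ) =
          (2 * lam + 1 + n) * binA (2 * lam + 1) n := by
        exact_mod_cast succ_mul_binA (2 * lam + 1) n
      apply mul_left_cancel₀ (pow_ne_zero 2 hn)
      rw [hint]
      push_cast
      linear_combination (-((n : ℂ) + 1) * circMass lam) * hs
    · exact Continuous.integrable_circ hlam (c1.mul (cc.mul c0))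
    · exact Continuous.integrable_circ hlam
        (Complex.continuous_conj.comp (c1.mul (cc.mul c0)))
    · exact Continuous.integrable_circ hlam
        (continuous_const.mul (c0.mul (Complex.continuous_conj.comp c0)))
    · exact Continuous.integrable_circ hlam (continuous_const.mul ((c1.mul (cc.mul c0)).add
        (Complex.continuous_conj.comp (c1.mul (cc.mul c0)))))

lemma integral_phi_mul_conj_phi {lam : ℝ} (hlam : 0 ≤ lam) (n m : ℕ) :
    ∫ θ, phi lam n (cis θ) * conj (phi lam m (cis θ)) ∂circ lam =
      if n = m then (circMass lam : ℂ) else 0 := by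
  split_ifs with h
  · subst h
    have e : ∀ θ, phi lam n (cis θ) * conj (phi lam n (cis θ)) = ((eps lam n ^ 2 : ℝ) : ℂ) *
        (basicPoly lam n (cis θ) * conj (basicPoly lam n (cis θ))) := fun θ => by
      rw [phi_eq]; simp; ring
    simp only [e]
    rw [integral_const_mul, integral_basicPoly_mul_conj hlam, ← Complex.ofReal_mul, eps_sq hlam,
      inv_mul_cancel_left₀ (binA_pos (by linarith) n).ne']
  · exact integral_phi_mul_conj_phi_of_ne hlam (Ne.symm h)

/-- Integration term by term of a series in the basic polynomials over a circle. -/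
lemma IsCoefSeq.hasSum_circPair {lam : ℝ} (hlam : 0 ≤ lam) {a : ℕ → ℂ} (ha : IsCoefSeq lam a)
    {η : ℝ → ℂ} (hη : Continuous η) {r : ℝ} (h0 : 0 ≤ r) (h1 : r < 1) :
    HasSum (fun n => a n * r ^ n * ∫ θ, phi lam n (cis θ) * η θ ∂circ lam)
      (circPair lam (fun z => ∑' n, a n * phi lam n z) η r) := by
  have hc : ∀ n, Continuous fun θ => a n * phi lam n (r * cis θ) * η θ := fun n =>
    (continuous_const.mul ((continuous_phi hlam n).comp
      (continuous_const.mul continuous_cis))).mul hη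
  have h := hasSum_integral_of_summable_integral_norm (μ := circ lam)
    (F := fun n θ => a n * phi lam n (r * cis θ) * η θ)
    (fun n => Continuous.integrable_circ hlam (hc n)) ?_
  · simp only [tsum_mul_right] at h
    refine HasSum.congr_fun h fun n => ?_
    rw [← integral_const_mul]
    simp only [phi_real_mul]
    congr 1; ext θ; ring
  · obtain ⟨s, hs1, hs2⟩ := exists_between h1
    refine Summable.of_nonneg_of_le (fun n => integral_nonneg fun θ => norm_nonneg _) (fun n => ?_)
      ((ha s (h0.trans_lt hs1) hs2).mul_right (∫ θ, ‖η θ‖ ∂circ lam))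
    rw [← integral_const_mul]
    refine integral_mono (Continuous.integrable_circ hlam (hc n).norm)
      (Continuous.integrable_circ hlam (continuous_const.mul hη.norm)) fun θ => ?_
    simp only
    rw [norm_mul]
    refine mul_le_mul_of_nonneg_right ?_ (norm_nonneg _)
    refine ((isHomBounded_phi hlam n (a n)).norm_le _).trans ?_
    rw [norm_real_mul_cis h0]
    gcongr

/-! ### Uniqueness and expansion -/

section Spanning

variable {lam : ℝ} {G : ℝ → ℂ}

/-- Vanishing of the moments of `G` against `e^{ikθ}` and `e^{-ikθ}`. -/
def MomentsVanish (lam : ℝ) (G : ℝ → ℂ) (k : ℕ) : Prop :=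
  ∫ θ, G θ * cis θ ^ k ∂circ lam = 0 ∧ ∫ θ, G θ * conj (cis θ) ^ k ∂circ lam = 0

lemma MomentsVanish.mixed {k : ℕ} (h : ∀ i ≤ k, MomentsVanish lam G i) (a b : ℕ)
    (hab : a ≤ b + k) (hba : b ≤ a + k) :
    ∫ θ, G θ * (conj (cis θ) ^ a * cis θ ^ b) ∂circ lam = 0 := by
  rcases le_total a b with hle | hle
  · obtain ⟨d, rfl⟩ := Nat.exists_eq_add_of_le hle
    have e : ∀ θ, conj (cis θ) ^ a * cis θ ^ (a + d) = cis θ ^ d := fun θ => by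
      rw [pow_add, ← mul_assoc, ← mul_pow, conj_cis_mul, one_pow, one_mul]
    simp only [e]
    exact (h d (by omega)).1
  · obtain ⟨d, rfl⟩ := Nat.exists_eq_add_of_le hle
    have e : ∀ θ, conj (cis θ) ^ (b + d) * cis θ ^ b = conj (cis θ) ^ d := fun θ => by
      rw [pow_add, mul_right_comm, ← mul_pow, conj_cis_mul, one_pow, one_mul]
    simp only [e]
    exact (h d (by omega)).2

/-- Orthogonality to the functions `conj φ_n` and `e^{iθ} φ_n` forces all Fourier moments to vanish,
since these functions are triangular with respect to the exponentials. -/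
lemma momentsVanish (hlam : 0 ≤ lam) (hG : Continuous G)
    (h1 : ∀ n, ∫ θ, G θ * conj (phi lam n (cis θ)) ∂circ lam = 0)
    (h2 : ∀ n, ∫ θ, G θ * (cis θ * phi lam n (cis θ)) ∂circ lam = 0) (k : ℕ) :
    MomentsVanish lam G k := by
  have hint : ∀ a b, Integrable (fun θ => G θ * (conj (cis θ) ^ a * cis θ ^ b)) (circ lam) :=
    fun a b => Continuous.integrable_circ hlam (hG.mul
      (((Complex.continuous_conj.comp continuous_cis).pow a).mul (continuous_cis.pow b)))
  have hhom : ∀ (c : ℕ → ℕ → ℝ) (n a b : ℕ),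
      ∫ θ, G θ * (conj (cis θ) ^ a * cis θ ^ b * homPoly c n (cis θ)) ∂circ lam =
        ∑ x ∈ Finset.HasAntidiagonal.antidiagonal n, (c x.1 x.2 : ℂ) *
          ∫ θ, G θ * (conj (cis θ) ^ (x.1 + a) * cis θ ^ (x.2 + b)) ∂circ lam := by
    intro c n a b
    simp only [← integral_const_mul]
    rw [← integral_finsetSum _ fun x _ => (hint _ _).const_mul _]
    congr 1; ext θ
    rw [homPoly, Finset.mul_sum, Finset.mul_sum]
    exact Finset.sum_congr rfl fun x _ => by ring
  have g1 : ∀ n, ∫ θ, G θ * homPoly (fun j k => coefA lam k j) n (cis θ) ∂circ lam = 0 := by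
    intro n
    have h := h1 n
    simp only [phi_eq, map_mul, Complex.conj_ofReal, basicPoly, conj_homPoly] at h
    simp only [mul_left_comm (G _)] at h
    rw [integral_const_mul] at h
    exact (mul_eq_zero.1 h).resolve_left (by exact_mod_cast (eps_pos hlam n).ne')
  have g2 : ∀ n, ∫ θ, G θ * (cis θ * homPoly (coefA lam) n (cis θ)) ∂circ lam = 0 := by
    intro n
    have h := h2 n
    simp only [phi_eq, basicPoly] at h
    have e : ∀ θ, G θ * (cis θ * (eps lam n * homPoly (coefA lam) n (cis θ))) =
        eps lam n * (G θ * (cis θ * homPoly (coefA lam) n (cis θ))) := fun θ => by ring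
    simp only [e] at h
    rw [integral_const_mul] at h
    exact (mul_eq_zero.1 h).resolve_left (by exact_mod_cast (eps_pos hlam n).ne')
  induction k using Nat.strong_induction_on with
  | _ k ih =>
  rcases k with _ | k
  · have := g1 0
    simp [homPoly, coefA, binA_zero] at this
    simp [MomentsVanish, this]
  have ih' : ∀ i ≤ k, MomentsVanish lam G i := fun i hi => ih i (by omega)
  -- `e^{i(k+1)θ}` is the only new exponential in `e^{iθ} φ_k`
  have hA : ∫ θ, G θ * cis θ ^ (k + 1) ∂circ lam = 0 := by
    have h := hhom (coefA lam) k 0 1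
    simp only [pow_zero, pow_one, one_mul] at h
    rw [g2, Finset.sum_eq_single (0, k)] at h
    · have hne : (coefA lam 0 k : ℂ) ≠ 0 := by
        rw [coefA, binA_zero, one_mul]; exact_mod_cast (binA_pos (by linarith) k).ne'
      have := (mul_eq_zero.1 h.symm).resolve_left hne
      simpa using this
    · rintro ⟨j, l⟩ hx hne
      have hjl : j + l = k := Finset.HasAntidiagonal.mem_antidiagonal.1 hx
      have hj : j ≠ 0 := by rintro rfl; apply hne; simp at hjl; simp [hjl]
      rw [MomentsVanish.mixed ih' _ _ (by simp; omega) (by simp; omega), mul_zero]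
    · simp
  refine ⟨hA, ?_⟩
  -- the new exponentials in `conj φ_{k+1}` are `e^{-i(k+1)θ}` and `e^{i(k+1)θ}`
  have h := hhom (fun j k => coefA lam k j) (k + 1) 0 0
  simp only [pow_zero, one_mul] at h
  rw [g1, Finset.sum_eq_single (k + 1, 0)] at h
  · have hne : (coefA lam 0 (k + 1) : ℂ) ≠ 0 := by
      rw [coefA, binA_zero, one_mul]; exact_mod_cast (binA_pos (by linarith) (k + 1)).ne'
    have := (mul_eq_zero.1 h.symm).resolve_left hne
    simpa using this
  · rintro ⟨j, l⟩ hx hne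
    have hjl : j + l = k + 1 := Finset.HasAntidiagonal.mem_antidiagonal.1 hx
    rcases Nat.eq_zero_or_pos j with rfl | hj
    · have : l = k + 1 := by simpa using hjl
      subst this
      simp [hA]
    · have hl : l ≠ 0 := by rintro rfl; apply hne; simp at hjl; simp [hjl]
      rw [MomentsVanish.mixed ih' _ _ (by simp; omega) (by simp; omega), mul_zero]
  · simp

end Spanning

/-- Uniqueness of Fourier coefficients for the weighted circle. -/
lemma eq_zero_of_momentsVanish {lam : ℝ} (hlam : 0 ≤ lam) {G : ℝ → ℂ} (hG : Continuous G)
    (hper : G (-Real.pi) = G Real.pi) (h : ∀ k, MomentsVanish lam G k) {θ : ℝ}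
    (hθ : θ ∈ Ioc (-Real.pi) Real.pi) (hs : Real.sin θ ≠ 0) : G θ = 0 := by
  have : Fact (0 < 2 * Real.pi) := ⟨Real.two_pi_pos⟩
  set H : ℝ → ℂ := fun θ => |Real.sin θ| ^ (2 * lam) • G θ with hH
  have hHc : Continuous H := (continuous_sinWeight hlam).smul hG
  have eπ : -Real.pi + 2 * Real.pi = Real.pi := by ring
  have hc : Continuous (AddCircle.liftIoc (2 * Real.pi) (-Real.pi) H) :=
    AddCircle.liftIoc_continuous (by rw [eπ]; simp [hH, hper]) hHc.continuousOn
  let f : C(AddCircle (2 * Real.pi), ℂ) := ⟨_, hc⟩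
  have hcoef : ∀ n : ℤ, fourierCoeff f n = 0 := by
    intro n
    have e1 : fourierCoeff f n = fourierCoeff (AddCircle.liftIoc (2 * Real.pi) (-Real.pi) H) n := rfl
    rw [e1, fourierCoeff_eq_intervalIntegral _ _ (-Real.pi)]
    have e2 : ∫ x in -Real.pi..-Real.pi + 2 * Real.pi, fourier (-n) (x : AddCircle (2 * Real.pi)) •
        AddCircle.liftIoc (2 * Real.pi) (-Real.pi) H x =
        ∫ x, G x * Complex.exp (-n * x * Complex.I) ∂circ lam := by
      rw [integral_circ hlam, eπ]
      refine intervalIntegral.integral_congr_ae (ae_of_all _ fun x hx => ?_)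
      rw [uIoc_of_le (by linarith [Real.pi_pos])] at hx
      rw [AddCircle.liftIoc_coe_apply (by rwa [eπ]), fourier_coe_apply, hH]
      simp only [smul_eq_mul, Complex.real_smul]
      have : 2 * (Real.pi : ℂ) * Complex.I * ((-n : ℤ) : ℂ) * x / ((2 * Real.pi : ℝ) : ℂ) =
          -n * x * Complex.I := by
        have : (Real.pi : ℂ) ≠ 0 := by exact_mod_cast Real.pi_ne_zero
        push_cast; field_simp
      rw [this]; ring
    rw [e2]
    have e3 : ∫ x, G x * Complex.exp (-n * x * Complex.I) ∂circ lam = 0 := by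
      rcases Int.eq_nat_or_neg n with ⟨k, rfl | rfl⟩
      · rw [← (h k).2]
        congr 1; ext x
        rw [conj_cis, ← Complex.exp_nat_mul]
        congr 2; push_cast; ring
      · rw [← (h k).1]
        congr 1; ext x
        rw [cis, ← Complex.exp_nat_mul]
        congr 2; push_cast; ring
    rw [e3, smul_zero]
  have hsum : Summable (fourierCoeff f) := by
    rw [show fourierCoeff f = fun _ => 0 from funext hcoef]; exact summable_zero
  have h0 := has_pointwise_sum_fourier_series_of_summable hsum (θ : AddCircle (2 * Real.pi))
  simp only [hcoef, zero_smul] at h0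
  have h1 : f (θ : AddCircle (2 * Real.pi)) = 0 := h0.unique hasSum_zero
  have h2 : f (θ : AddCircle (2 * Real.pi)) = H θ := by
    change AddCircle.liftIoc (2 * Real.pi) (-Real.pi) H θ = H θ
    exact AddCircle.liftIoc_coe_apply (by rwa [eπ])
  rw [h2, hH] at h1
  simp only at h1
  exact (smul_eq_zero.1 h1).resolve_left (Real.rpow_pos_of_pos (abs_pos.2 hs) _).ne'

/-- A `lam`-analytic function that is orthogonal to all `φ_n` on circles vanishes. Orthogonality to
the functions `e^{iθ} φ_n` need not be assumed, by `IsOffReal.circPair_eq_zero`. -/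
lemma IsOffReal.eq_zero {lam : ℝ} (hlam : 0 ≤ lam) {g : ℂ → ℂ} (hg : IsOffReal lam g)
    (h : ∀ n, ∀ r ∈ Ioo (0 : ℝ) 1, circPair lam g (fun θ => conj (phi lam n (cis θ))) r = 0)
    {z : ℂ} (hz : z ∈ disk) : g z = 0 := by
  have hoff : ∀ z ∈ disk, z.im ≠ 0 → g z = 0 := by
    intro z hz hi
    have hz0 : z ≠ 0 := by rintro rfl; simp at hi
    have hr : ‖z‖ ∈ Ioo (0 : ℝ) 1 := ⟨norm_pos_iff.2 hz0, mem_disk.1 hz⟩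
    have e : ((‖z‖ : ℝ) : ℂ) * cis z.arg = z := Complex.norm_mul_exp_arg_mul_I z
    have hs : Real.sin z.arg ≠ 0 := by
      rw [Complex.sin_arg]; exact div_ne_zero hi (norm_ne_zero_iff.2 hz0)
    have := eq_zero_of_momentsVanish hlam (hg.continuous_circle hr.1.le hr.2)
      (by simp only [cis_neg_pi]) (momentsVanish hlam (hg.continuous_circle hr.1.le hr.2)
        (fun n => h n _ hr) (fun n => hg.circPair_eq_zero hlam
          (by have : (0 : ℝ) ≤ n := by positivity
              linarith) (isTransposeEigen_cis_mul_phi hlam n) hr))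
      (Complex.arg_mem_Ioc z) hs
    simpa only [e] using this
  by_cases hi : z.im = 0
  swap
  · exact hoff z hz hi
  have hpath : Tendsto (fun t : ℝ => z + t * Complex.I) (𝓝[≠] 0) (𝓝 z) := by
    have : Continuous fun t : ℝ => z + t * Complex.I := by fun_prop
    have := this.tendsto 0
    simp only [Complex.ofReal_zero, zero_mul, add_zero] at this
    exact this.mono_left nhdsWithin_le_nhds
  have h1 : Tendsto (fun t : ℝ => g (z + t * Complex.I)) (𝓝[≠] 0) (𝓝 (g z)) :=
    (hg.differentiableAt hz).continuousAt.tendsto.comp hpath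
  have h2 : (fun t : ℝ => g (z + t * Complex.I)) =ᶠ[𝓝[≠] 0] fun _ => 0 := by
    filter_upwards [hpath.eventually (isOpen_disk.mem_nhds hz), self_mem_nhdsWithin] with t ht ht0
    exact hoff _ ht (by simpa [hi] using ht0)
  exact tendsto_nhds_unique (h1.congr' h2) tendsto_const_nhds |>.symm ▸ rfl

lemma IsOffReal.sub {lam : ℝ} {f g : ℂ → ℂ} (hf : IsOffReal lam f) (hg : IsOffReal lam g) :
    IsOffReal lam (fun z => f z - g z) := by
  refine ⟨hf.contDiffOn.sub hg.contDiffOn, fun z hz hi => ?_⟩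
  have h1 := hf.eq_off z hz hi
  have h2 := hg.eq_off z hz hi
  have e : dbar (fun z => f z - g z) z = dbar f z - dbar g z := by
    simp only [dbar]
    rw [fderiv_fun_sub (hf.differentiableAt hz) (hg.differentiableAt hz)]
    simp; ring
  rw [e]
  linear_combination h1 - h2

/-- The coefficients of a series of basic polynomials are recovered from its circle pairings. -/
lemma IsCoefSeq.circPair_conj_phi {lam : ℝ} (hlam : 0 ≤ lam) {a : ℕ → ℂ} (ha : IsCoefSeq lam a)
    (n : ℕ) {r : ℝ} (h0 : 0 ≤ r) (h1 : r < 1) :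
    circPair lam (fun z => ∑' n, a n * phi lam n z) (fun θ => conj (phi lam n (cis θ))) r =
      circMass lam * a n * r ^ n := by
  have hc : Continuous fun θ => conj (phi lam n (cis θ)) :=
    Complex.continuous_conj.comp ((continuous_phi hlam n).comp continuous_cis)
  have h := ha.hasSum_circPair hlam hc h0 h1
  simp only [integral_phi_mul_conj_phi hlam] at h
  refine h.unique ?_
  convert hasSum_ite_eq n (circMass lam * a n * (r : ℂ) ^ n) using 2 with k
  split_ifs with hk
  · subst hk; ring
  · simp

/-- Every `lam`-analytic function on the disk is a series in the basic polynomials. -/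
theorem IsOffReal.expansion {lam : ℝ} (hlam : 0 ≤ lam) {g : ℂ → ℂ} (hg : IsOffReal lam g) :
    ∃ a : ℕ → ℂ, IsCoefSeq lam a ∧ ∀ z ∈ disk, g z = ∑' n, a n * phi lam n z := by
  have hκ := circMass_pos hlam
  have hκ' : (circMass lam : ℂ) ≠ 0 := by exact_mod_cast hκ.ne'
  choose c hc using fun n => hg.circPair_eq hlam (isTransposeEigen_conj_phi hlam n)
  have ha : IsCoefSeq lam fun n => (circMass lam : ℂ)⁻¹ * c n := by
    intro r h0 h1
    obtain ⟨s, hs1, hs2⟩ := exists_between h1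
    have hs0 := h0.trans hs1
    obtain ⟨C, hC⟩ := (isCompact_closedBall (0 : ℂ) s).exists_bound_of_continuousOn
      (hg.contDiffOn.continuousOn.mono (Metric.closedBall_subset_ball hs2))
    have hC0 : 0 ≤ C := (norm_nonneg _).trans (hC 0 (by simp [hs0.le]))
    -- a Cauchy estimate on the circle of radius `s`
    have hb : ∀ n, ‖c n‖ * s ^ n ≤ C * ((n : ℝ) + 1) ^ growthExp lam * circMass lam := by
      intro n
      have e := hc n s ⟨hs0, hs2⟩
      rw [Real.rpow_natCast] at e
      have e2 : ‖c n‖ * s ^ n = ‖circPair lam g (fun θ => conj (phi lam n (cis θ))) s‖ := by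
        rw [e, norm_mul, Complex.norm_real, Real.norm_of_nonneg (by positivity), mul_comm]
      rw [e2]
      have := isFiniteMeasure_circ hlam
      refine norm_integral_le_of_norm_le_const (ae_of_all _ fun θ => ?_)
      rw [norm_mul, RCLike.norm_conj]
      refine mul_le_mul (hC _ ?_) ?_ (norm_nonneg _) hC0
      · rw [mem_closedBall_zero_iff, norm_real_mul_cis hs0.le]
      · simpa [norm_cis] using norm_phi_le hlam n (cis θ)
    refine Summable.of_nonneg_of_le (fun n => by positivity) (fun n => ?_)
      ((summable_growth (growthExp lam + growthExp lam) (by positivity)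
        ((div_lt_one hs0).2 hs1)).mul_left C)
    have e3 : r ^ n = (r / s) ^ n * s ^ n := by rw [← mul_pow, div_mul_cancel₀ _ hs0.ne']
    rw [norm_mul, norm_inv, Complex.norm_real, Real.norm_of_nonneg hκ.le, e3, pow_add]
    calc (circMass lam)⁻¹ * ‖c n‖ * ((n : ℝ) + 1) ^ growthExp lam * ((r / s) ^ n * s ^ n)
        = (‖c n‖ * s ^ n) * ((circMass lam)⁻¹ * ((n : ℝ) + 1) ^ growthExp lam * (r / s) ^ n) := by
          ring
      _ ≤ (C * ((n : ℝ) + 1) ^ growthExp lam * circMass lam) *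
          ((circMass lam)⁻¹ * ((n : ℝ) + 1) ^ growthExp lam * (r / s) ^ n) :=
          mul_le_mul_of_nonneg_right (hb n) (by positivity)
      _ = _ := by field_simp
  refine ⟨_, ha, fun z hz => ?_⟩
  have hs := ha.isLamAnalytic hlam
  refine sub_eq_zero.1 ((hg.sub hs.isOffReal).eq_zero hlam (fun n r hr => ?_) hz)
  have hη : Continuous fun θ => conj (phi lam n (cis θ)) :=
    Complex.continuous_conj.comp ((continuous_phi hlam n).comp continuous_cis)
  have h1 := hc n r hr
  have h2 := ha.circPair_conj_phi hlam n hr.1.le hr.2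
  have h3 : circPair lam (fun z => g z - ∑' n, (circMass lam : ℂ)⁻¹ * c n * phi lam n z)
      (fun θ => conj (phi lam n (cis θ))) r =
      circPair lam g (fun θ => conj (phi lam n (cis θ))) r -
      circPair lam (fun z => ∑' n, (circMass lam : ℂ)⁻¹ * c n * phi lam n z)
        (fun θ => conj (phi lam n (cis θ))) r := by
    simp only [circPair, sub_mul]
    exact integral_sub (Continuous.integrable_circ hlam
      ((hg.continuous_circle hr.1.le hr.2).mul hη)) (Continuous.integrable_circ hlam
      ((hs.isOffReal.continuous_circle hr.1.le hr.2).mul hη))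
  rw [h3, h1, h2, Real.rpow_natCast]
  push_cast
  field_simp
  ring

end LambdaBergman

namespace LambdaBergman

open Filter Topology Set

/-! ### Polar coordinates -/

/-- The radial part of `sigma`. -/
noncomputable def radial (lam : ℝ) : Measure ℝ :=
  (volume.restrict (Ioo 0 1)).withDensity
    (fun r => ENNReal.ofReal (normConst lam * r ^ (2 * lam + 1)))

lemma normConst_pos {lam : ℝ} (hlam : 0 ≤ lam) : 0 < normConst lam :=
  div_pos (Real.Gamma_pos_of_pos (by linarith))
    (mul_pos (Real.Gamma_pos_of_pos (by linarith)) (Real.Gamma_pos_of_pos (by norm_num)))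

lemma continuous_radialWeight {lam : ℝ} (hlam : 0 ≤ lam) :
    Continuous fun r : ℝ => normConst lam * r ^ (2 * lam + 1) :=
  continuous_const.mul (Real.continuous_rpow_const (by linarith))

lemma isFiniteMeasure_radial {lam : ℝ} (hlam : 0 ≤ lam) : IsFiniteMeasure (radial lam) := by
  refine isFiniteMeasure_withDensity (ne_of_lt ?_)
  calc ∫⁻ r in Ioo (0 : ℝ) 1, ENNReal.ofReal (normConst lam * r ^ (2 * lam + 1))
      ≤ ∫⁻ _ in Ioo (0 : ℝ) 1, ENNReal.ofReal (normConst lam) := by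
        refine setLIntegral_mono measurable_const fun r hr => ?_
        refine ENNReal.ofReal_le_ofReal (mul_le_of_le_one_right (normConst_pos hlam).le ?_)
        exact Real.rpow_le_one hr.1.le hr.2.le (by linarith)
    _ < ⊤ := by simp

lemma ae_radial (lam : ℝ) : ∀ᵐ r ∂radial lam, r ∈ Ioo (0 : ℝ) 1 :=
  (withDensity_absolutelyContinuous _ _).ae_le (ae_restrict_mem measurableSet_Ioo)

lemma continuous_polar : Continuous fun p : ℝ × ℝ => (p.1 : ℂ) * cis p.2 :=
  (Complex.continuous_ofReal.comp continuous_fst).mul (continuous_cis.comp continuous_snd)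

/-- `sigma` is the product of its radial and angular parts in polar coordinates. -/
lemma sigma_eq_map {lam : ℝ} (hlam : 0 ≤ lam) :
    sigma lam = ((radial lam).prod (circ lam)).map (fun p : ℝ × ℝ => (p.1 : ℂ) * cis p.2) := by
  have := isFiniteMeasure_circ hlam
  have := isFiniteMeasure_radial hlam
  refine Measure.ext_of_lintegral _ fun f hf => ?_
  have hDm : Measurable fun z : ℂ => ENNReal.ofReal (normConst lam * |z.im| ^ (2 * lam)) := by
    refine Measurable.ennreal_ofReal (Continuous.measurable (continuous_const.mul ?_))
    exact (Complex.continuous_im.abs).rpow_const fun _ => Or.inr (by linarith)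
  have hdm : MeasurableSet disk := isOpen_disk.measurableSet
  have hcm := (continuous_sinWeight hlam).measurable.ennreal_ofReal
  have hrm := (continuous_radialWeight hlam).measurable.ennreal_ofReal
  have hfp : Measurable fun p : ℝ × ℝ => f (p.1 * cis p.2) := hf.comp continuous_polar.measurable
  rw [lintegral_map hf continuous_polar.measurable, lintegral_prod _ hfp.aemeasurable, sigma,
    lintegral_withDensity_eq_lintegral_mul _ hDm hf, ← lintegral_indicator hdm,
    ← Complex.lintegral_comp_polarCoord_symm, show polarCoord.target = Ioi 0 ×ˢ Ioo (-Real.pi) Real.pi from rfl,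
    Measure.volume_eq_prod,
    ← Measure.prod_restrict, lintegral_prod]
  swap
  · refine Measurable.aemeasurable ?_
    refine (measurable_fst.ennreal_ofReal).mul ?_
    refine ((hDm.mul hf).indicator hdm).comp ?_
    have : (Complex.polarCoord.symm : ℝ × ℝ → ℂ) = fun p => (p.1 : ℂ) * cis p.2 := by
      ext1 p
      rw [Complex.polarCoord_symm_apply, cis, Complex.exp_mul_I]; simp
    rw [this]
    exact continuous_polar.measurable
  have hin : ∀ r : ℝ, ∫⁻ θ, f (r * cis θ) ∂circ lam =
      ∫⁻ θ in Ioo (-Real.pi) Real.pi, ENNReal.ofReal (|Real.sin θ| ^ (2 * lam)) * f (r * cis θ) := by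
    intro r
    have hm : Measurable fun θ => f (r * cis θ) :=
      hf.comp (continuous_const.mul continuous_cis).measurable
    rw [circ, lintegral_withDensity_eq_lintegral_mul _ hcm hm,
      Measure.restrict_congr_set Ioo_ae_eq_Ioc]
    rfl
  simp only [hin]
  have hout : Measurable fun r : ℝ => ∫⁻ θ in Ioo (-Real.pi) Real.pi,
      ENNReal.ofReal (|Real.sin θ| ^ (2 * lam)) * f (r * cis θ) :=
    Measurable.lintegral_prod_right' (f := fun p : ℝ × ℝ =>
      ENNReal.ofReal (|Real.sin p.2| ^ (2 * lam)) * f (p.1 * cis p.2))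
      ((hcm.comp measurable_snd).mul hfp)
  rw [radial, lintegral_withDensity_eq_lintegral_mul _ hrm hout, ← lintegral_indicator
    measurableSet_Ioo, ← lintegral_indicator measurableSet_Ioi]
  refine lintegral_congr fun r => ?_
  by_cases hr0 : 0 < r
  swap
  · rw [indicator_of_notMem (by simpa using hr0), indicator_of_notMem (fun h => hr0 h.1)]
  rw [indicator_of_mem (by exact hr0)]
  have hz : ∀ θ : ℝ, Complex.polarCoord.symm (r, θ) = r * cis θ := fun θ => by
    rw [Complex.polarCoord_symm_apply, cis, Complex.exp_mul_I]; simp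
  simp only [hz]
  by_cases hr1 : r < 1
  · have hr1' : r ∈ Ioo (0 : ℝ) 1 := ⟨hr0, hr1⟩
    rw [indicator_of_mem hr1', Pi.mul_apply, ← lintegral_const_mul]
    swap
    · exact hcm.mul (hf.comp (continuous_const.mul continuous_cis).measurable)
    refine lintegral_congr fun θ => ?_
    rw [indicator_of_mem (real_mul_cis_mem_disk hr0.le hr1 θ), Pi.mul_apply, smul_eq_mul,
      ← mul_assoc, ← mul_assoc, ← ENNReal.ofReal_mul hr0.le, ← ENNReal.ofReal_mul
      (mul_nonneg (normConst_pos hlam).le (by positivity))]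
    congr 2
    rw [← Complex.real_smul, Complex.smul_im, cis_im, smul_eq_mul, abs_mul, abs_of_pos hr0,
      Real.mul_rpow hr0.le (abs_nonneg _), Real.rpow_add_one hr0.ne']
    ring
  · have hr1' : r ∉ Ioo (0 : ℝ) 1 := fun h => hr1 h.2
    rw [indicator_of_notMem hr1']
    refine (lintegral_congr fun θ => ?_).trans lintegral_zero
    rw [indicator_of_notMem, smul_zero]
    rw [mem_disk, norm_real_mul_cis hr0.le]; exact hr1

lemma isFiniteMeasure_sigma {lam : ℝ} (hlam : 0 ≤ lam) : IsFiniteMeasure (sigma lam) := by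
  have := isFiniteMeasure_circ hlam
  have := isFiniteMeasure_radial hlam
  rw [sigma_eq_map hlam]
  infer_instance

lemma ae_sigma (lam : ℝ) : ∀ᵐ z ∂sigma lam, z ∈ disk :=
  (withDensity_absolutelyContinuous _ _).ae_le (ae_restrict_mem isOpen_disk.measurableSet)

lemma sigma_absolutelyContinuous (lam : ℝ) : sigma lam ≪ volume.restrict disk :=
  withDensity_absolutelyContinuous _ _

/-- Integration in polar coordinates; the inequality needs no measurability of `f`. -/
lemma lintegral_sigma_le {lam : ℝ} (hlam : 0 ≤ lam) (f : ℂ → ℝ≥0∞) :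
    ∫⁻ z, f z ∂sigma lam ≤ ∫⁻ r, ∫⁻ θ, f (r * cis θ) ∂circ lam ∂radial lam := by
  have := isFiniteMeasure_circ hlam
  have := isFiniteMeasure_radial hlam
  rw [sigma_eq_map hlam]
  exact (lintegral_map_le _ _).trans (lintegral_prod_le _)

lemma integral_sigma {lam : ℝ} (hlam : 0 ≤ lam) {f : ℂ → ℂ} (hf : Integrable f (sigma lam)) :
    ∫ z, f z ∂sigma lam = ∫ r, ∫ θ, f (r * cis θ) ∂circ lam ∂radial lam := by
  have := isFiniteMeasure_circ hlam
  have := isFiniteMeasure_radial hlam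
  rw [sigma_eq_map hlam] at hf ⊢
  rw [integral_map continuous_polar.aemeasurable hf.aestronglyMeasurable]
  exact integral_prod _ (hf.comp_aemeasurable continuous_polar.aemeasurable)

end LambdaBergman

namespace LambdaBergman

open Filter Topology Set ProbabilityTheory

/-! ### The symmetric beta distribution -/

lemma ae_betaMeasure (lam : ℝ) : ∀ᵐ u ∂betaMeasure lam lam, u ∈ Ioo (0 : ℝ) 1 := by
  have hm : Measurable (betaPDF lam lam) := (measurable_betaPDFReal lam lam).ennreal_ofReal
  rw [betaMeasure, ae_withDensity_iff hm]
  filter_upwards with u hu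
  by_contra h
  refine hu ?_
  rw [betaPDF_eq, if_neg (show ¬(0 < u ∧ u < 1) from h), ENNReal.ofReal_zero]

/-- The density of the symmetric beta distribution. -/
noncomputable def betaWeight (lam u : ℝ) : ℝ :=
  1 / beta lam lam * u ^ (lam - 1) * (1 - u) ^ (lam - 1)

lemma betaPDFReal_nonneg {lam : ℝ} (hlam : 0 < lam) (u : ℝ) : 0 ≤ betaPDFReal lam lam u := by
  by_cases h : 0 < u ∧ u < 1
  · exact (betaPDFReal_pos h.1 h.2 hlam hlam).le
  · rw [betaPDFReal, if_neg h]

lemma integral_betaMeasure {lam : ℝ} (hlam : 0 < lam) (f : ℝ → ℝ) :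
    ∫ u, f u ∂betaMeasure lam lam = ∫ u in (0 : ℝ)..1, betaWeight lam u * f u := by
  have hm : Measurable (betaPDF lam lam) := (measurable_betaPDFReal lam lam).ennreal_ofReal
  rw [betaMeasure, integral_withDensity_eq_integral_toReal_smul hm
    (by filter_upwards with u using ENNReal.ofReal_lt_top),
    intervalIntegral.integral_of_le zero_le_one, integral_Ioc_eq_integral_Ioo,
    ← integral_indicator measurableSet_Ioo]
  congr 1
  ext u
  rw [betaPDF, ENNReal.toReal_ofReal (betaPDFReal_nonneg hlam u), betaPDFReal, indicator, smul_eq_mul,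
    betaWeight]
  by_cases h : 0 < u ∧ u < 1
  · rw [if_pos h, if_pos (show u ∈ Ioo (0 : ℝ) 1 from h)]
  · rw [if_neg h, if_neg (show ¬ u ∈ Ioo (0 : ℝ) 1 from h), zero_mul]

lemma intervalIntegrable_betaWeight {lam : ℝ} (hlam : 0 < lam) :
    IntervalIntegrable (betaWeight lam) volume 0 1 := by
  have := isProbabilityMeasureBeta hlam hlam
  rw [intervalIntegrable_iff_integrableOn_Ioo_of_le zero_le_one]
  have h1 : Integrable (betaPDFReal lam lam) volume := by
    refine ⟨(measurable_betaPDFReal lam lam).aestronglyMeasurable, ?_⟩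
    rw [hasFiniteIntegral_iff_ofReal (by filter_upwards with u using betaPDFReal_nonneg hlam u)]
    exact (lintegral_betaPDF_eq_one hlam hlam).trans_lt ENNReal.one_lt_top
  refine h1.integrableOn.congr_fun (fun u hu => ?_) measurableSet_Ioo
  rw [betaPDFReal, if_pos (show 0 < u ∧ u < 1 from hu), betaWeight]

/-- Symmetry of the beta distribution. -/
lemma integral_betaMeasure_one_sub {lam : ℝ} (hlam : 0 < lam) (f : ℝ → ℝ) :
    ∫ u, f (1 - u) ∂betaMeasure lam lam = ∫ u, f u ∂betaMeasure lam lam := by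
  rw [integral_betaMeasure hlam, integral_betaMeasure hlam]
  have := intervalIntegral.integral_comp_sub_left (fun u => betaWeight lam u * f u)
    (a := 0) (b := 1) (1 : ℝ)
  simp only [sub_self, sub_zero] at this
  rw [← this]
  congr 1
  ext u
  rw [betaWeight, betaWeight, sub_sub_cancel]
  ring

/-- Integration by parts against the symmetric beta distribution: the weight satisfies
`(u (1 - u) w)' = lam (1 - 2 u) w`. -/
lemma integral_betaMeasure_by_parts {lam : ℝ} (hlam : 0 < lam) {f f' : ℝ → ℝ}
    (hf : ∀ u ∈ Icc (0 : ℝ) 1, HasDerivAt f (f' u) u) (hf' : ContinuousOn f' (Icc 0 1)) :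
    ∫ u, (lam * (1 - 2 * u) * f u + u * (1 - u) * f' u) ∂betaMeasure lam lam = 0 := by
  rw [integral_betaMeasure hlam]
  have hfc : ContinuousOn f (Icc 0 1) := fun u hu => (hf u hu).continuousAt.continuousWithinAt
  have h := intervalIntegral.integral_eq_sub_of_hasDerivAt_of_le (zero_le_one' ℝ)
    (f := fun u => 1 / beta lam lam * u ^ lam * (1 - u) ^ lam * f u)
    (f' := fun u => betaWeight lam u * (lam * (1 - 2 * u) * f u + u * (1 - u) * f' u)) ?_ ?_ ?_
  · rw [h]
    simp [Real.zero_rpow hlam.ne']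
  · refine ContinuousOn.mul (Continuous.continuousOn ?_) hfc
    refine (continuous_const.mul (Real.continuous_rpow_const hlam.le)).mul
      ((Real.continuous_rpow_const hlam.le).comp (continuous_const.sub continuous_id))
  · intro u hu
    have hu0 : u ≠ 0 := hu.1.ne'
    have hu1 : 1 - u ≠ 0 := by linarith [hu.2]
    have h1 := ((Real.hasDerivAt_rpow_const (p := lam) (Or.inl hu0)).const_mul
      (1 / beta lam lam)).mul (((hasDerivAt_id u).const_sub 1).rpow_const (p := lam) (Or.inl hu1))
    refine (h1.mul (hf u (Ioo_subset_Icc_self hu))).congr_deriv ?_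
    have e1 : u ^ lam = u ^ (lam - 1) * u := by rw [Real.rpow_sub_one hu0]; field_simp
    have e2 : (1 - u) ^ lam = (1 - u) ^ (lam - 1) * (1 - u) := by
      rw [Real.rpow_sub_one hu1]; field_simp
    simp only [Pi.mul_apply, id, betaWeight, e1, e2]
    ring
  · refine (intervalIntegrable_betaWeight hlam).mul_continuousOn ?_
    rw [uIcc_of_le zero_le_one]
    exact ((by fun_prop : Continuous fun u : ℝ => lam * (1 - 2 * u)).continuousOn.mul hfc).add
      ((by fun_prop : Continuous fun u : ℝ => u * (1 - u)).continuousOn.mul hf')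

lemma integral_betaMeasure_two_mul_one_sub {lam : ℝ} (hlam : 0 < lam) :
    ∫ u, 2 * (1 - u) ∂betaMeasure lam lam = 1 := by
  have := isProbabilityMeasureBeta hlam hlam
  have hi : Integrable (fun u : ℝ => u) (betaMeasure lam lam) := by
    refine Integrable.of_bound (by fun_prop) 1 ?_
    filter_upwards [ae_betaMeasure lam] with u hu
    rw [Real.norm_of_nonneg hu.1.le]; exact hu.2.le
  have h := integral_betaMeasure_one_sub hlam (fun u => u)
  rw [integral_sub (integrable_const _) hi] at h
  rw [integral_const_mul, integral_sub (integrable_const _) hi]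
  simp at h ⊢
  linarith

/-! ### The quadratic form in the kernel -/

/-- `|1 - zw|² - 4 u Im z Im w`, which interpolates between `|1 - z w|²` at `u = 0` and
`|1 - z w̄|²` at `u = 1`. -/
noncomputable def quadForm (w : ℂ) (u : ℝ) (z : ℂ) : ℝ :=
  Complex.normSq (1 - z * w) - u * (4 * z.im * w.im)

lemma quadForm_eq (w : ℂ) (u : ℝ) (z : ℂ) : quadForm w u z =
    (1 - u) * Complex.normSq (1 - z * w) + u * Complex.normSq (1 - z * conj w) := by
  simp only [quadForm, Complex.normSq_apply, Complex.sub_re, Complex.sub_im, Complex.mul_re,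
    Complex.mul_im, Complex.one_re, Complex.one_im, Complex.conj_re, Complex.conj_im]
  ring

lemma quadForm_conj (w : ℂ) (u : ℝ) (z : ℂ) : quadForm w u (conj z) = quadForm w (1 - u) z := by
  simp only [quadForm, Complex.normSq_apply, Complex.sub_re, Complex.sub_im, Complex.mul_re,
    Complex.mul_im, Complex.one_re, Complex.one_im, Complex.conj_re, Complex.conj_im]
  ring

lemma one_sub_norm_sq_le_normSq {z w : ℂ} (hz : z ∈ disk) (hw : w ∈ disk) :
    (1 - ‖w‖) ^ 2 ≤ Complex.normSq (1 - z * w) := by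
  rw [mem_disk] at hz hw
  rw [Complex.normSq_eq_norm_sq]
  have h1 : 1 - ‖z‖ * ‖w‖ ≤ ‖1 - z * w‖ := by
    have := norm_sub_norm_le (1 : ℂ) (z * w)
    rwa [norm_one, norm_mul] at this
  have h2 : ‖z‖ * ‖w‖ ≤ ‖w‖ := mul_le_of_le_one_left (norm_nonneg w) hz.le
  gcongr
  linarith

lemma le_quadForm {z w : ℂ} (hz : z ∈ disk) (hw : w ∈ disk) {u : ℝ} (hu : u ∈ Icc (0 : ℝ) 1) :
    (1 - ‖w‖) ^ 2 ≤ quadForm w u z := by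
  have h1 := one_sub_norm_sq_le_normSq hz hw
  have h2 := one_sub_norm_sq_le_normSq hz (conj_mem_disk.2 hw)
  rw [Complex.norm_conj] at h2
  rw [quadForm_eq]
  have := mul_le_mul_of_nonneg_left h1 (sub_nonneg.2 hu.2)
  have := mul_le_mul_of_nonneg_left h2 hu.1
  linarith

lemma one_sub_norm_sq_pos {w : ℂ} (hw : w ∈ disk) : 0 < (1 - ‖w‖) ^ 2 := by
  rw [mem_disk] at hw
  have : 0 < 1 - ‖w‖ := by linarith
  positivity

lemma quadForm_pos {z w : ℂ} (hz : z ∈ disk) (hw : w ∈ disk) {u : ℝ} (hu : u ∈ Icc (0 : ℝ) 1) :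
    0 < quadForm w u z :=
  (one_sub_norm_sq_pos hw).trans_le (le_quadForm hz hw hu)

/-- The derivative of `quadForm w u` at `z`. -/
noncomputable def quadFormDeriv (w : ℂ) (u : ℝ) (z : ℂ) : ℂ →L[ℝ] ℝ :=
  (2 * z.re * Complex.normSq w - 2 * w.re) • Complex.reCLM +
    (2 * z.im * Complex.normSq w + 2 * w.im - u * (4 * w.im)) • Complex.imCLM

lemma quadForm_apply (w : ℂ) (u : ℝ) (z : ℂ) : quadForm w u z =
    1 - 2 * (z.re * w.re - z.im * w.im) + (z.re * z.re + z.im * z.im) * Complex.normSq w -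
      u * (4 * w.im) * z.im := by
  simp only [quadForm, Complex.normSq_apply, Complex.sub_re, Complex.sub_im, Complex.mul_re,
    Complex.mul_im, Complex.one_re, Complex.one_im]
  ring

lemma hasFDerivAt_quadForm (w : ℂ) (u : ℝ) (z : ℂ) :
    HasFDerivAt (quadForm w u) (quadFormDeriv w u z) z := by
  have e : quadForm w u = fun z => 1 - 2 * (z.re * w.re - z.im * w.im) +
      (z.re * z.re + z.im * z.im) * Complex.normSq w - u * (4 * w.im) * z.im :=
    funext (quadForm_apply w u)
  rw [e]
  have hr : HasFDerivAt (fun z : ℂ => z.re) Complex.reCLM z := Complex.reCLM.hasFDerivAt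
  have hi : HasFDerivAt (fun z : ℂ => z.im) Complex.imCLM z := Complex.imCLM.hasFDerivAt
  refine ((((((hr.mul_const w.re).sub (hi.mul_const w.im)).const_mul 2).const_sub 1).add
    (((hr.mul hr).add (hi.mul hi)).mul_const _)).sub (hi.const_mul _)).congr_fderiv ?_
  ext
  simp [quadFormDeriv]
  ring

lemma norm_quadFormDeriv_le {z w : ℂ} (hz : z ∈ disk) (hw : w ∈ disk) {u : ℝ}
    (hu : u ∈ Icc (0 : ℝ) 1) : ‖quadFormDeriv w u z‖ ≤ 12 := by
  rw [mem_disk] at hz hw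
  have hzr := (Complex.abs_re_le_norm z).trans hz.le
  have hzi := (Complex.abs_im_le_norm z).trans hz.le
  have hwr := (Complex.abs_re_le_norm w).trans hw.le
  have hwi := (Complex.abs_im_le_norm w).trans hw.le
  have hn : |Complex.normSq w| ≤ 1 := by
    rw [abs_of_nonneg (Complex.normSq_nonneg w), Complex.normSq_eq_norm_sq]
    exact pow_le_one₀ (norm_nonneg w) hw.le
  have hua : |u| ≤ 1 := abs_le.2 ⟨by linarith [hu.1], hu.2⟩
  have h1 : |z.re * Complex.normSq w| ≤ 1 := by
    rw [abs_mul]; exact mul_le_one₀ hzr (abs_nonneg _) hn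
  have h2 : |z.im * Complex.normSq w| ≤ 1 := by
    rw [abs_mul]; exact mul_le_one₀ hzi (abs_nonneg _) hn
  have h3 : |u * w.im| ≤ 1 := by
    rw [abs_mul]; exact mul_le_one₀ hua (abs_nonneg _) hwi
  rw [abs_le] at h1 h2 h3 hwr hwi
  refine (norm_add_le _ _).trans ?_
  rw [norm_smul, norm_smul, Complex.reCLM_norm, Complex.imCLM_norm, mul_one, mul_one,
    Real.norm_eq_abs, Real.norm_eq_abs]
  have a1 : |2 * z.re * Complex.normSq w - 2 * w.re| ≤ 4 := abs_le.2 ⟨by linarith, by linarith⟩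
  have a2 : |2 * z.im * Complex.normSq w + 2 * w.im - u * (4 * w.im)| ≤ 8 :=
    abs_le.2 ⟨by linarith, by linarith⟩
  linarith

/-! ### The numerator of the Szegő kernel -/

/-- The moments `∫ u ^ k quadForm ^ (-lam - 1)` in terms of which the numerator and its derivative
are expressed. -/
noncomputable def quadMoment (lam : ℝ) (w : ℂ) (k : ℕ) (z : ℂ) : ℝ :=
  ∫ u, u ^ k * quadForm w u z ^ (-lam - 1) ∂betaMeasure lam lam

/-- The numerator of the Szegő kernel for `lam > 0`, see `szego_eq`. -/
noncomputable def szegoNum (lam : ℝ) (w z : ℂ) : ℝ :=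
  ∫ u, 2 * (1 - u) * quadForm w u z ^ (-lam) ∂betaMeasure lam lam

lemma continuous_quadForm_param (w z : ℂ) : Continuous fun u => quadForm w u z := by
  unfold quadForm; fun_prop

lemma quadForm_rpow_le {z w : ℂ} (hz : z ∈ disk) (hw : w ∈ disk) {u : ℝ}
    (hu : u ∈ Icc (0 : ℝ) 1) {s : ℝ} (hs : s ≤ 0) :
    quadForm w u z ^ s ≤ ((1 - ‖w‖) ^ 2) ^ s :=
  Real.rpow_le_rpow_of_nonpos (one_sub_norm_sq_pos hw) (le_quadForm hz hw hu) hs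

lemma integrable_mul_quadForm_rpow {lam : ℝ} (hlam : 0 < lam) {z w : ℂ} (hz : z ∈ disk)
    (hw : w ∈ disk) {s : ℝ} (hs : s ≤ 0) {g : ℝ → ℝ} (hg : Continuous g) :
    Integrable (fun u => g u * quadForm w u z ^ s) (betaMeasure lam lam) := by
  have := isProbabilityMeasureBeta hlam hlam
  obtain ⟨C, hC⟩ := isCompact_Icc.exists_bound_of_continuousOn (hg.continuousOn (s := Icc 0 1))
  refine Integrable.of_bound ?_ (C * ((1 - ‖w‖) ^ 2) ^ s) ?_
  · exact (hg.measurable.mul ((continuous_quadForm_param w z).measurable.pow_const _)).aestronglyMeasurable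
  · filter_upwards [ae_betaMeasure lam] with u hu
    have hu' := Ioo_subset_Icc_self hu
    rw [norm_mul, Real.norm_of_nonneg (Real.rpow_nonneg (quadForm_pos hz hw hu').le s)]
    exact mul_le_mul (hC u hu') (quadForm_rpow_le hz hw hu' hs)
      (Real.rpow_nonneg (quadForm_pos hz hw hu').le s) ((norm_nonneg _).trans (hC u hu'))

lemma integral_poly_mul_quadForm {lam : ℝ} (hlam : 0 < lam) {z w : ℂ} (hz : z ∈ disk)
    (hw : w ∈ disk) (c0 c1 c2 : ℝ) :
    ∫ u, (c0 + c1 * u + c2 * u ^ 2) * quadForm w u z ^ (-lam - 1) ∂betaMeasure lam lam =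
      c0 * quadMoment lam w 0 z + c1 * quadMoment lam w 1 z + c2 * quadMoment lam w 2 z := by
  have hi : ∀ k, Integrable (fun u : ℝ => u ^ k * quadForm w u z ^ (-lam - 1))
      (betaMeasure lam lam) := fun k =>
    integrable_mul_quadForm_rpow hlam hz hw (by linarith) (continuous_id.pow k)
  simp only [quadMoment, ← integral_const_mul]
  have h01 : Integrable (fun u : ℝ => c0 * (u ^ 0 * quadForm w u z ^ (-lam - 1)) +
      c1 * (u ^ 1 * quadForm w u z ^ (-lam - 1))) (betaMeasure lam lam) :=
    ((hi 0).const_mul _).add ((hi 1).const_mul _)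
  rw [← integral_add ((hi 0).const_mul _) ((hi 1).const_mul _),
    ← integral_add h01 ((hi 2).const_mul _)]
  congr 1
  ext u
  simp
  ring

lemma quadForm_rpow_neg {z w : ℂ} (hz : z ∈ disk) (hw : w ∈ disk) {u : ℝ}
    (hu : u ∈ Icc (0 : ℝ) 1) (lam : ℝ) :
    quadForm w u z ^ (-lam) = quadForm w u z * quadForm w u z ^ (-lam - 1) := by
  have h := (quadForm_pos hz hw hu)
  rw [Real.rpow_sub_one h.ne']
  field_simp

lemma szegoNum_eq {lam : ℝ} (hlam : 0 < lam) {z w : ℂ} (hz : z ∈ disk) (hw : w ∈ disk) :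
    szegoNum lam w z = 2 * (Complex.normSq (1 - z * w) * quadMoment lam w 0 z +
      (-(4 * z.im * w.im) - Complex.normSq (1 - z * w)) * quadMoment lam w 1 z +
      4 * z.im * w.im * quadMoment lam w 2 z) := by
  have := integral_poly_mul_quadForm hlam hz hw (2 * Complex.normSq (1 - z * w))
    (2 * (-(4 * z.im * w.im) - Complex.normSq (1 - z * w))) (2 * (4 * z.im * w.im))
  rw [mul_add, mul_add, ← mul_assoc, ← mul_assoc, ← mul_assoc 2 (4 * z.im * w.im), ← this, szegoNum]
  refine integral_congr_ae ?_
  filter_upwards [ae_betaMeasure lam] with u hu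
  rw [quadForm_rpow_neg hz hw (Ioo_subset_Icc_self hu)]
  generalize quadForm w u z ^ (-lam - 1) = X
  rw [quadForm]
  ring

/-- The numerator at the reflected point, by the symmetry `u ↦ 1 - u` of the beta distribution. -/
lemma szegoNum_conj {lam : ℝ} (hlam : 0 < lam) {z w : ℂ} (hz : z ∈ disk) (hw : w ∈ disk) :
    szegoNum lam w (conj z) = 2 * (Complex.normSq (1 - z * w) * quadMoment lam w 1 z -
      4 * z.im * w.im * quadMoment lam w 2 z) := by
  have := integral_poly_mul_quadForm hlam hz hw 0
    (2 * Complex.normSq (1 - z * w)) (-(2 * (4 * z.im * w.im)))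
  have h2 := integral_betaMeasure_one_sub hlam (fun u => 2 * (1 - u) * quadForm w (1 - u) z ^ (-lam))
  simp only [sub_sub_cancel] at h2
  rw [szegoNum]
  simp only [quadForm_conj]
  rw [← h2]
  trans 0 * quadMoment lam w 0 z + 2 * Complex.normSq (1 - z * w) * quadMoment lam w 1 z +
    -(2 * (4 * z.im * w.im)) * quadMoment lam w 2 z
  swap
  · ring
  rw [← this]
  refine integral_congr_ae ?_
  filter_upwards [ae_betaMeasure lam] with u hu
  rw [quadForm_rpow_neg hz hw (Ioo_subset_Icc_self hu)]
  generalize quadForm w u z ^ (-lam - 1) = X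
  rw [quadForm]
  ring

/-- Integration by parts of `quadForm w u z ^ (-lam)` in `u` against the beta distribution. -/
lemma quadMoment_relation {lam : ℝ} (hlam : 0 < lam) {z w : ℂ} (hz : z ∈ disk) (hw : w ∈ disk) :
    Complex.normSq (1 - z * w) * quadMoment lam w 0 z -
      2 * Complex.normSq (1 - z * w) * quadMoment lam w 1 z +
      4 * z.im * w.im * quadMoment lam w 2 z = 0 := by
  have h := integral_betaMeasure_by_parts hlam (f := fun u => quadForm w u z ^ (-lam))
    (f' := fun u => -(4 * z.im * w.im) * -lam * quadForm w u z ^ (-lam - 1)) ?_ ?_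
  · have h2 := integral_poly_mul_quadForm hlam hz hw (Complex.normSq (1 - z * w))
      (-(2 * Complex.normSq (1 - z * w))) (4 * z.im * w.im)
    have h3 : lam * ∫ u, (Complex.normSq (1 - z * w) + -(2 * Complex.normSq (1 - z * w)) * u +
        4 * z.im * w.im * u ^ 2) * quadForm w u z ^ (-lam - 1) ∂betaMeasure lam lam = 0 := by
      rw [← h, ← integral_const_mul]
      refine integral_congr_ae ?_
      filter_upwards [ae_betaMeasure lam] with u hu
      rw [quadForm_rpow_neg hz hw (Ioo_subset_Icc_self hu)]
      generalize quadForm w u z ^ (-lam - 1) = X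
      rw [quadForm]
      ring
    rw [h2] at h3
    have := (mul_eq_zero.1 h3).resolve_left hlam.ne'
    linarith
  · intro u hu
    have h1 : HasDerivAt (fun u => quadForm w u z) (-(4 * z.im * w.im)) u := by
      have := ((hasDerivAt_id u).mul_const (4 * z.im * w.im)).const_sub
        (Complex.normSq (1 - z * w))
      simpa [quadForm] using this
    exact h1.rpow_const (Or.inl (quadForm_pos hz hw hu).ne')
  · refine continuousOn_const.mul ?_
    exact (continuous_quadForm_param w z).continuousOn.rpow_const fun u hu =>
      Or.inl (quadForm_pos hz hw hu).ne'

end LambdaBergman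

namespace LambdaBergman

open Filter Topology Set ProbabilityTheory

/-- The derivative of the integrand of `szegoNum`. -/
noncomputable def szegoNumIntegrandDeriv (lam : ℝ) (w z : ℂ) (u : ℝ) : ℂ →L[ℝ] ℝ :=
  (-2 * lam * ((1 - u) * quadForm w u z ^ (-lam - 1))) • quadFormDeriv w u z

lemma continuous_quadFormDeriv_param (w z : ℂ) : Continuous fun u => quadFormDeriv w u z := by
  unfold quadFormDeriv; fun_prop

lemma aestronglyMeasurable_szegoNumIntegrandDeriv (lam : ℝ) (w z : ℂ) :
    AEStronglyMeasurable (szegoNumIntegrandDeriv lam w z) (betaMeasure lam lam) := by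
  have h1 : AEStronglyMeasurable (fun u => quadFormDeriv w u z) (betaMeasure lam lam) :=
    (continuous_quadFormDeriv_param w z).aestronglyMeasurable
  have h2 : AEStronglyMeasurable (fun u => -2 * lam * ((1 - u) * quadForm w u z ^ (-lam - 1)))
      (betaMeasure lam lam) :=
    (measurable_const.mul ((measurable_const.sub measurable_id).mul
      ((continuous_quadForm_param w z).measurable.pow_const _))).aestronglyMeasurable
  exact h2.smul h1

lemma norm_szegoNumIntegrandDeriv_le {lam : ℝ} (hlam : 0 < lam) {z w : ℂ} (hz : z ∈ disk)
    (hw : w ∈ disk) {u : ℝ} (hu : u ∈ Icc (0 : ℝ) 1) :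
    ‖szegoNumIntegrandDeriv lam w z u‖ ≤ 2 * lam * ((1 - ‖w‖) ^ 2) ^ (-lam - 1) * 12 := by
  have h0 := Real.rpow_nonneg (quadForm_pos hz hw hu).le (-lam - 1)
  rw [szegoNumIntegrandDeriv, norm_smul]
  refine mul_le_mul ?_ (norm_quadFormDeriv_le hz hw hu) (norm_nonneg _)
    (mul_nonneg (by linarith) (Real.rpow_nonneg (one_sub_norm_sq_pos hw).le _))
  rw [norm_mul, norm_mul, norm_mul, Real.norm_of_nonneg h0, Real.norm_of_nonneg hlam.le,
    Real.norm_of_nonneg (sub_nonneg.2 hu.2)]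
  have h1 := quadForm_rpow_le hz hw hu (s := -lam - 1) (by linarith)
  have h2 : (1 - u) * quadForm w u z ^ (-lam - 1) ≤ 1 * ((1 - ‖w‖) ^ 2) ^ (-lam - 1) :=
    mul_le_mul (by linarith [hu.1]) h1 h0 zero_le_one
  rw [one_mul] at h2
  norm_num
  gcongr

lemma hasFDerivAt_szegoNum_integral {lam : ℝ} (hlam : 0 < lam) {z w : ℂ} (hz : z ∈ disk)
    (hw : w ∈ disk) : HasFDerivAt (szegoNum lam w)
      (∫ u, szegoNumIntegrandDeriv lam w z u ∂betaMeasure lam lam) z := by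
  have := isProbabilityMeasureBeta hlam hlam
  refine hasFDerivAt_integral_of_dominated_of_fderiv_le (𝕜 := ℝ)
    (F := fun z u => 2 * (1 - u) * quadForm w u z ^ (-lam)) (s := disk)
    (bound := fun _ => 2 * lam * ((1 - ‖w‖) ^ 2) ^ (-lam - 1) * 12)
    (isOpen_disk.mem_nhds hz) ?_ ?_ (aestronglyMeasurable_szegoNumIntegrandDeriv lam w z) ?_
    (integrable_const _) ?_
  · filter_upwards [isOpen_disk.mem_nhds hz] with x hx
    exact (integrable_mul_quadForm_rpow hlam hx hw (by linarith)
      (by fun_prop : Continuous fun u : ℝ => 2 * (1 - u))).aestronglyMeasurable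
  · exact integrable_mul_quadForm_rpow hlam hz hw (by linarith)
      (by fun_prop : Continuous fun u : ℝ => 2 * (1 - u))
  · filter_upwards [ae_betaMeasure lam] with u hu x hx
    exact norm_szegoNumIntegrandDeriv_le hlam hx hw (Ioo_subset_Icc_self hu)
  · filter_upwards [ae_betaMeasure lam] with u hu x hx
    have h := ((hasFDerivAt_quadForm w u x).rpow_const (p := -lam)
      (Or.inl (quadForm_pos hx hw (Ioo_subset_Icc_self hu)).ne')).const_mul (2 * (1 - u))
    refine h.congr_fderiv ?_
    rw [szegoNumIntegrandDeriv, smul_smul]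
    congr 1
    ring

lemma continuousAt_integral_szegoNumIntegrandDeriv {lam : ℝ} (hlam : 0 < lam) {z w : ℂ}
    (hz : z ∈ disk) (hw : w ∈ disk) :
    ContinuousAt (fun z => ∫ u, szegoNumIntegrandDeriv lam w z u ∂betaMeasure lam lam) z := by
  have := isProbabilityMeasureBeta hlam hlam
  refine continuousAt_of_dominated
    (bound := fun _ => 2 * lam * ((1 - ‖w‖) ^ 2) ^ (-lam - 1) * 12)
    (Eventually.of_forall fun x => aestronglyMeasurable_szegoNumIntegrandDeriv lam w x) ?_
    (integrable_const _) ?_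
  · filter_upwards [isOpen_disk.mem_nhds hz] with x hx
    filter_upwards [ae_betaMeasure lam] with u hu
    exact norm_szegoNumIntegrandDeriv_le hlam hx hw (Ioo_subset_Icc_self hu)
  · filter_upwards [ae_betaMeasure lam] with u hu
    have h1 : ContinuousAt (fun x => quadForm w u x ^ (-lam - 1)) z :=
      (hasFDerivAt_quadForm w u z).continuousAt.rpow_const
        (Or.inl (quadForm_pos hz hw (Ioo_subset_Icc_self hu)).ne')
    have h2 : Continuous fun x => quadFormDeriv w u x := by
      unfold quadFormDeriv; fun_prop
    exact (continuousAt_const.mul (continuousAt_const.mul h1)).smul h2.continuousAt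

/-- The derivative of `szegoNum` in terms of moments. -/
noncomputable def szegoNumDeriv (lam : ℝ) (w z : ℂ) : ℂ →L[ℝ] ℝ :=
  (-2 * lam) • ((quadMoment lam w 0 z - quadMoment lam w 1 z) • quadFormDeriv w 0 z -
    (4 * w.im * (quadMoment lam w 1 z - quadMoment lam w 2 z)) • Complex.imCLM)

lemma integral_szegoNumIntegrandDeriv {lam : ℝ} (hlam : 0 < lam) {z w : ℂ} (hz : z ∈ disk)
    (hw : w ∈ disk) :
    ∫ u, szegoNumIntegrandDeriv lam w z u ∂betaMeasure lam lam = szegoNumDeriv lam w z := by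
  have := isProbabilityMeasureBeta hlam hlam
  ext h
  have hint : Integrable (szegoNumIntegrandDeriv lam w z) (betaMeasure lam lam) := by
    refine Integrable.of_bound (aestronglyMeasurable_szegoNumIntegrandDeriv lam w z)
      (2 * lam * ((1 - ‖w‖) ^ 2) ^ (-lam - 1) * 12) ?_
    filter_upwards [ae_betaMeasure lam] with u hu
    exact norm_szegoNumIntegrandDeriv_le hlam hz hw (Ioo_subset_Icc_self hu)
  rw [ContinuousLinearMap.integral_apply hint]
  have := integral_poly_mul_quadForm hlam hz hw (-2 * lam * quadFormDeriv w 0 z h)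
    (2 * lam * quadFormDeriv w 0 z h + 8 * lam * w.im * h.im) (-8 * lam * w.im * h.im)
  trans -2 * lam * quadFormDeriv w 0 z h * quadMoment lam w 0 z +
      (2 * lam * quadFormDeriv w 0 z h + 8 * lam * w.im * h.im) * quadMoment lam w 1 z +
      -8 * lam * w.im * h.im * quadMoment lam w 2 z
  · rw [← this]
    congr 1
    ext u
    simp only [szegoNumIntegrandDeriv, quadFormDeriv, FunLike.coe_add, FunLike.coe_smul,
      Pi.add_apply, Pi.smul_apply, smul_eq_mul, Complex.reCLM_apply, Complex.imCLM_apply]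
    ring
  · simp only [szegoNumDeriv, FunLike.coe_sub, FunLike.coe_smul,
      Pi.sub_apply, Pi.smul_apply, smul_eq_mul, Complex.imCLM_apply]
    ring

lemma hasFDerivAt_szegoNum {lam : ℝ} (hlam : 0 < lam) {z w : ℂ} (hz : z ∈ disk)
    (hw : w ∈ disk) : HasFDerivAt (szegoNum lam w) (szegoNumDeriv lam w z) z :=
  integral_szegoNumIntegrandDeriv hlam hz hw ▸ hasFDerivAt_szegoNum_integral hlam hz hw

lemma contDiffOn_szegoNum {lam : ℝ} (hlam : 0 < lam) {w : ℂ} (hw : w ∈ disk) :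
    ContDiffOn ℝ 1 (szegoNum lam w) disk := by
  have h : ContDiffOn ℝ (0 + 1) (szegoNum lam w) disk := by
    rw [contDiffOn_succ_iff_fderiv_of_isOpen isOpen_disk]
    refine ⟨fun z hz => (hasFDerivAt_szegoNum hlam hz hw).differentiableAt.differentiableWithinAt,
      by simp, ?_⟩
    rw [contDiffOn_zero]
    have hc : ContinuousOn (fun z => ∫ u, szegoNumIntegrandDeriv lam w z u ∂betaMeasure lam lam)
        disk := fun z hz =>
      (continuousAt_integral_szegoNumIntegrandDeriv hlam hz hw).continuousWithinAt
    exact hc.congr fun z hz => (hasFDerivAt_szegoNum_integral hlam hz hw).fderiv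
  simpa using h

lemma szegoNum_nonneg {lam : ℝ} {z w : ℂ} (hz : z ∈ disk) (hw : w ∈ disk) :
    0 ≤ szegoNum lam w z := by
  refine integral_nonneg_of_ae ?_
  filter_upwards [ae_betaMeasure lam] with u hu
  exact mul_nonneg (by linarith [hu.2])
    (Real.rpow_nonneg (quadForm_pos hz hw (Ioo_subset_Icc_self hu)).le _)

lemma quadMoment_one_le {lam : ℝ} (hlam : 0 < lam) {z w : ℂ} (hz : z ∈ disk) (hw : w ∈ disk) :
    0 ≤ quadMoment lam w 0 z - quadMoment lam w 1 z := by
  have := integral_poly_mul_quadForm hlam hz hw 1 (-1) 0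
  have h2 : 0 ≤ ∫ u, (1 + -1 * u + 0 * u ^ 2) * quadForm w u z ^ (-lam - 1)
      ∂betaMeasure lam lam := by
    refine integral_nonneg_of_ae ?_
    filter_upwards [ae_betaMeasure lam] with u hu
    exact mul_nonneg (by linarith [hu.2])
      (Real.rpow_nonneg (quadForm_pos hz hw (Ioo_subset_Icc_self hu)).le _)
  linarith

/-- The radial derivative of the numerator, shifted by `lam`, is nonnegative, because the derivative
of the quadratic form along `z` is `quadForm w u z - (1 - |z|² |w|²)`. -/
lemma szegoNumDeriv_self_add_nonneg {lam : ℝ} (hlam : 0 < lam) {z w : ℂ} (hz : z ∈ disk)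
    (hw : w ∈ disk) : 0 ≤ szegoNumDeriv lam w z z + lam * szegoNum lam w z := by
  have e : szegoNumDeriv lam w z z + lam * szegoNum lam w z =
      2 * lam * (1 - Complex.normSq z * Complex.normSq w) *
        (quadMoment lam w 0 z - quadMoment lam w 1 z) := by
    rw [szegoNum_eq hlam hz hw]
    simp only [szegoNumDeriv, quadFormDeriv, FunLike.coe_add, FunLike.coe_sub, FunLike.coe_smul,
      Pi.add_apply, Pi.sub_apply, Pi.smul_apply, smul_eq_mul, Complex.reCLM_apply,
      Complex.imCLM_apply, Complex.normSq_apply, Complex.sub_re, Complex.sub_im, Complex.mul_re,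
      Complex.mul_im, Complex.one_re, Complex.one_im]
    ring
  rw [e]
  refine mul_nonneg (mul_nonneg (by linarith) (sub_nonneg.2 ?_)) (quadMoment_one_le hlam hz hw)
  rw [mem_disk] at hz hw
  rw [Complex.normSq_eq_norm_sq, Complex.normSq_eq_norm_sq, ← mul_pow]
  exact pow_le_one₀ (by positivity) (mul_le_one₀ hz.le (norm_nonneg w) hw.le)

lemma one_sub_mul_conj_ne_zero {z w : ℂ} (hz : z ∈ disk) (hw : w ∈ disk) :
    1 - z * conj w ≠ 0 := by
  intro h
  have := (one_sub_norm_sq_pos (conj_mem_disk.2 hw)).trans_le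
    (one_sub_norm_sq_le_normSq hz (conj_mem_disk.2 hw))
  rw [h, map_zero] at this
  exact lt_irrefl _ this

lemma hasFDerivAt_div_one_sub {q : ℂ → ℝ} {q' : ℂ →L[ℝ] ℝ} {z w : ℂ} (hz : z ∈ disk)
    (hw : w ∈ disk) (hq : HasFDerivAt q q' z) :
    ∃ L : ℂ →L[ℝ] ℂ, HasFDerivAt (fun z => (q z : ℂ) / (1 - z * conj w)) L z ∧
      ∀ h, L h = q' h / (1 - z * conj w) + q z * (h * conj w) / (1 - z * conj w) ^ 2 := by
  have h0 := one_sub_mul_conj_ne_zero hz hw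
  have h1 : HasFDerivAt (fun z => (q z : ℂ)) (Complex.ofRealCLM.comp q') z :=
    Complex.ofRealCLM.hasFDerivAt.comp z hq
  have h2 : HasFDerivAt (fun z : ℂ => 1 - z * conj w)
      (-(ContinuousLinearMap.mul ℝ ℂ (conj w))) z := by
    have := ((ContinuousLinearMap.mul ℝ ℂ (conj w)).hasFDerivAt (x := z)).const_sub 1
    refine this.congr_of_eventuallyEq (Eventually.of_forall fun x => ?_)
    simp [mul_comm]
  simp only [div_eq_mul_inv]
  refine ⟨_, h1.mul ((hasFDerivAt_inv' (𝕜 := ℝ) h0).comp z h2), fun h => ?_⟩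
  simp
  field_simp
  ring

/-- The closed form of the Szegő kernel satisfies the Dunkl equation off the real axis, by the
linear relation between the moments. -/
lemma isOffReal_szegoNum_div {lam : ℝ} (hlam : 0 < lam) {w : ℂ} (hw : w ∈ disk) :
    IsOffReal lam (fun z => (szegoNum lam w z : ℂ) / (1 - z * conj w)) := by
  refine ⟨?_, fun z hz _ => ?_⟩
  · simp only [div_eq_mul_inv]
    refine ContDiffOn.mul (Complex.ofRealCLM.contDiff.comp_contDiffOn (contDiffOn_szegoNum hlam hw))
      (ContDiffOn.inv ?_ fun z hz => one_sub_mul_conj_ne_zero hz hw)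
    exact (contDiff_const.sub (contDiff_id.mul contDiff_const)).contDiffOn
  · obtain ⟨L, hL, hL'⟩ := hasFDerivAt_div_one_sub hz hw (hasFDerivAt_szegoNum hlam hz hw)
    rw [dbar, hL.fderiv, hL', hL']
    have h0 := one_sub_mul_conj_ne_zero hz hw
    have h1 := one_sub_mul_conj_ne_zero (conj_mem_disk.2 hz) hw
    have hrel := quadMoment_relation hlam hz hw
    rw [szegoNum_conj hlam hz hw, szegoNum_eq hlam hz hw]
    simp only [szegoNumDeriv, quadFormDeriv, FunLike.coe_add, FunLike.coe_sub, FunLike.coe_smul,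
      Pi.add_apply, Pi.sub_apply, Pi.smul_apply, smul_eq_mul, Complex.reCLM_apply,
      Complex.imCLM_apply, Complex.one_re, Complex.one_im, Complex.I_re, Complex.I_im]
    generalize quadMoment lam w 0 z = M0 at *
    generalize quadMoment lam w 1 z = M1 at *
    generalize quadMoment lam w 2 z = M2 at *
    generalize hD1 : -2 * lam * _ = D1
    generalize hDI : -2 * lam * _ = DI
    generalize hQ : 2 * (_ + 4 * z.im * w.im * M2) = Q
    generalize hQc : 2 * (_ - 4 * z.im * w.im * M2) = Qc
    -- `D1`, `DI` are the partial derivatives of the numerator at `z`, and `Q`, `Qc` its values at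
    -- `z` and `z̄`; real and imaginary part of the identity are multiples of `hrel`
    have key : (z - conj z) * (D1 + Complex.I * DI) * (1 - conj z * conj w) =
        2 * lam * (Q * (1 - conj z * conj w) - Qc * (1 - z * conj w)) := by
      rw [← hD1, ← hDI, ← hQ, ← hQc]
      rw [Complex.normSq_apply] at hrel ⊢
      apply Complex.ext
      · simp [Complex.normSq_apply] at hrel ⊢
        linear_combination (-4 * lam * (1 - (z.re * w.re + z.im * w.im))) * hrel
      · simp [Complex.normSq_apply] at hrel ⊢
        linear_combination (-4 * lam * (z.re * w.im - z.im * w.re)) * hrel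
    field_simp
    linear_combination (1 - z * conj w) * key +
      Q * conj w * (z - conj z) * (1 - conj z * conj w) * Complex.I_sq

end LambdaBergman

namespace LambdaBergman

open Filter Topology Set

/-! ### The Szegő kernel on the real axis -/

lemma multichoose_eq_binA (a : ℝ) (n : ℕ) : Ring.multichoose a n = binA a n := by
  have h := Ring.factorial_nsmul_multichoose_eq_ascPochhammer a n
  rw [Polynomial.ascPochhammer_smeval_eq_eval, nsmul_eq_mul] at h
  rw [binA, poch, ← h]
  field_simp

lemma choose_eq_binA (a : ℝ) (n : ℕ) : Ring.choose ((a : ℂ) + n - 1) n = binA a n := by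
  rw [← Ring.multichoose_eq, ← multichoose_eq_binA]
  exact (Ring.map_multichoose Complex.ofRealHom a n).symm

/-- The binomial series of `(1 - q) ^ (-a)`. -/
lemma hasSum_binA (a : ℝ) {q : ℂ} (hq : ‖q‖ < 1) :
    HasSum (fun n => (binA a n : ℂ) * q ^ n) (1 / (1 - q) ^ (a : ℂ)) ∧
      Summable fun n => ‖(binA a n : ℂ) * q ^ n‖ := by
  have h := Complex.one_div_one_sub_cpow_hasFPowerSeriesOnBall_zero (a : ℂ)
  have hq' : q ∈ Metric.eball (0 : ℂ) 1 := by
    rw [Metric.mem_eball, edist_zero_right, ← ofReal_norm]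
    exact ENNReal.ofReal_lt_one.2 hq
  have e : ∀ n, (FormalMultilinearSeries.ofScalars ℂ
      fun n : ℕ ↦ Ring.choose ((a : ℂ) + n - 1) n) n (fun _ => q) = (binA a n : ℂ) * q ^ n := by
    intro n
    rw [FormalMultilinearSeries.ofScalars_apply_eq, choose_eq_binA, smul_eq_mul]
  constructor
  · have := h.hasSum hq'
    simpa only [e, zero_add] using this
  · have := FormalMultilinearSeries.summable_norm_apply _ (Metric.eball_subset_eball h.r_le hq')
    simpa only [e] using this

/-- The Szegő kernel, the reproducing kernel for the circle. -/
noncomputable def szego (lam : ℝ) (w z : ℂ) : ℂ := ∑' n, conj (phi lam n w) * phi lam n z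

lemma isCoefSeq_conj_phi {lam : ℝ} (hlam : 0 ≤ lam) {w : ℂ} (hw : w ∈ disk) :
    IsCoefSeq lam (fun n => conj (phi lam n w)) := by
  refine IsCoefSeq.of_norm_le (C := 1) (m := growthExp lam) fun n => ?_
  rw [RCLike.norm_conj, one_mul]
  refine (norm_phi_le hlam n w).trans (mul_le_of_le_one_right (by positivity) ?_)
  exact pow_le_one₀ (norm_nonneg w) (mem_disk.1 hw).le

/-- The terms of the Szegő kernel on the real axis are those of the Cauchy product of the binomial series
of `(1 - x w) ^ (-lam)` and `(1 - x w̄) ^ (-lam - 1)`. -/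
lemma conj_phi_mul_phi_ofReal {lam : ℝ} (hlam : 0 ≤ lam) (n : ℕ) (w : ℂ) (x : ℝ) :
    conj (phi lam n w) * phi lam n x = ∑ kl ∈ Finset.HasAntidiagonal.antidiagonal n,
      (binA lam kl.1 : ℂ) * (x * w) ^ kl.1 * ((binA (lam + 1) kl.2 : ℂ) * (x * conj w) ^ kl.2) := by
  have hb : binA (2 * lam + 1) n ≠ 0 := (binA_pos (by linarith) n).ne'
  have e := eps_sq hlam n
  have e' : (eps lam n : ℂ) * eps lam n * binA (2 * lam + 1) n = 1 := by
    norm_cast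
    rw [← sq, e, inv_mul_cancel₀ hb]
  rw [phi_ofReal, phi_eq, map_mul, basicPoly, conj_homPoly, Complex.conj_ofReal]
  trans (homPoly (fun j k => coefA lam k j) n w) * x ^ n
  · push_cast
    linear_combination (homPoly (fun j k => coefA lam k j) n w) * x ^ n * e'
  rw [homPoly, Finset.sum_mul, ← Finset.Nat.sum_antidiagonal_swap]
  refine Finset.sum_congr rfl fun kl hkl => ?_
  rw [← Finset.HasAntidiagonal.mem_antidiagonal.1 hkl, coefA]
  push_cast
  simp only [Prod.fst_swap, Prod.snd_swap]
  ring

lemma szego_ofReal {lam : ℝ} (hlam : 0 ≤ lam) {w : ℂ} (hw : w ∈ disk) {x : ℝ} (hx : |x| < 1) :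
    szego lam w x = (Complex.normSq (1 - x * w) ^ (-lam) : ℝ) / (1 - x * conj w) := by
  rw [mem_disk] at hw
  have hq : ‖(x : ℂ) * w‖ < 1 := by
    rw [norm_mul, Complex.norm_real, Real.norm_eq_abs]
    exact mul_lt_one_of_nonneg_of_lt_one_left (abs_nonneg x) hx hw.le
  have hq' : ‖(x : ℂ) * conj w‖ < 1 := by
    rwa [norm_mul, RCLike.norm_conj, ← norm_mul]
  obtain ⟨h1, h1'⟩ := hasSum_binA lam hq
  obtain ⟨h2, h2'⟩ := hasSum_binA (lam + 1) hq'
  have h := tsum_mul_tsum_eq_tsum_sum_antidiagonal_of_summable_norm h1' h2'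
  rw [h1.tsum_eq, h2.tsum_eq] at h
  simp only [szego, conj_phi_mul_phi_ofReal hlam]
  rw [← h]
  have hv : 0 < (1 - (x : ℂ) * w).re := by
    have := (Complex.re_le_norm ((x : ℂ) * w)).trans_lt hq
    simp only [Complex.sub_re, Complex.one_re]
    linarith
  have hv0 : 1 - (x : ℂ) * w ≠ 0 := fun h0 => by rw [h0] at hv; simp at hv
  have hc : 1 - (x : ℂ) * conj w = conj (1 - x * w) := by simp
  have harg : (1 - (x : ℂ) * w).arg ≠ Real.pi := fun h0 => by
    rw [Complex.arg_eq_pi_iff] at h0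
    linarith [h0.1]
  rw [hc]
  generalize 1 - (x : ℂ) * w = v at *
  have hvc : conj v ≠ 0 := by simpa using hv0
  rw [Complex.ofReal_add, Complex.ofReal_one, Complex.cpow_add _ _ hvc, Complex.cpow_one,
    Complex.conj_cpow _ _ harg, Complex.conj_ofReal]
  have e : v ^ (lam : ℂ) * conj (v ^ (lam : ℂ)) = ((Complex.normSq v ^ lam : ℝ) : ℂ) := by
    rw [Complex.mul_conj, Complex.normSq_eq_norm_sq, Complex.normSq_eq_norm_sq,
      Complex.norm_cpow_real, ← Real.rpow_natCast, ← Real.rpow_natCast,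
      ← Real.rpow_mul (norm_nonneg _), ← Real.rpow_mul (norm_nonneg _), mul_comm]
  rw [Real.rpow_neg (Complex.normSq_nonneg v), Complex.ofReal_inv, ← e]
  simp only [mul_inv, div_eq_mul_inv]
  ring

/-! ### Uniqueness from the values on the real axis -/

lemma eq_zero_of_hasSum_pow {b : ℕ → ℂ}
    (h : ∀ x : ℝ, |x| < 1 → HasSum (fun n => b n * (x : ℂ) ^ n) 0) : b = 0 := by
  let p : FormalMultilinearSeries ℝ ℝ ℂ := fun n => ContinuousMultilinearMap.mkPiRing ℝ (Fin n) (b n)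
  have hp : HasFPowerSeriesAt (0 : ℝ → ℂ) p 0 := by
    refine hasFPowerSeriesAt_iff.2 ?_
    filter_upwards [Metric.ball_mem_nhds (0 : ℝ) one_pos] with x hx
    rw [mem_ball_zero_iff, Real.norm_eq_abs] at hx
    have e : ∀ n, x ^ n • p.coeff n = b n * (x : ℂ) ^ n := fun n => by
      simp [p, FormalMultilinearSeries.coeff, mul_comm]
    have h2 := h x hx
    simp only [← e] at h2
    exact h2
  ext n
  have := congrFun hp.eq_zero n
  have h1 := congrArg (fun f => f (fun _ => (1 : ℝ))) this
  simpa [p] using h1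

/-- A solution of the Dunkl equation is determined by its values on the real diameter. -/
lemma IsOffReal.eq_zero_of_real {lam : ℝ} (hlam : 0 ≤ lam) {g : ℂ → ℂ} (hg : IsOffReal lam g)
    (h0 : ∀ x : ℝ, |x| < 1 → g x = 0) {z : ℂ} (hz : z ∈ disk) : g z = 0 := by
  obtain ⟨a, ha, hag⟩ := hg.expansion hlam
  have hb : (fun n => a n * (eps lam n * binA (2 * lam + 1) n : ℝ)) = 0 := by
    refine eq_zero_of_hasSum_pow fun x hx => ?_
    have hxd : (x : ℂ) ∈ disk := by rwa [mem_disk, Complex.norm_real]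
    have := (ha.summable_norm hlam hxd).of_norm.hasSum
    rw [← hag x hxd, h0 x hx] at this
    simpa only [phi_ofReal, mul_assoc] using this
  have ha0 : ∀ n, a n = 0 := fun n => by
    have h1 := congrFun hb n
    refine (mul_eq_zero.1 h1).resolve_right ?_
    exact_mod_cast (mul_pos (eps_pos hlam n) (binA_pos (by linarith) n)).ne'
  rw [hag z hz]
  simp [ha0]

lemma IsOffReal.eq_of_real {lam : ℝ} (hlam : 0 ≤ lam) {f g : ℂ → ℂ} (hf : IsOffReal lam f)
    (hg : IsOffReal lam g) (h0 : ∀ x : ℝ, |x| < 1 → f x = g x) {z : ℂ} (hz : z ∈ disk) :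
    f z = g z := by
  have := (hf.sub hg).eq_zero_of_real hlam (fun x hx => by simp [h0 x hx]) hz
  simpa [sub_eq_zero] using this

lemma isOffReal_szego {lam : ℝ} (hlam : 0 ≤ lam) {w : ℂ} (hw : w ∈ disk) :
    IsOffReal lam (szego lam w) :=
  ((isCoefSeq_conj_phi hlam hw).isLamAnalytic hlam).isOffReal

/-- Both sides solve the Dunkl equation and agree on the real axis, where `quadForm` does not depend on
`u`. -/
lemma szego_eq {lam : ℝ} (hlam : 0 < lam) {w : ℂ} (hw : w ∈ disk) {z : ℂ} (hz : z ∈ disk) :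
    szego lam w z = szegoNum lam w z / (1 - z * conj w) := by
  refine (isOffReal_szego hlam.le hw).eq_of_real hlam.le (isOffReal_szegoNum_div hlam hw)
    (fun x hx => ?_) hz
  rw [szego_ofReal hlam.le hw hx]
  congr 2
  have e : ∀ u, quadForm w u x = Complex.normSq (1 - x * w) := fun u => by simp [quadForm]
  simp only [szegoNum, e]
  rw [integral_mul_const, integral_betaMeasure_two_mul_one_sub hlam, one_mul]

/-- For `lam = 0` the basic polynomials are the powers of `z`. -/
lemma szego_zero {w : ℂ} (hw : w ∈ disk) {z : ℂ} (hz : z ∈ disk) :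
    szego 0 w z = (1 : ℝ) / (1 - z * conj w) := by
  have hoff : IsOffReal 0 (fun z => ((1 : ℝ) : ℂ) / (1 - z * conj w)) := by
    refine ⟨?_, fun z hz _ => ?_⟩
    · simp only [div_eq_mul_inv]
      refine contDiffOn_const.mul (ContDiffOn.inv ?_ fun z hz => one_sub_mul_conj_ne_zero hz hw)
      exact (contDiff_const.sub (contDiff_id.mul contDiff_const)).contDiffOn
    · obtain ⟨L, hL, hL'⟩ := hasFDerivAt_div_one_sub (q := fun _ => 1) hz hw
        (hasFDerivAt_const 1 z)
      rw [dbar, hL.fderiv, hL', hL']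
      have hI : ∀ X : ℂ, X * (1 * conj w) + Complex.I * (X * (Complex.I * conj w)) = 0 :=
        fun X => by linear_combination X * conj w * Complex.I_sq
      simp only [_root_.zero_apply, Complex.ofReal_zero, zero_div, zero_add, Complex.ofReal_one,
        one_mul, zero_mul, mul_eq_zero, div_eq_zero_iff]
      right; left
      have := hI (((1 - z * conj w) ^ 2)⁻¹)
      rw [div_eq_mul_inv, div_eq_mul_inv]
      linear_combination this
  refine (isOffReal_szego le_rfl hw).eq_of_real le_rfl hoff (fun x hx => ?_) hz
  rw [szego_ofReal le_rfl hw hx]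
  simp

/-- The Szegő kernel is `p z / (1 - z w̄)` with a nonnegative numerator `p` for which the radial
derivative of `|z| ^ lam * p` is nonnegative as well. -/
lemma exists_szego_numerator {lam : ℝ} (hlam : 0 ≤ lam) {w : ℂ} (hw : w ∈ disk) :
    ∃ p : ℂ → ℝ, ∀ z ∈ disk, DifferentiableAt ℝ p z ∧ 0 ≤ p z ∧
      0 ≤ fderiv ℝ p z z + lam * p z ∧ szego lam w z = p z / (1 - z * conj w) := by
  rcases hlam.eq_or_lt with rfl | h
  · exact ⟨fun _ => 1, fun z hz => ⟨differentiableAt_const _, zero_le_one, by simp,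
      szego_zero hw hz⟩⟩
  · refine ⟨szegoNum lam w, fun z hz => ⟨(hasFDerivAt_szegoNum h hz hw).differentiableAt,
      szegoNum_nonneg hz hw, ?_, szego_eq h hw hz⟩⟩
    rw [(hasFDerivAt_szegoNum h hz hw).fderiv]
    exact szegoNumDeriv_self_add_nonneg h hz hw

end LambdaBergman

namespace LambdaBergman

open Filter Topology Set

/-! ### The Bergman kernel -/

/-- The coefficients of `kernel lam · w` in the basic polynomials. -/
noncomputable def kernelCoef (lam : ℝ) (w : ℂ) (n : ℕ) : ℂ :=
  ((((n : ℝ) + lam + 1) / (lam + 1) : ℝ) : ℂ) * conj (phi lam n w)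

lemma kernelTerm_eq (lam : ℝ) (z w : ℂ) (n : ℕ) :
    kernelTerm lam z w n = kernelCoef lam w n * phi lam n z := by
  rw [kernelTerm, kernelCoef]; ring

lemma kernelWeight_nonneg {lam : ℝ} (hlam : 0 ≤ lam) (n : ℕ) : 0 ≤ ((n : ℝ) + lam + 1) / (lam + 1) := by
  positivity

lemma kernelWeight_le {lam : ℝ} (hlam : 0 ≤ lam) (n : ℕ) :
    ((n : ℝ) + lam + 1) / (lam + 1) ≤ n + 1 := by
  rw [div_le_iff₀ (by linarith)]
  nlinarith [mul_nonneg (Nat.cast_nonneg (α := ℝ) n) hlam]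

lemma norm_kernelCoef_le {lam : ℝ} (hlam : 0 ≤ lam) (w : ℂ) (n : ℕ) :
    ‖kernelCoef lam w n‖ ≤ ((n : ℝ) + 1) ^ (growthExp lam + 1) * ‖w‖ ^ n := by
  rw [kernelCoef, norm_mul, Complex.norm_real, RCLike.norm_conj,
    Real.norm_of_nonneg (kernelWeight_nonneg hlam n), pow_succ', mul_assoc]
  exact mul_le_mul (kernelWeight_le hlam n) (norm_phi_le hlam n w) (norm_nonneg _) (by positivity)

lemma isCoefSeq_kernelCoef {lam : ℝ} (hlam : 0 ≤ lam) {w : ℂ} (hw : w ∈ disk) :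
    IsCoefSeq lam (kernelCoef lam w) := by
  refine IsCoefSeq.of_norm_le (C := 1) (m := growthExp lam + 1) fun n => ?_
  rw [one_mul]
  refine (norm_kernelCoef_le hlam w n).trans (mul_le_of_le_one_right (by positivity) ?_)
  exact pow_le_one₀ (norm_nonneg w) (mem_disk.1 hw).le

lemma kernel_eq (lam : ℝ) (z w : ℂ) :
    kernel lam z w = ∑' n, kernelCoef lam w n * phi lam n z := by
  simp only [kernel, kernelTerm_eq]

lemma conj_kernel (lam : ℝ) (z w : ℂ) : conj (kernel lam z w) = kernel lam w z := by
  rw [kernel, kernel, Complex.conj_tsum]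
  congr 1
  ext n
  simp only [kernelTerm, map_mul, Complex.conj_ofReal, Complex.conj_conj]
  ring

lemma conj_szego (lam : ℝ) (z w : ℂ) : conj (szego lam w z) = szego lam z w := by
  rw [szego, szego, Complex.conj_tsum]
  congr 1
  ext n
  simp only [map_mul, Complex.conj_conj]
  ring

/-- The Bergman kernel is obtained from the Szegő kernel by a radial derivative. -/
lemma kernel_eq_fderiv_szego {lam : ℝ} (hlam : 0 ≤ lam) {z w : ℂ} (hz : z ∈ disk) (hw : w ∈ disk) :
    (lam + 1) * kernel lam z w = fderiv ℝ (szego lam w) z z + (lam + 1) * szego lam w z := by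
  have ha := isCoefSeq_conj_phi hlam hw
  have h1 := (ha.summable_fderiv hlam hz).hasSum
  have h2 : HasSum (fun n => fderiv ℝ (fun z => conj (phi lam n w) * phi lam n z) z z)
      ((∑' n, fderiv ℝ (fun z => conj (phi lam n w) * phi lam n z) z) z) :=
    (ContinuousLinearMap.apply ℝ ℂ z).hasSum h1
  have h3 := (ha.summable_norm hlam hz).of_norm.hasSum
  have h4 := ((isCoefSeq_kernelCoef hlam hw).summable_norm hlam hz).of_norm.hasSum.mul_left
    ((lam : ℂ) + 1)
  rw [← kernel_eq] at h4
  have hf : fderiv ℝ (szego lam w) z = ∑' n, fderiv ℝ (fun z => conj (phi lam n w) * phi lam n z) z :=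
    (ha.hasFDerivAt hlam hz).fderiv
  rw [hf]
  have h5 := h2.add (h3.mul_left ((lam : ℂ) + 1))
  have hl : (lam : ℂ) + 1 ≠ 0 := by
    have : lam + 1 ≠ 0 := by linarith
    exact_mod_cast this
  have e : ∀ n, (lam + 1) * (kernelCoef lam w n * phi lam n z) =
      fderiv ℝ (fun z => conj (phi lam n w) * phi lam n z) z z +
        (lam + 1) * (conj (phi lam n w) * phi lam n z) := fun n => by
    rw [fderiv_const_mul (differentiable_phi hlam n z)]
    simp only [FunLike.coe_smul, Pi.smul_apply, smul_eq_mul, fderiv_phi_self hlam, kernelCoef]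
    push_cast
    field_simp
    ring
  simp only [e] at h4
  exact h4.unique h5

/-- The Szegő and Bergman kernels in terms of two nonnegative numbers `p` and `s`: the numerator of the
former and the radial derivative that occurs in `exists_szego_numerator`. -/
lemma exists_kernel_eq {lam : ℝ} (hlam : 0 ≤ lam) {z w : ℂ} (hz : z ∈ disk) (hw : w ∈ disk) :
    ∃ p s : ℝ, 0 ≤ p ∧ 0 ≤ s ∧ szego lam w z = p / (1 - z * conj w) ∧
      (lam + 1) * kernel lam z w = s / (1 - z * conj w) + p / (1 - z * conj w) ^ 2 := by
  obtain ⟨p, hp⟩ := exists_szego_numerator hlam hw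
  obtain ⟨hd, h0, hs, he⟩ := hp z hz
  refine ⟨p z, fderiv ℝ p z z + lam * p z, h0, hs, he, ?_⟩
  obtain ⟨L, hL, hL'⟩ := hasFDerivAt_div_one_sub hz hw hd.hasFDerivAt
  have hev : szego lam w =ᶠ[𝓝 z] fun z => (p z : ℂ) / (1 - z * conj w) := by
    filter_upwards [isOpen_disk.mem_nhds hz] with x hx using (hp x hx).2.2.2
  rw [kernel_eq_fderiv_szego hlam hz hw, hev.fderiv_eq, hL.fderiv, hL', he]
  have := one_sub_mul_conj_ne_zero hz hw
  push_cast
  field_simp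
  ring

/-! ### Integrals of the kernel over circles -/

/-- `1 - z w̄` is at distance at least `1 - |z| r` from the origin for `|w| = r`. -/
lemma one_sub_le_norm (z w : ℂ) : 1 - ‖z‖ * ‖w‖ ≤ ‖1 - z * conj w‖ := by
  have := norm_sub_norm_le (1 : ℂ) (z * conj w)
  rwa [norm_one, norm_mul, RCLike.norm_conj] at this

/-- A pointwise bound for the kernel by two nonnegative functions of `w`. Both are real parts of
combinations of `kernel lam w z`, `szego lam z w`, their products with `w`, and the conjugate of
`szego lam z w`, whose integrals over circles `|w| = r` are known. The second one is a Poisson kernel,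
up to a factor. -/
lemma norm_kernel_le {lam : ℝ} (hlam : 0 ≤ lam) {z w : ℂ} (hz : z ∈ disk) (hw : w ∈ disk) :
    (lam + 1) * ‖kernel lam z w‖ ≤
      (((lam + 1) * (1 - conj z * w) * kernel lam w z - szego lam z w).re) / (1 - ‖z‖ * ‖w‖) +
      ((szego lam w z + conj z * w * szego lam z w).re) / (1 - (‖z‖ * ‖w‖) ^ 2) := by
  obtain ⟨p, s, hp, hs, h1, h2⟩ := exists_kernel_eq hlam hz hw
  have hv := one_sub_mul_conj_ne_zero hz hw
  have hρ : ‖z‖ * ‖w‖ < 1 := by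
    rw [mem_disk] at hz hw
    exact mul_lt_one_of_nonneg_of_lt_one_left (norm_nonneg z) hz hw.le
  have hρ0 : 0 ≤ ‖z‖ * ‖w‖ := by positivity
  have hle := one_sub_le_norm z w
  have hvpos : 0 < ‖1 - z * conj w‖ := norm_pos_iff.2 hv
  have h1' : szego lam z w = p / (1 - conj z * w) := by
    rw [← conj_szego, h1]; simp
  have h2' : (lam + 1) * kernel lam w z = s / (1 - conj z * w) + p / (1 - conj z * w) ^ 2 := by
    have := congrArg conj h2
    simpa [conj_kernel] using this
  have hv' : 1 - conj z * w ≠ 0 := by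
    rw [show 1 - conj z * w = conj (1 - z * conj w) by simp]
    exact (map_ne_zero _).2 hv
  have es : (lam + 1) * (1 - conj z * w) * kernel lam w z - szego lam z w = s := by
    have : (lam + 1) * (1 - conj z * w) * kernel lam w z =
      (1 - conj z * w) * ((lam + 1) * kernel lam w z) := by ring
    rw [this, h2', h1']
    field_simp
    ring
  have hvn : (1 - z * conj w) * (1 - conj z * w) = ((‖1 - z * conj w‖ ^ 2 : ℝ) : ℂ) := by
    push_cast
    rw [← Complex.mul_conj']
    simp
  have hzw : z * conj z * (w * conj w) = (((‖z‖ * ‖w‖) ^ 2 : ℝ) : ℂ) := by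
    rw [Complex.mul_conj', Complex.mul_conj']; push_cast; ring
  have ep : szego lam w z + conj z * w * szego lam z w =
      ((p * (1 - (‖z‖ * ‖w‖) ^ 2) / ‖1 - z * conj w‖ ^ 2 : ℝ) : ℂ) := by
    rw [Complex.ofReal_div, ← hvn, Complex.ofReal_mul, Complex.ofReal_sub, ← hzw, h1, h1']
    field_simp
    push_cast
    ring
  rw [es, ep, Complex.ofReal_re, Complex.ofReal_re]
  have hn : (lam + 1) * ‖kernel lam z w‖ = ‖(lam + 1) * kernel lam z w‖ := by
    rw [norm_mul]
    congr 1
    have : ((lam : ℂ) + 1) = ((lam + 1 : ℝ) : ℂ) := by push_cast; ring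
    rw [this, Complex.norm_real, Real.norm_of_nonneg (by linarith)]
  rw [hn, h2]
  refine (norm_add_le _ _).trans (add_le_add ?_ (le_of_eq ?_))
  · rw [norm_div, Complex.norm_real, Real.norm_of_nonneg hs]
    exact div_le_div_of_nonneg_left hs (by linarith) hle
  · have : 1 - (‖z‖ * ‖w‖) ^ 2 ≠ 0 := by nlinarith
    rw [norm_div, norm_pow, Complex.norm_real, Real.norm_of_nonneg hp, div_right_comm,
      mul_div_cancel_right₀ _ this]

lemma integral_phi_cis {lam : ℝ} (hlam : 0 ≤ lam) (n : ℕ) :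
    ∫ θ, phi lam n (cis θ) ∂circ lam = if n = 0 then (circMass lam : ℂ) else 0 := by
  have := integral_phi_mul_conj_phi hlam n 0
  simpa [phi_zero] using this

/-- The mean value property. -/
lemma IsCoefSeq.integral_circle {lam : ℝ} (hlam : 0 ≤ lam) {a : ℕ → ℂ} (ha : IsCoefSeq lam a)
    {r : ℝ} (h0 : 0 ≤ r) (h1 : r < 1) :
    ∫ θ, (∑' n, a n * phi lam n (r * cis θ)) ∂circ lam = a 0 * circMass lam := by
  have h := ha.hasSum_circPair hlam (η := fun _ => 1) continuous_const h0 h1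
  simp only [mul_one, integral_phi_cis hlam, circPair] at h
  refine h.unique ?_
  have := hasSum_ite_eq 0 (a 0 * circMass lam)
  convert this using 2 with n
  split_ifs with hn <;> simp [hn]

/-- The first negative moment: `e^{iθ}` is orthogonal to all basic polynomials. -/
lemma IsCoefSeq.integral_circle_mul_cis {lam : ℝ} (hlam : 0 ≤ lam) {a : ℕ → ℂ}
    (ha : IsCoefSeq lam a) {r : ℝ} (h0 : 0 ≤ r) (h1 : r < 1) :
    ∫ θ, (∑' n, a n * phi lam n (r * cis θ)) * cis θ ∂circ lam = 0 := by
  have h := ha.hasSum_circPair hlam continuous_cis h0 h1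
  have e : ∀ n, ∫ θ, phi lam n (cis θ) * cis θ ∂circ lam = 0 := fun n => by
    have := integral_phi_mul_cis_mul_phi hlam n 0
    simpa [phi_zero] using this
  simp only [e, mul_zero, circPair] at h
  exact h.unique hasSum_zero

lemma continuous_szego_circle {lam : ℝ} (hlam : 0 ≤ lam) {z : ℂ} (hz : z ∈ disk) {r : ℝ}
    (h0 : 0 ≤ r) (h1 : r < 1) : Continuous fun θ : ℝ => szego lam z (r * cis θ) :=
  (isOffReal_szego hlam hz).continuous_circle h0 h1

lemma continuous_kernel_circle {lam : ℝ} (hlam : 0 ≤ lam) {z : ℂ} (hz : z ∈ disk) {r : ℝ}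
    (h0 : 0 ≤ r) (h1 : r < 1) : Continuous fun θ : ℝ => kernel lam (r * cis θ) z := by
  have := ((isCoefSeq_kernelCoef hlam hz).isLamAnalytic hlam).isOffReal.continuous_circle h0 h1
  simpa only [kernel_eq] using this

/-- The circle bound for the Bergman kernel. The two functions in `norm_kernel_le` have the integrals
`lam * circMass lam` and `circMass lam`. -/
lemma integral_norm_kernel_circle_le {lam : ℝ} (hlam : 0 ≤ lam) {z : ℂ} (hz : z ∈ disk) {r : ℝ}
    (h0 : 0 ≤ r) (h1 : r < 1) :
    ∫ θ, ‖kernel lam (r * cis θ) z‖ ∂circ lam ≤ circMass lam / (1 - ‖z‖ * r) := by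
  have hS := isCoefSeq_conj_phi hlam hz
  have hK := isCoefSeq_kernelCoef hlam hz
  have hSc := continuous_szego_circle hlam hz h0 h1
  have hKc := continuous_kernel_circle hlam hz h0 h1
  have hcc : Continuous fun θ => (r : ℂ) * cis θ := continuous_const.mul continuous_cis
  have iS := hS.integral_circle hlam h0 h1
  have iS' := hS.integral_circle_mul_cis hlam h0 h1
  have iK := hK.integral_circle hlam h0 h1
  have iK' := hK.integral_circle_mul_cis hlam h0 h1
  simp only [← kernel_eq] at iK iK'
  have eS : ∀ w, ∑' n, conj (phi lam n z) * phi lam n w = szego lam z w := fun w => rfl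
  simp only [eS] at iS iS'
  have hl : (lam : ℂ) + 1 ≠ 0 := by
    have : lam + 1 ≠ 0 := by linarith
    exact_mod_cast this
  have eK0 : kernelCoef lam z 0 = 1 := by
    simp [kernelCoef, phi_zero, hl]
  rw [eK0, one_mul] at iK
  simp only [phi_zero, map_one, one_mul] at iS
  set ρ := ‖z‖ * r with hρdef
  have hρ0 : 0 ≤ ρ := by positivity
  have hρ : ρ < 1 := mul_lt_one_of_nonneg_of_lt_one_left (norm_nonneg z) (mem_disk.1 hz) h1.le
  have int : ∀ {F : ℝ → ℂ}, Continuous F → Integrable F (circ lam) :=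
    fun hF => Continuous.integrable_circ hlam hF
  have c1 : Continuous fun θ => ((lam : ℂ) + 1) * (1 - conj z * (r * cis θ)) *
      kernel lam (r * cis θ) z - szego lam z (r * cis θ) :=
    ((continuous_const.mul (continuous_const.sub (continuous_const.mul hcc))).mul hKc).sub hSc
  have c2 : Continuous fun θ => conj (szego lam z (r * cis θ)) +
      conj z * (r * cis θ) * szego lam z (r * cis θ) :=
    (Complex.continuous_conj.comp hSc).add ((continuous_const.mul hcc).mul hSc)
  have i1 : ∫ θ, (((lam : ℂ) + 1) * (1 - conj z * (r * cis θ)) *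
      kernel lam (r * cis θ) z - szego lam z (r * cis θ)) ∂circ lam = lam * circMass lam := by
    have e : ∀ θ, ((lam : ℂ) + 1) * (1 - conj z * (r * cis θ)) *
      kernel lam (r * cis θ) z - szego lam z (r * cis θ) =
      ((lam : ℂ) + 1) * kernel lam (r * cis θ) z - ((lam : ℂ) + 1) * conj z * r *
        (kernel lam (r * cis θ) z * cis θ) - szego lam z (r * cis θ) := fun θ => by ring
    simp only [e]
    have g1 : Continuous fun θ => ((lam : ℂ) + 1) * kernel lam (r * cis θ) z :=
      continuous_const.mul hKc
    have g2 : Continuous fun θ => ((lam : ℂ) + 1) * conj z * r *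
        (kernel lam (r * cis θ) z * cis θ) := continuous_const.mul (hKc.mul continuous_cis)
    have g12 : Continuous fun θ => ((lam : ℂ) + 1) * kernel lam (r * cis θ) z -
        ((lam : ℂ) + 1) * conj z * r * (kernel lam (r * cis θ) z * cis θ) := g1.sub g2
    rw [integral_sub (int g12) (int hSc), integral_sub (int g1) (int g2),
      integral_const_mul, integral_const_mul, iK, iK', iS]
    ring
  have i2 : ∫ θ, (conj (szego lam z (r * cis θ)) +
      conj z * (r * cis θ) * szego lam z (r * cis θ)) ∂circ lam = circMass lam := by
    have e : ∀ θ, conj z * (r * cis θ) * szego lam z (r * cis θ) =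
      conj z * r * (szego lam z (r * cis θ) * cis θ) := fun θ => by ring
    simp only [e]
    have g1 : Continuous fun θ => conj (szego lam z (r * cis θ)) :=
      Complex.continuous_conj.comp hSc
    have g2 : Continuous fun θ => conj z * r * (szego lam z (r * cis θ) * cis θ) :=
      continuous_const.mul (hSc.mul continuous_cis)
    rw [integral_add (int g1) (int g2), integral_conj, integral_const_mul,
      iS, iS']
    simp
  have hpt : ∀ θ, (lam + 1) * ‖kernel lam (r * cis θ) z‖ ≤
      (((lam : ℂ) + 1) * (1 - conj z * (r * cis θ)) *
        kernel lam (r * cis θ) z - szego lam z (r * cis θ)).re / (1 - ρ) +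
      (conj (szego lam z (r * cis θ)) +
        conj z * (r * cis θ) * szego lam z (r * cis θ)).re / (1 - ρ ^ 2) := fun θ => by
    have := norm_kernel_le hlam hz (real_mul_cis_mem_disk h0 h1 θ)
    rw [norm_real_mul_cis h0] at this
    rw [conj_szego]
    rwa [← conj_kernel, RCLike.norm_conj] at this
  have hint := integral_mono (μ := circ lam)
    ((Continuous.integrable_circ hlam hKc).norm.const_mul _)
    (((int c1).re.div_const (1 - ρ)).add ((int c2).re.div_const (1 - ρ ^ 2))) hpt
  rw [integral_const_mul, integral_add' ((int c1).re.div_const (1 - ρ)) ((int c2).re.div_const (1 - ρ ^ 2)),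
    integral_div, integral_div, integral_re (int c1), integral_re (int c2), i1, i2] at hint
  have hκ := circMass_pos hlam
  simp only [RCLike.re_to_complex, Complex.re_ofReal_mul, Complex.ofReal_re] at hint
  have hle : circMass lam / (1 - ρ ^ 2) ≤ circMass lam / (1 - ρ) :=
    div_le_div_of_nonneg_left hκ.le (by linarith) (by nlinarith)
  have : (lam + 1) * ∫ θ, ‖kernel lam (r * cis θ) z‖ ∂circ lam ≤
      (lam + 1) * (circMass lam / (1 - ρ)) := by
    refine hint.trans ?_
    rw [mul_div_assoc]
    linarith
  exact le_of_mul_le_mul_left this (by linarith)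

end LambdaBergman

namespace LambdaBergman

open Filter Topology Set

/-! ### The Schur test -/

/-- The Schur test with one weight `h`. -/
lemma lintegral_rpow_le_of_schur {α : Type*} [MeasurableSpace α] {μ : Measure α} [SFinite μ]
    {p q : ℝ} (hpq : p.HolderConjugate q) {K : α → α → ℝ≥0∞}
    (hK : AEMeasurable (Function.uncurry K) (μ.prod μ)) (hK' : ∀ᵐ z ∂μ, AEMeasurable (K z) μ)
    (hK'' : ∀ᵐ w ∂μ, AEMeasurable (K · w) μ)
    {h : α → ℝ≥0∞} (hh : Measurable h) (hh0 : ∀ᵐ z ∂μ, h z ≠ 0 ∧ h z ≠ ⊤) {C : ℝ≥0∞}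
    (h1 : ∀ᵐ z ∂μ, ∫⁻ w, K z w * h w ^ q ∂μ ≤ C * h z ^ q)
    (h2 : ∀ᵐ w ∂μ, ∫⁻ z, K z w * h z ^ p ∂μ ≤ C * h w ^ p)
    {f : α → ℝ≥0∞} (hf : AEMeasurable f μ) :
    ∫⁻ z, (∫⁻ w, K z w * f w ∂μ) ^ p ∂μ ≤ C ^ (p / q) * C * ∫⁻ w, f w ^ p ∂μ := by
  have hp := hpq.pos
  have hq := hpq.symm.pos
  set g : α → ℝ≥0∞ := fun w => ((h w)⁻¹ * f w) ^ p with hg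
  have hgm : AEMeasurable g μ := (hh.inv.aemeasurable.mul hf).pow_const _
  -- Hölder's inequality for the splitting `K f = (K ^ (1 / p) h⁻¹ f) (K ^ (1 / q) h)`
  have key : ∀ᵐ z ∂μ, (∫⁻ w, K z w * f w ∂μ) ^ p ≤
      C ^ (p / q) * (h z ^ p * ∫⁻ w, K z w * g w ∂μ) := by
    filter_upwards [hK', h1] with z hz hz1
    have hH := ENNReal.lintegral_mul_le_Lp_mul_Lq μ hpq
      (f := fun w => K z w ^ (1 / p) * ((h w)⁻¹ * f w)) (g := fun w => K z w ^ (1 / q) * h w)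
      ((hz.pow_const _).mul (hh.inv.aemeasurable.mul hf)) ((hz.pow_const _).mul hh.aemeasurable)
    have e1 : ∫⁻ w, K z w * f w ∂μ = ∫⁻ w, ((fun w => K z w ^ (1 / p) * ((h w)⁻¹ * f w)) *
        (fun w => K z w ^ (1 / q) * h w)) w ∂μ := by
      refine lintegral_congr_ae ?_
      filter_upwards [hh0] with w hw
      have e : K z w = K z w ^ (1 / p) * K z w ^ (1 / q) := by
        rw [← ENNReal.rpow_add_of_nonneg _ _ (by positivity) (by positivity), one_div, one_div,
          hpq.inv_add_inv_eq_one, ENNReal.rpow_one]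
      simp only [Pi.mul_apply]
      conv_lhs => rw [e]
      calc _ = K z w ^ (1 / p) * K z w ^ (1 / q) * f w * 1 := by rw [mul_one]
        _ = K z w ^ (1 / p) * K z w ^ (1 / q) * f w * ((h w)⁻¹ * h w) := by
          rw [ENNReal.inv_mul_cancel hw.1 hw.2]
        _ = _ := by ring
    rw [e1]
    refine (ENNReal.rpow_le_rpow hH hp.le).trans ?_
    rw [ENNReal.mul_rpow_of_nonneg _ _ hp.le, ← ENNReal.rpow_mul, ← ENNReal.rpow_mul,
      one_div_mul_cancel hp.ne', ENNReal.rpow_one]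
    have e2 : ∀ w, (K z w ^ (1 / p) * ((h w)⁻¹ * f w)) ^ p = K z w * g w := fun w => by
      rw [ENNReal.mul_rpow_of_nonneg _ _ hp.le, ← ENNReal.rpow_mul, one_div_mul_cancel hp.ne',
        ENNReal.rpow_one]
    have e3 : ∀ w, (K z w ^ (1 / q) * h w) ^ q = K z w * h w ^ q := fun w => by
      rw [ENNReal.mul_rpow_of_nonneg _ _ hq.le, ← ENNReal.rpow_mul, one_div_mul_cancel hq.ne',
        ENNReal.rpow_one]
    simp only [e2, e3]
    have e4 : (C * h z ^ q) ^ (1 / q * p) = C ^ (p / q) * h z ^ p := by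
      rw [ENNReal.mul_rpow_of_nonneg _ _ (by positivity), ← ENNReal.rpow_mul]
      congr 2 <;> field_simp
    calc _ ≤ (∫⁻ w, K z w * g w ∂μ) * (C * h z ^ q) ^ (1 / q * p) := by gcongr
      _ = _ := by rw [e4]; ring
  calc ∫⁻ z, (∫⁻ w, K z w * f w ∂μ) ^ p ∂μ
      ≤ ∫⁻ z, C ^ (p / q) * (h z ^ p * ∫⁻ w, K z w * g w ∂μ) ∂μ := lintegral_mono_ae key
    _ ≤ C ^ (p / q) * ∫⁻ z, (∫⁻ w, h z ^ p * (K z w * g w) ∂μ) ∂μ := by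
        have hm : AEMeasurable (fun z => h z ^ p * ∫⁻ w, K z w * g w ∂μ) μ :=
          (hh.pow_const _).aemeasurable.mul (hK.mul hgm.comp_snd).lintegral_prod_right'
        rw [lintegral_const_mul'' _ hm]
        gcongr with z
        exact lintegral_const_mul_le _ _
    _ = C ^ (p / q) * ∫⁻ w, (∫⁻ z, h z ^ p * (K z w * g w) ∂μ) ∂μ := by
        rw [lintegral_lintegral_swap]
        exact (hh.pow_const _).aemeasurable.comp_fst.mul (hK.mul hgm.comp_snd)
    _ ≤ C ^ (p / q) * ∫⁻ w, C * f w ^ p ∂μ := by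
        refine mul_le_mul_right (lintegral_mono_ae ?_) _
        filter_upwards [h2, hh0, hK''] with w hw hw0 hKw
        have hg0 : h w ^ p * g w = f w ^ p := by
          rw [hg, ← ENNReal.mul_rpow_of_nonneg _ _ hp.le, ← mul_assoc,
            ENNReal.mul_inv_cancel hw0.1 hw0.2, one_mul]
        have e : ∀ z, h z ^ p * (K z w * g w) = K z w * h z ^ p * g w := fun z => by ring
        simp only [e]
        have hm : AEMeasurable (fun z => K z w * h z ^ p) μ :=
          hKw.mul (hh.pow_const p).aemeasurable
        rw [lintegral_mul_const'' _ hm, ← hg0, ← mul_assoc]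
        exact mul_le_mul_left hw _
    _ = _ := by
        rw [lintegral_const_mul'' _ (hf.pow_const _), mul_assoc]

/-! ### A one-dimensional integral -/

lemma lintegral_rpow_div_le {s : ℝ} (h0 : 0 < s) (h1 : s < 1) {a : ℝ} (ha0 : 0 ≤ a) (ha1 : a < 1) :
    ∫⁻ r in Ioo (0 : ℝ) 1, ENNReal.ofReal ((1 - r) ^ (-s) / (1 - a * r)) ≤
      ENNReal.ofReal ((1 / (1 - s) + 1 / s) * (1 - a) ^ (-s)) := by
  set δ := 1 - a with hδ
  have hδ0 : 0 < δ := by linarith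
  have hδ1 : δ ≤ 1 := by linarith
  -- the integrand is compared with a power of `1 - r` on each side of `1 - r = δ`
  set F : ℝ → ℝ≥0∞ := fun t =>
    if t ≤ δ then ENNReal.ofReal (t ^ (-s) * δ⁻¹) else ENNReal.ofReal (t ^ (-s - 1)) with hF
  have hFm : Measurable F := Measurable.ite measurableSet_Iic (by fun_prop) (by fun_prop)
  have hpre : (fun t : ℝ => 1 - t) ⁻¹' Ioo (0 : ℝ) 1 = Ioo 0 1 := by
    ext t; simp only [mem_preimage, mem_Ioo]; constructor <;> rintro ⟨h, h'⟩ <;> constructor <;> linarith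
  have hsub := (Measure.measurePreserving_sub_left volume (1 : ℝ)).setLIntegral_comp_preimage
    (measurableSet_Ioo (a := (0 : ℝ)) (b := 1)) hFm
  rw [hpre] at hsub
  have i1 : ∫⁻ t in Ioc 0 δ, ENNReal.ofReal (t ^ (-s) * δ⁻¹) =
      ENNReal.ofReal (1 / (1 - s) * δ ^ (-s)) := by
    have hint : IntervalIntegrable (fun t : ℝ => t ^ (-s) * δ⁻¹) volume 0 δ :=
      (intervalIntegral.intervalIntegrable_rpow' (by linarith)).mul_const _
    rw [← ofReal_integral_eq_lintegral_ofReal ((intervalIntegrable_iff_integrableOn_Ioc_of_le hδ0.le).1 hint),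
      ← intervalIntegral.integral_of_le hδ0.le, intervalIntegral.integral_mul_const,
      integral_rpow (Or.inl (by linarith)), Real.zero_rpow (by linarith), Real.rpow_add_one hδ0.ne']
    · congr 1
      have : 1 - s ≠ 0 := by linarith
      have : -s + 1 ≠ 0 := by linarith
      field_simp
      ring
    · filter_upwards [ae_restrict_mem measurableSet_Ioc] with t ht
      exact mul_nonneg (Real.rpow_nonneg ht.1.le _) (by positivity)
  have i2 : ∫⁻ t in Ioc δ 1, ENNReal.ofReal (t ^ (-s - 1)) ≤ ENNReal.ofReal (1 / s * δ ^ (-s)) := by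
    have hn : (0 : ℝ) ∉ uIcc δ 1 := by
      rw [uIcc_of_le hδ1]; exact fun h => by linarith [h.1]
    have hint : IntervalIntegrable (fun t : ℝ => t ^ (-s - 1)) volume δ 1 :=
      intervalIntegral.intervalIntegrable_rpow (Or.inr hn)
    rw [← ofReal_integral_eq_lintegral_ofReal ((intervalIntegrable_iff_integrableOn_Ioc_of_le hδ1).1 hint),
      ← intervalIntegral.integral_of_le hδ1,
      integral_rpow (Or.inr ⟨by linarith, hn⟩), Real.one_rpow, sub_add_cancel]
    · refine ENNReal.ofReal_le_ofReal ?_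
      have hpos := Real.rpow_pos_of_pos hδ0 (-s)
      rw [div_neg, ← neg_div, one_div, inv_mul_eq_div]
      exact div_le_div_of_nonneg_right (by linarith) h0.le
    · filter_upwards [ae_restrict_mem measurableSet_Ioc] with t ht
      exact Real.rpow_nonneg (hδ0.trans ht.1).le _
  calc ∫⁻ r in Ioo (0 : ℝ) 1, ENNReal.ofReal ((1 - r) ^ (-s) / (1 - a * r))
      ≤ ∫⁻ r in Ioo (0 : ℝ) 1, F (1 - r) := by
        refine setLIntegral_mono (hFm.comp (measurable_const.sub measurable_id)) fun r hr => ?_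
        have hr0 : 0 < 1 - r := by linarith [hr.2]
        have b1 : δ ≤ 1 - a * r := by nlinarith [hr.1, hr.2]
        have b2 : 1 - r ≤ 1 - a * r := by nlinarith [hr.1, hr.2]
        have hp := Real.rpow_nonneg hr0.le (-s)
        simp only [hF]
        split_ifs with h
        · refine ENNReal.ofReal_le_ofReal ?_
          rw [← div_eq_mul_inv]
          exact div_le_div_of_nonneg_left hp hδ0 b1
        · refine ENNReal.ofReal_le_ofReal ?_
          rw [Real.rpow_sub_one hr0.ne']
          exact div_le_div_of_nonneg_left hp hr0 b2
    _ = ∫⁻ t in Ioo (0 : ℝ) 1, F t := hsub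
    _ ≤ ∫⁻ t in Ioc 0 δ ∪ Ioc δ 1, F t := by
        refine lintegral_mono_set ?_
        rw [Ioc_union_Ioc_eq_Ioc hδ0.le hδ1]
        exact Ioo_subset_Ioc_self
    _ ≤ (∫⁻ t in Ioc 0 δ, F t) + ∫⁻ t in Ioc δ 1, F t := lintegral_union_le _ _ _
    _ = (∫⁻ t in Ioc 0 δ, ENNReal.ofReal (t ^ (-s) * δ⁻¹)) +
          ∫⁻ t in Ioc δ 1, ENNReal.ofReal (t ^ (-s - 1)) := by
        congr 1
        · exact setLIntegral_congr_fun measurableSet_Ioc fun t ht => if_pos ht.2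
        · exact setLIntegral_congr_fun measurableSet_Ioc fun t ht => if_neg (not_le.2 ht.1)
    _ ≤ ENNReal.ofReal (1 / (1 - s) * δ ^ (-s)) + ENNReal.ofReal (1 / s * δ ^ (-s)) :=
        add_le_add i1.le i2
    _ = _ := by
        have : 0 ≤ δ ^ (-s) := Real.rpow_nonneg hδ0.le _
        have : 0 < 1 - s := by linarith
        rw [← ENNReal.ofReal_add (by positivity) (by positivity), add_mul]

/-! ### Weighted integrals of the kernel -/

lemma lintegral_radial_le {lam : ℝ} (hlam : 0 ≤ lam) {f : ℝ → ℝ≥0∞} (hf : Measurable f) :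
    ∫⁻ r, f r ∂radial lam ≤ ENNReal.ofReal (normConst lam) * ∫⁻ r in Ioo (0 : ℝ) 1, f r := by
  rw [radial, lintegral_withDensity_eq_lintegral_mul _
    (continuous_radialWeight hlam).measurable.ennreal_ofReal hf, ← lintegral_const_mul _ hf]
  refine setLIntegral_mono (measurable_const.mul hf) fun r hr => ?_
  simp only [Pi.mul_apply]
  gcongr
  refine mul_le_of_le_one_right (normConst_pos hlam).le ?_
  exact Real.rpow_le_one hr.1.le hr.2.le (by linarith)

lemma enorm_kernel_comm (lam : ℝ) (z w : ℂ) : ‖kernel lam z w‖ₑ = ‖kernel lam w z‖ₑ := by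
  rw [← conj_kernel lam w z, RCLike.enorm_conj]

/-- The Schur condition for the kernel with powers of `1 - |w|` as weights. -/
lemma lintegral_enorm_kernel_mul_le {lam : ℝ} (hlam : 0 ≤ lam) {s : ℝ} (h0 : 0 < s) (h1 : s < 1)
    {z : ℂ} (hz : z ∈ disk) :
    ∫⁻ w, ‖kernel lam z w‖ₑ * ENNReal.ofReal (1 - ‖w‖) ^ (-s) ∂sigma lam ≤
      ENNReal.ofReal (normConst lam * circMass lam * (1 / (1 - s) + 1 / s)) *
        ENNReal.ofReal (1 - ‖z‖) ^ (-s) := by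
  have hκ := circMass_pos hlam
  have hc := normConst_pos hlam
  have hz1 := mem_disk.1 hz
  refine (lintegral_sigma_le hlam _).trans ?_
  have hm : Measurable fun r : ℝ => ENNReal.ofReal (circMass lam) *
      ENNReal.ofReal ((1 - r) ^ (-s) / (1 - ‖z‖ * r)) := by fun_prop
  calc ∫⁻ r, ∫⁻ θ, ‖kernel lam z (r * cis θ)‖ₑ * ENNReal.ofReal (1 - ‖(r : ℂ) * cis θ‖) ^ (-s)
        ∂circ lam ∂radial lam
      ≤ ∫⁻ r, ENNReal.ofReal (circMass lam) * ENNReal.ofReal ((1 - r) ^ (-s) / (1 - ‖z‖ * r))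
        ∂radial lam := by
        refine lintegral_mono_ae ?_
        filter_upwards [ae_radial lam] with r hr
        have hr1 : 0 < 1 - r := by linarith [hr.2]
        have hzr : 0 < 1 - ‖z‖ * r := by
          nlinarith [norm_nonneg z, hr.1, hr.2]
        have hKc := continuous_kernel_circle hlam hz hr.1.le hr.2
        simp only [norm_real_mul_cis hr.1.le, enorm_kernel_comm lam z]
        rw [lintegral_mul_const'' _ hKc.enorm.aemeasurable, ENNReal.ofReal_rpow_of_pos hr1]
        have hb : ∫⁻ θ, ‖kernel lam (r * cis θ) z‖ₑ ∂circ lam ≤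
            ENNReal.ofReal (circMass lam / (1 - ‖z‖ * r)) := by
          rw [← ofReal_integral_norm_eq_lintegral_enorm (Continuous.integrable_circ hlam hKc)]
          exact ENNReal.ofReal_le_ofReal (integral_norm_kernel_circle_le hlam hz hr.1.le hr.2)
        refine (mul_le_mul_left hb _).trans_eq ?_
        rw [← ENNReal.ofReal_mul (by positivity), ← ENNReal.ofReal_mul hκ.le]
        congr 1
        ring
    _ ≤ ENNReal.ofReal (normConst lam) * ∫⁻ r in Ioo (0 : ℝ) 1, ENNReal.ofReal (circMass lam) *
        ENNReal.ofReal ((1 - r) ^ (-s) / (1 - ‖z‖ * r)) := lintegral_radial_le hlam hm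
    _ = ENNReal.ofReal (normConst lam) * ENNReal.ofReal (circMass lam) *
        ∫⁻ r in Ioo (0 : ℝ) 1, ENNReal.ofReal ((1 - r) ^ (-s) / (1 - ‖z‖ * r)) := by
        rw [lintegral_const_mul _ (by fun_prop), mul_assoc]
    _ ≤ ENNReal.ofReal (normConst lam) * ENNReal.ofReal (circMass lam) *
        ENNReal.ofReal ((1 / (1 - s) + 1 / s) * (1 - ‖z‖) ^ (-s)) := by
        gcongr
        exact lintegral_rpow_div_le h0 h1 (norm_nonneg z) hz1
    _ = _ := by
        have : 0 < 1 - s := by linarith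
        rw [ENNReal.ofReal_rpow_of_pos (by linarith), ← ENNReal.ofReal_mul hc.le,
          ← ENNReal.ofReal_mul (by positivity), ← ENNReal.ofReal_mul (by positivity)]
        congr 1
        ring

/-! ### Boundedness of the projection -/

lemma summable_kernelTerm {lam : ℝ} (hlam : 0 ≤ lam) {z w : ℂ} (hz : z ∈ disk) (hw : w ∈ disk) :
    Summable (kernelTerm lam z w) := by
  have := ((isCoefSeq_kernelCoef hlam hw).summable_norm hlam hz).of_norm
  simpa only [← kernelTerm_eq] using this

lemma continuous_kernelTerm {lam : ℝ} (hlam : 0 ≤ lam) (n : ℕ) :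
    Continuous fun x : ℂ × ℂ => kernelTerm lam x.1 x.2 n :=
  (continuous_const.mul ((continuous_phi hlam n).comp continuous_fst)).mul
    (Complex.continuous_conj.comp ((continuous_phi hlam n).comp continuous_snd))

lemma aemeasurable_kernel {lam : ℝ} (hlam : 0 ≤ lam) :
    AEMeasurable (fun x : ℂ × ℂ => kernel lam x.1 x.2) ((sigma lam).prod (sigma lam)) := by
  have := isFiniteMeasure_sigma hlam
  have hc : ∀ N, Continuous fun x : ℂ × ℂ => ∑ n ∈ Finset.range N, kernelTerm lam x.1 x.2 n :=
    fun N => continuous_finsetSum _ fun n _ => continuous_kernelTerm hlam n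
  refine aemeasurable_of_tendsto_metrizable_ae atTop (fun N => (hc N).measurable.aemeasurable) ?_
  filter_upwards [Measure.quasiMeasurePreserving_fst.ae (ae_sigma lam),
    Measure.quasiMeasurePreserving_snd.ae (ae_sigma lam)] with x h1 h2
  exact (summable_kernelTerm hlam h1 h2).hasSum.tendsto_sum_nat

lemma aemeasurable_kernel_right {lam : ℝ} (hlam : 0 ≤ lam) {z : ℂ} (hz : z ∈ disk) :
    AEMeasurable (kernel lam z) (sigma lam) := by
  refine aemeasurable_of_tendsto_metrizable_ae atTop
    (f := fun N w => ∑ n ∈ Finset.range N, kernelTerm lam z w n)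
    (fun N => (continuous_finsetSum _ fun n _ =>
      (continuous_kernelTerm hlam n).comp (Continuous.prodMk_right z)).aemeasurable) ?_
  filter_upwards [ae_sigma lam] with w hw
  exact (summable_kernelTerm hlam hz hw).hasSum.tendsto_sum_nat

/-- The positive operator with kernel `|K|` is bounded on `L^p`: the Schur test with the weight
`(1 - |w|) ^ (-1 / (p q))`. -/
lemma exists_lintegral_kernel_rpow_le {lam : ℝ} (hlam : 0 ≤ lam) {p : ℝ} (hp : 1 < p) :
    ∃ C : ℝ≥0∞, C ≠ ⊤ ∧ ∀ f : ℂ → ℝ≥0∞, AEMeasurable f (sigma lam) →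
      ∫⁻ z, (∫⁻ w, ‖kernel lam z w‖ₑ * f w ∂sigma lam) ^ p ∂sigma lam ≤
        C * ∫⁻ w, f w ^ p ∂sigma lam := by
  have := isFiniteMeasure_sigma hlam
  have hpq := Real.HolderConjugate.conjExponent hp
  set q := p.conjExponent
  have hp0 := hpq.pos
  have hq0 := hpq.symm.pos
  set A : ℝ → ℝ := fun s => normConst lam * circMass lam * (1 / (1 - s) + 1 / s) with hA
  set C : ℝ≥0∞ := ENNReal.ofReal (A (1 / p)) + ENNReal.ofReal (A (1 / q)) with hC
  have hCt : C ≠ ⊤ := by simp [hC]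
  have hm : Measurable fun z : ℂ => ENNReal.ofReal (1 - ‖z‖) ^ (-(1 / (p * q))) := by fun_prop
  have e1 : ∀ z : ℂ, (ENNReal.ofReal (1 - ‖z‖) ^ (-(1 / (p * q)))) ^ q =
      ENNReal.ofReal (1 - ‖z‖) ^ (-(1 / p)) := fun z => by
    rw [← ENNReal.rpow_mul]; congr 1; field_simp
  have e2 : ∀ z : ℂ, (ENNReal.ofReal (1 - ‖z‖) ^ (-(1 / (p * q)))) ^ p =
      ENNReal.ofReal (1 - ‖z‖) ^ (-(1 / q)) := fun z => by
    rw [← ENNReal.rpow_mul]; congr 1; field_simp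
  refine ⟨C ^ (p / q) * C, ENNReal.mul_ne_top (ENNReal.rpow_ne_top_of_nonneg (by positivity) hCt)
    hCt, fun f hf => ?_⟩
  refine lintegral_rpow_le_of_schur hpq (aemeasurable_kernel hlam).enorm ?_ ?_ hm ?_ ?_ ?_ hf
  · filter_upwards [ae_sigma lam] with z hz using (aemeasurable_kernel_right hlam hz).enorm
  · filter_upwards [ae_sigma lam] with w hw
    simpa only [enorm_kernel_comm lam _ w] using (aemeasurable_kernel_right hlam hw).enorm
  · filter_upwards [ae_sigma lam] with z hz
    have : 0 < 1 - ‖z‖ := by linarith [mem_disk.1 hz]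
    rw [ENNReal.ofReal_rpow_of_pos this]
    exact ⟨(ENNReal.ofReal_pos.2 (Real.rpow_pos_of_pos this _)).ne', ENNReal.ofReal_ne_top⟩
  · filter_upwards [ae_sigma lam] with z hz
    simp only [e1]
    refine (lintegral_enorm_kernel_mul_le hlam (by positivity)
      ((div_lt_one hp0).2 hp) hz).trans ?_
    exact mul_le_mul_left le_self_add _
  · filter_upwards [ae_sigma lam] with w hw
    simp only [e2, enorm_kernel_comm lam _ w]
    refine (lintegral_enorm_kernel_mul_le hlam (by positivity)
      ((div_lt_one hq0).2 hpq.symm.lt) hw).trans ?_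
    exact mul_le_mul_left le_add_self _

end LambdaBergman

namespace LambdaBergman

open Filter Topology Set

/-! ### The projection as a series of basic polynomials -/

lemma norm_kernelTerm_le {lam : ℝ} (hlam : 0 ≤ lam) (z : ℂ) {w : ℂ} (hw : w ∈ disk) (n : ℕ) :
    ‖kernelTerm lam z w n‖ ≤ ((n : ℝ) + 1) ^ (growthExp lam + 1 + growthExp lam) * ‖z‖ ^ n := by
  rw [kernelTerm_eq, norm_mul, pow_add, mul_assoc]
  refine mul_le_mul ?_ (norm_phi_le hlam n z) (norm_nonneg _) (by positivity)
  refine (norm_kernelCoef_le hlam w n).trans (mul_le_of_le_one_right (by positivity) ?_)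
  exact pow_le_one₀ (norm_nonneg w) (mem_disk.1 hw).le

lemma exists_norm_kernel_le {lam : ℝ} (hlam : 0 ≤ lam) {z : ℂ} (hz : z ∈ disk) :
    ∃ B : ℝ, ∀ w ∈ disk, ‖kernel lam z w‖ ≤ B :=
  ⟨_, fun _ hw => tsum_of_norm_bounded
    (summable_growth _ (norm_nonneg z) (mem_disk.1 hz)).hasSum
    fun n => norm_kernelTerm_le hlam z hw n⟩

lemma integrable_mul_kernel {lam : ℝ} (hlam : 0 ≤ lam) {f : ℂ → ℂ}
    (hf : Integrable f (sigma lam)) {z : ℂ} (hz : z ∈ disk) :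
    Integrable (fun w => f w * kernel lam z w) (sigma lam) := by
  obtain ⟨B, hB⟩ := exists_norm_kernel_le hlam hz
  refine hf.mul_bdd (c := B) (aemeasurable_kernel_right hlam hz).aestronglyMeasurable ?_
  filter_upwards [ae_sigma lam] with w hw using hB w hw

lemma integrable_mul_conj_phi {lam : ℝ} (hlam : 0 ≤ lam) {f : ℂ → ℂ}
    (hf : Integrable f (sigma lam)) (n : ℕ) :
    Integrable (fun w => f w * conj (phi lam n w)) (sigma lam) := by
  refine hf.mul_bdd (c := ((n : ℝ) + 1) ^ growthExp lam)
    (Complex.continuous_conj.comp (continuous_phi hlam n)).aestronglyMeasurable ?_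
  filter_upwards [ae_sigma lam] with w hw
  rw [RCLike.norm_conj]
  refine (norm_phi_le hlam n w).trans (mul_le_of_le_one_right (by positivity) ?_)
  exact pow_le_one₀ (norm_nonneg w) (mem_disk.1 hw).le

/-- The coefficients of the projection of `f` in the basic polynomials. -/
noncomputable def projCoef (lam : ℝ) (f : ℂ → ℂ) (n : ℕ) : ℂ :=
  ((((n : ℝ) + lam + 1) / (lam + 1) : ℝ) : ℂ) * ∫ w, f w * conj (phi lam n w) ∂sigma lam

lemma isCoefSeq_projCoef {lam : ℝ} (hlam : 0 ≤ lam) {f : ℂ → ℂ} (hf : Integrable f (sigma lam)) :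
    IsCoefSeq lam (projCoef lam f) := by
  refine IsCoefSeq.of_norm_le (C := ∫ w, ‖f w‖ ∂sigma lam) (m := growthExp lam + 1) fun n => ?_
  have h : ‖∫ w, f w * conj (phi lam n w) ∂sigma lam‖ ≤
      ((n : ℝ) + 1) ^ growthExp lam * ∫ w, ‖f w‖ ∂sigma lam := by
    rw [← integral_const_mul]
    refine (norm_integral_le_integral_norm _).trans (integral_mono_ae
      (integrable_mul_conj_phi hlam hf n).norm (hf.norm.const_mul _) ?_)
    filter_upwards [ae_sigma lam] with w hw
    rw [norm_mul, RCLike.norm_conj, mul_comm]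
    refine mul_le_mul_of_nonneg_right ((norm_phi_le hlam n w).trans ?_) (norm_nonneg _)
    exact mul_le_of_le_one_right (by positivity) (pow_le_one₀ (norm_nonneg w) (mem_disk.1 hw).le)
  rw [projCoef, norm_mul, Complex.norm_real, Real.norm_of_nonneg (kernelWeight_nonneg hlam n)]
  calc _ ≤ ((n : ℝ) + 1) * (((n : ℝ) + 1) ^ growthExp lam * ∫ w, ‖f w‖ ∂sigma lam) :=
        mul_le_mul (kernelWeight_le hlam n) h (norm_nonneg _) (by positivity)
    _ = _ := by rw [pow_succ']; ring

/-- The projection of `f` is a series of basic polynomials. -/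
lemma bergmanProj_eq_tsum {lam : ℝ} (hlam : 0 ≤ lam) {f : ℂ → ℂ} (hf : Integrable f (sigma lam))
    {z : ℂ} (hz : z ∈ disk) : bergmanProj lam f z = ∑' n, projCoef lam f n * phi lam n z := by
  have hint : ∀ n, Integrable (fun w => f w * kernelTerm lam z w n) (sigma lam) := fun n => by
    refine ((integrable_mul_conj_phi hlam hf n).const_mul
      (((((n : ℝ) + lam + 1) / (lam + 1) : ℝ) : ℂ) * phi lam n z)).congr ?_
    filter_upwards with w
    rw [kernelTerm]; ring
  have hs : Summable fun n => ∫ w, ‖f w * kernelTerm lam z w n‖ ∂sigma lam := by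
    refine Summable.of_nonneg_of_le (fun n => integral_nonneg fun w => norm_nonneg _) (fun n => ?_)
      ((summable_growth (growthExp lam + 1 + growthExp lam) (norm_nonneg z)
        (mem_disk.1 hz)).mul_right (∫ w, ‖f w‖ ∂sigma lam))
    rw [← integral_const_mul]
    refine integral_mono_ae (hint n).norm (hf.norm.const_mul _) ?_
    filter_upwards [ae_sigma lam] with w hw
    rw [norm_mul, mul_comm]
    exact mul_le_mul_of_nonneg_right (norm_kernelTerm_le hlam z hw n) (norm_nonneg _)
  have h := hasSum_integral_of_summable_integral_norm hint hs
  rw [bergmanProj]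
  simp only [kernel, ← tsum_mul_left]
  rw [← h.tsum_eq]
  congr 1
  ext n
  rw [projCoef, mul_assoc, mul_comm _ (phi lam n z), ← mul_assoc, ← integral_const_mul]
  congr 1
  ext w
  rw [kernelTerm]; ring

lemma IsLamAnalytic.congr {lam : ℝ} {f g : ℂ → ℂ} (hf : IsLamAnalytic lam f)
    (h : ∀ z ∈ disk, g z = f z) : IsLamAnalytic lam g := by
  refine ⟨hf.1.congr h, fun z hz => ?_⟩
  have hev : g =ᶠ[𝓝 z] f := by
    filter_upwards [isOpen_disk.mem_nhds hz] with x hx using h x hx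
  rw [← hf.2 z hz]
  simp only [dunklBar, dbar, reflQuotient, hev.fderiv_eq, h z hz, h _ (conj_mem_disk.2 hz)]

lemma isLamAnalytic_bergmanProj {lam : ℝ} (hlam : 0 ≤ lam) {f : ℂ → ℂ}
    (hf : Integrable f (sigma lam)) : IsLamAnalytic lam (bergmanProj lam f) :=
  ((isCoefSeq_projCoef hlam hf).isLamAnalytic hlam).congr fun _ hz => bergmanProj_eq_tsum hlam hf hz

lemma IsLamAnalytic.aestronglyMeasurable {lam : ℝ} {f : ℂ → ℂ} (hf : IsLamAnalytic lam f) :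
    AEStronglyMeasurable f (sigma lam) :=
  (hf.1.continuousOn.aestronglyMeasurable isOpen_disk.measurableSet).mono_ac
    (sigma_absolutelyContinuous lam)

/-- The bound `|P f| ≤ ∫ |K| |f|` reduces the claim to the positive operator. -/
lemma exists_eLpNorm_bergmanProj_le {lam : ℝ} (hlam : 0 ≤ lam) {p : ℝ≥0∞} (hp : 1 < p)
    (hp' : p ≠ ⊤) : ∃ C : ℝ≥0, ∀ f : ℂ → ℂ, AEStronglyMeasurable f (sigma lam) →
      eLpNorm (bergmanProj lam f) p (sigma lam) ≤ C * eLpNorm f p (sigma lam) := by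
  have hp1 : 1 < p.toReal := by
    rw [← ENNReal.toReal_one]
    exact (ENNReal.toReal_lt_toReal ENNReal.one_ne_top hp').2 hp
  have hp0 : 0 < p.toReal := by linarith
  have hpz : p ≠ 0 := (zero_lt_one.trans hp).ne'
  obtain ⟨C, hC, h⟩ := exists_lintegral_kernel_rpow_le hlam hp1
  have hC' : C ^ (1 / p.toReal) ≠ ⊤ := ENNReal.rpow_ne_top_of_nonneg (by positivity) hC
  refine ⟨(C ^ (1 / p.toReal)).toNNReal, fun f hf => ?_⟩
  rw [ENNReal.coe_toNNReal hC', eLpNorm_eq_lintegral_rpow_enorm_toReal hpz hp',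
    eLpNorm_eq_lintegral_rpow_enorm_toReal hpz hp', ← ENNReal.mul_rpow_of_nonneg _ _ (by positivity)]
  refine ENNReal.rpow_le_rpow (le_trans ?_ (h (fun w => ‖f w‖ₑ) hf.enorm)) (by positivity)
  refine lintegral_mono fun z => ENNReal.rpow_le_rpow ?_ hp0.le
  refine (enorm_integral_le_lintegral_enorm _).trans_eq ?_
  congr 1
  ext w
  rw [enorm_mul, mul_comm]

/-! ### Surjectivity -/

lemma integral_pow_radial {lam : ℝ} (hlam : 0 ≤ lam) (n : ℕ) :
    ∫ r, r ^ n * r ^ n ∂radial lam = normConst lam / (2 * (n + lam + 1)) := by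
  have hc := normConst_pos hlam
  rw [radial, integral_withDensity_eq_integral_toReal_smul
    (continuous_radialWeight hlam).measurable.ennreal_ofReal
    (by filter_upwards with r using ENNReal.ofReal_lt_top)]
  have e : ∫ r in Ioo (0 : ℝ) 1, (ENNReal.ofReal (normConst lam * r ^ (2 * lam + 1))).toReal •
      (r ^ n * r ^ n) = ∫ r in Ioo (0 : ℝ) 1, normConst lam * r ^ (2 * n + 2 * lam + 1) := by
    refine setIntegral_congr_fun measurableSet_Ioo fun r hr => ?_
    have hr0 : 0 < r := hr.1
    rw [ENNReal.toReal_ofReal (by positivity), smul_eq_mul, mul_assoc, ← Real.rpow_natCast,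
      ← Real.rpow_add hr0, ← Real.rpow_add hr0]
    congr 2
    ring
  have hn : (0 : ℝ) ≤ n := n.cast_nonneg
  rw [e, integral_const_mul, ← integral_Ioc_eq_integral_Ioo,
    ← intervalIntegral.integral_of_le zero_le_one, integral_rpow (Or.inl (by linarith)),
    Real.one_rpow, Real.zero_rpow (by linarith), sub_zero, mul_one_div]
  congr 1
  ring

/-- On the Bergman space the projection is multiplication by the total mass of `sigma lam`. This
constant is in fact `1`, but only its positivity matters for surjectivity. -/
lemma bergmanProj_eq_const_mul {lam : ℝ} (hlam : 0 ≤ lam) {g : ℂ → ℂ} (hg : IsLamAnalytic lam g)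
    (hgi : Integrable g (sigma lam)) {z : ℂ} (hz : z ∈ disk) :
    bergmanProj lam g z =
      ((circMass lam * normConst lam / (2 * (lam + 1)) : ℝ) : ℂ) * g z := by
  obtain ⟨a, ha, hag⟩ := hg.isOffReal.expansion hlam
  have hco : ∀ n, ∫ w, g w * conj (phi lam n w) ∂sigma lam =
      ((circMass lam * normConst lam / (2 * (n + lam + 1)) : ℝ) : ℂ) * a n := fun n => by
    rw [integral_sigma hlam (integrable_mul_conj_phi hlam hgi n)]
    have e : ∀ᵐ r : ℝ ∂radial lam, ∫ θ, g (r * cis θ) * conj (phi lam n (r * cis θ)) ∂circ lam =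
        (circMass lam * a n) * ((r ^ n * r ^ n : ℝ) : ℂ) := by
      filter_upwards [ae_radial lam] with r hr
      have h := ha.circPair_conj_phi hlam n hr.1.le hr.2
      rw [circPair] at h
      have e2 : ∀ θ, g (r * cis θ) * conj (phi lam n (r * cis θ)) = (r : ℂ) ^ n *
          ((∑' n, a n * phi lam n (r * cis θ)) * conj (phi lam n (cis θ))) := fun θ => by
        rw [hag _ (real_mul_cis_mem_disk hr.1.le hr.2 θ), phi_real_mul lam n, map_mul, map_pow,
          Complex.conj_ofReal]
        ring
      simp only [e2]
      rw [integral_const_mul, h]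
      push_cast
      ring
    rw [integral_congr_ae e, integral_const_mul, integral_complex_ofReal, integral_pow_radial hlam]
    push_cast
    ring
  rw [bergmanProj_eq_tsum hlam hgi hz, hag z hz, ← tsum_mul_left]
  congr 1
  ext n
  have h1 : (lam : ℂ) + 1 ≠ 0 := by
    have : lam + 1 ≠ 0 := by linarith
    exact_mod_cast this
  have h2 : (n : ℂ) + lam + 1 ≠ 0 := by
    have : (n : ℝ) + lam + 1 ≠ 0 := by positivity
    exact_mod_cast this
  rw [projCoef, hco n]
  push_cast
  field_simp

end LambdaBergman

theorem mainTheorem1 (lam : ℝ) (hlam : 0 ≤ lam) (p : ℝ≥0∞) (hp : 1 < p) (hp' : p ≠ ⊤) :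
    -- the series of the kernel converges absolutely
    (∀ z ∈ LambdaBergman.disk, ∀ w ∈ LambdaBergman.disk,
      Summable (LambdaBergman.kernelTerm lam z w)) ∧
    -- the integral that defines the projection converges at every point of the disk
    (∀ f : ℂ → ℂ, MemLp f p (LambdaBergman.sigma lam) → ∀ z ∈ LambdaBergman.disk,
      Integrable (fun w => f w * LambdaBergman.kernel lam z w) (LambdaBergman.sigma lam)) ∧
    -- linearity
    (∀ f g : ℂ → ℂ, MemLp f p (LambdaBergman.sigma lam) → MemLp g p (LambdaBergman.sigma lam) →
      ∀ a b : ℂ, ∀ z ∈ LambdaBergman.disk,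
        LambdaBergman.bergmanProj lam (fun w => a * f w + b * g w) z =
          a * LambdaBergman.bergmanProj lam f z + b * LambdaBergman.bergmanProj lam g z) ∧
    -- the projection maps into the Bergman space and is bounded
    (∃ C : ℝ≥0, ∀ f : ℂ → ℂ, MemLp f p (LambdaBergman.sigma lam) →
      LambdaBergman.bergmanProj lam f ∈ LambdaBergman.bergmanSpace lam p ∧
      eLpNorm (LambdaBergman.bergmanProj lam f) p (LambdaBergman.sigma lam) ≤
        C * eLpNorm f p (LambdaBergman.sigma lam)) ∧
    -- the projection is onto the Bergman space
    (∀ g ∈ LambdaBergman.bergmanSpace lam p, ∃ f : ℂ → ℂ, MemLp f p (LambdaBergman.sigma lam) ∧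
      ∀ z ∈ LambdaBergman.disk, LambdaBergman.bergmanProj lam f z = g z) := by
  have := LambdaBergman.isFiniteMeasure_sigma hlam
  have hint : ∀ f : ℂ → ℂ, MemLp f p (LambdaBergman.sigma lam) →
      Integrable f (LambdaBergman.sigma lam) := fun f hf => hf.integrable hp.le
  refine ⟨fun z hz w hw => LambdaBergman.summable_kernelTerm hlam hz hw,
    fun f hf z hz => LambdaBergman.integrable_mul_kernel hlam (hint f hf) hz,
    fun f g hf hg a b z hz => ?_, ?_, fun g hg => ?_⟩
  · simp only [LambdaBergman.bergmanProj, add_mul, mul_assoc]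
    rw [integral_add, integral_const_mul, integral_const_mul]
    · exact (LambdaBergman.integrable_mul_kernel hlam (hint f hf) hz).const_mul a
    · exact (LambdaBergman.integrable_mul_kernel hlam (hint g hg) hz).const_mul b
  · obtain ⟨C, hC⟩ := LambdaBergman.exists_eLpNorm_bergmanProj_le hlam hp hp'
    refine ⟨C, fun f hf => ?_⟩
    have ha := LambdaBergman.isLamAnalytic_bergmanProj hlam (hint f hf)
    have hb := hC f hf.aestronglyMeasurable
    exact ⟨⟨ha, ha.aestronglyMeasurable,
      hb.trans_lt (ENNReal.mul_lt_top ENNReal.coe_lt_top hf.eLpNorm_lt_top)⟩, hb⟩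
  · set γ : ℂ := ((LambdaBergman.circMass lam * LambdaBergman.normConst lam /
      (2 * (lam + 1)) : ℝ) : ℂ) with hγ
    have hγ0 : γ ≠ 0 := by
      have h1 := LambdaBergman.circMass_pos hlam
      have h2 := LambdaBergman.normConst_pos hlam
      rw [hγ, Complex.ofReal_ne_zero]
      positivity
    refine ⟨fun w => γ⁻¹ * g w, hg.2.const_mul _, fun z hz => ?_⟩
    have h := LambdaBergman.bergmanProj_eq_const_mul hlam hg.1 (hint g hg.2) hz
    rw [LambdaBergman.bergmanProj] at h ⊢
    simp only [mul_assoc]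
    rw [integral_const_mul, h, ← hγ, inv_mul_cancel_left₀ hγ0]
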